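/- Let $G$ be a fixed finite simple graph with at least one edge, and let $v(H)$, $e(H)$ denote the numbers of vertices and edges of a graph $H$. For $N\ge v(G)$ and $0<p<1$, let $\mathcal G(N,p)$ be the Erdős–Rényi random graph on $N$ labelled vertices, in which each of the $\binom N2$ possible edges is present independently with probability $p$. Let $S_N$ be the number of copies (not necessarily induced) of $G$ in $\mathcal G(N,p)$, that is, the number of subgraphs of $\mathcal G(N,p)$ isomorphic to $G$; put $\mu_N=\mathbb E S_N$, $\sigma_N=\sqrt{\operatorname{Var}(S_N)}$, $W_N=(S_N-\mu_N)/\sigma_N$, and let $\Phi$ be the standard normal distribution function. Let $$\psi=\min_{H\subset G,\ e(H)>0} N^{v(H)}p^{e(H)},$$ and, for $z\ge 0$, $$b_N(p,z)=\begin{cases}\psi^{-1/2}(1+z), & 0<p\le 1/2,\\ N^{-1}(1-p)^{-1/2}\bigl(1+(1-p)^{-1/2}z\bigr), & 1/2<p<1.\end{cases}$$ There is a constant $C>0$ depending only on $G$ such that, for all $N\ge v(G)$ and all $0<p<1$: 1. $$\sup_{z\in\mathbb R}\bigl|\mathbb P(W_N\le z)-\Phi(z)\bigr|\le\begin{cases}C\psi^{-1/2},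 & 0<p\le 1/2,\\ C N^{-1}(1-p)^{-1/2}, & 1/2<p<1;\end{cases}$$ 2. for every $z$ with $0\le z\le (1-p)N^2p^{e(G)}\psi^{-1/2}$ and $(1+z^2)\,b_N(p,z)\le 1$, $$\left|\frac{\mathbb P(W_N>z)}{1-\Phi(z)}-1\right|\le C\,(1+z^2)\,b_N(p,z).$$ -/

import Mathlib

open MeasureTheory ProbabilityTheory

noncomputable section

namespace SubgraphCount

/-- `ψ = min N^{v(H)} p^{e(H)}`, the minimum being over all subgraphs `H` of `G` with at least one
edge. (The family is finite, and it is nonempty as soon as `G` has an edge, so that the infimum is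
attained: see `psi_isLeast`.) -/
def psi {V : Type*} (G : SimpleGraph V) (N : ℕ) (p : ℝ) : ℝ :=
  ⨅ H : {H : G.Subgraph // H.edgeSet.Nonempty},
    (N : ℝ) ^ H.1.verts.ncard * p ^ H.1.edgeSet.ncard

theorem psi_isLeast {V : Type*} [Finite V] (G : SimpleGraph V) (hG : G.edgeSet.Nonempty)
    (N : ℕ) (p : ℝ) :
    IsLeast {x : ℝ | ∃ H : G.Subgraph, H.edgeSet.Nonempty ∧
      x = (N : ℝ) ^ H.verts.ncard * p ^ H.edgeSet.ncard} (psi G N p) := by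
  have : Nonempty {H : G.Subgraph // H.edgeSet.Nonempty} := ⟨⟨⊤, by simpa using hG⟩⟩
  have : Finite G.Subgraph := by
    have hinj : Function.Injective
        (fun H : G.Subgraph => ((H.verts, H.Adj) : Set V × (V → V → Prop))) := by
      intro H K h
      rw [Prod.mk.injEq] at h
      exact SimpleGraph.Subgraph.ext h.1 h.2
    exact Finite.of_injective _ hinj
  constructor
  · obtain ⟨H, hH⟩ := exists_eq_ciInf_of_finite
      (f := fun H : {H : G.Subgraph // H.edgeSet.Nonempty} =>
        (N : ℝ) ^ H.1.verts.ncard * p ^ H.1.edgeSet.ncard)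
    exact ⟨H.1, H.2, hH.symm⟩
  · rintro x ⟨H, hH, rfl⟩
    exact ciInf_le (Set.finite_range _).bddBelow
      (⟨H, hH⟩ : {H : G.Subgraph // H.edgeSet.Nonempty})

/-- The number of (not necessarily induced) copies of `G` in the graph `Γ` on `N` vertices. -/
def S {V : Type*} (G : SimpleGraph V) {N : ℕ} (Γ : SimpleGraph (Fin N)) : ℝ :=
  (Γ.copyCount G : ℝ)

/-- The mean of the number of copies of `G` in the Erdős–Rényi graph `G(N, p)`, whose law is
`SimpleGraph.binomialRandom (Fin N) p`. -/
def mean {V : Type*} (G : SimpleGraph V) (N : ℕ) (p : unitInterval) : ℝ :=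
  ∫ Γ, S G Γ ∂(SimpleGraph.binomialRandom (Fin N) p)

/-- The standard deviation of the number of copies of `G` in `G(N, p)`. -/
def sd {V : Type*} (G : SimpleGraph V) (N : ℕ) (p : unitInterval) : ℝ :=
  √(variance (fun Γ => S G Γ) (SimpleGraph.binomialRandom (Fin N) p))

/-- The standardized number of copies of `G`, as a random variable on the space of graphs on
`N` vertices with the law of `G(N, p)`. -/
def W {V : Type*} (G : SimpleGraph V) (N : ℕ) (p : unitInterval) (Γ : SimpleGraph (Fin N)) : ℝ :=
  (S G Γ - mean G N p) / sd G N p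

/-- The standard normal distribution function. -/
def Phi (z : ℝ) : ℝ := cdf (gaussianReal 0 1) z

/-- The order of the Berry–Esseen bound. -/
def berryEsseenRate {V : Type*} (G : SimpleGraph V) (N : ℕ) (p : ℝ) : ℝ :=
  if p ≤ 1 / 2 then 1 / √(psi G N p) else 1 / ((N : ℝ) * √(1 - p))

/-- The quantity `b_N(p, z)` in the error term of the moderate deviation expansion. -/
def b {V : Type*} (G : SimpleGraph V) (N : ℕ) (p z : ℝ) : ℝ :=
  if p ≤ 1 / 2 then 1 / √(psi G N p) * (1 + z)
  else 1 / ((N : ℝ) * √(1 - p)) * (1 + z / √(1 - p))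

end SubgraphCount

end

/-! The proof is Stein's method run under an exponential tilt. Up to the factor 1/|Aut G|, which
standardization removes, the number of copies is the sum over embeddings φ of the indicators that
the image of the edges of G lies in the random edge set A. Let W be the standardized sum and H(t) =
E e^{tW}.

Conditioning on `s i ⊆ A` amounts to passing from A to `A ∪ s i`, and this gives the size-bias
identity `size_bias` for E[W g(W)]. A first-order expansion leaves two errors: a random factor
`steinVar` with mean 1 in front of g', and a remainder. When g' is a difference of increasing
functions with sum M, undoing the coupling rewrites the remainder bound as E[`steinRem` · M(W)]
(`expect_steinRem_mul`), where `steinRem` is again a centred sum of local terms. Hence no third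
moment of the jumps is needed: both errors are controlled by tilted first moments of centred local
sums.

Those moments are bounded by Cauchy–Schwarz and a tilted second moment. Pairs of terms with
overlapping supports are estimated by their size; pairs with disjoint supports decorrelate because
only the mixed second difference of e^{tW} survives (`expect_mul_mul_exp_le`). The range of z
ensures that deleting boundedly many edges changes tW by O(1) (`mul_loss_edgeImage_le`). The
resulting sums need upper bounds for overlapping embeddings (`sum_meets_edgeImage_le`) and a lower
bound for the variance (`cvar_edgeImage_ge`), both expressed through ψ. They yield an error ε of
order (ψ(1-p))^{-1/2}(1 + z(1-p)^{-1/2}), which is O(b).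

With the shifted Stein solution times e^{tw} as test function, the law tilted by t is within (8 +
6t)ε of N(t, 1) in Kolmogorov distance (`abs_tilted_cdf_sub_le`); t = 0 is the Berry–Esseen bound.
With e^{tw} itself as test function, log H(z) = z²/2 + O(z²ε). Undoing the tilt at t = z by
integrating against z e^{-zx} gives the relative error of the tail (`abs_tail_div_sub_one_le`). For
ψ ≤ 1 the rates are bounded below and crude bounds suffice. -/

namespace SubgraphCount

open Finset

set_option linter.unusedSectionVars false

/-! ### Expectations over a binomial random subset, and independence of local functions. -/

section RandomSubset

variable {E : Type*} [Fintype E] [DecidableEq E]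

/-- The expectation of `F` at the random subset of `E` containing each element independently with
probability `p`. -/
noncomputable def expect (p : ℝ) (F : Finset E → ℝ) : ℝ :=
  ∑ A, p ^ #A * (1 - p) ^ #Aᶜ * F A

/-- The function `F` of a set only depends on the part of the set in `B`. -/
def LocalOn {β : Type*} (B : Finset E) (F : Finset E → β) : Prop := ∀ A, F (A ∩ B) = F A

/-- The indicator of the event that the random set contains `B`. -/
def ind (B A : Finset E) : ℝ := if B ⊆ A then 1 else 0

variable {p : ℝ} {F G : Finset E → ℝ} {B C : Finset E}

theorem expect_add (F G : Finset E → ℝ) :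
    expect p (fun A => F A + G A) = expect p F + expect p G := by
  simp only [expect, mul_add, sum_add_distrib]

theorem expect_sub (F G : Finset E → ℝ) :
    expect p (fun A => F A - G A) = expect p F - expect p G := by
  simp only [expect, mul_sub, sum_sub_distrib]

theorem expect_const_mul (c : ℝ) (F : Finset E → ℝ) :
    expect p (fun A => c * F A) = c * expect p F := by
  simp only [expect, mul_sum]
  exact sum_congr rfl fun _ _ => by ring

theorem expect_sum {ι : Type*} (s : Finset ι) (F : ι → Finset E → ℝ) :
    expect p (fun A => ∑ i ∈ s, F i A) = ∑ i ∈ s, expect p (F i) := by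
  simp only [expect, mul_sum]
  exact sum_comm

theorem weight_nonneg (h0 : 0 ≤ p) (h1 : p ≤ 1) (A : Finset E) :
    0 ≤ p ^ #A * (1 - p) ^ #Aᶜ :=
  mul_nonneg (pow_nonneg h0 _) (pow_nonneg (sub_nonneg.2 h1) _)

theorem expect_mono (h0 : 0 ≤ p) (h1 : p ≤ 1) (h : ∀ A, F A ≤ G A) :
    expect p F ≤ expect p G :=
  sum_le_sum fun A _ => mul_le_mul_of_nonneg_left (h A) (weight_nonneg h0 h1 A)

theorem expect_nonneg (h0 : 0 ≤ p) (h1 : p ≤ 1) (h : ∀ A, 0 ≤ F A) : 0 ≤ expect p F :=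
  sum_nonneg fun A _ => mul_nonneg (weight_nonneg h0 h1 A) (h A)

theorem abs_expect_le (h0 : 0 ≤ p) (h1 : p ≤ 1) (F : Finset E → ℝ) :
    |expect p F| ≤ expect p (fun A => |F A|) := by
  refine (abs_sum_le_sum_abs _ _).trans (sum_le_sum fun A _ => ?_)
  rw [abs_mul, abs_of_nonneg (weight_nonneg h0 h1 A)]

theorem expect_one : expect p (fun _ : Finset E => 1) = 1 := by
  simp only [expect, mul_one]
  have := Finset.sum_pow_mul_eq_add_pow p (1 - p) (univ : Finset E)
  simp only [add_sub_cancel, one_pow, powerset_univ] at this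
  refine Eq.trans (sum_congr rfl fun A _ => ?_) this
  rw [card_compl, card_univ]

theorem expect_const (c : ℝ) : expect p (fun _ : Finset E => c) = c := by
  have := expect_const_mul (p := p) c (fun _ : Finset E => 1)
  simpa [expect_one] using this

/-- Cauchy–Schwarz for a weighted expectation. -/
theorem sq_expect_mul_le (h0 : 0 ≤ p) (h1 : p ≤ 1) (F G : Finset E → ℝ) (hG : ∀ A, 0 ≤ G A) :
    expect p (fun A => |F A| * G A) ^ 2 ≤ expect p (fun A => F A ^ 2 * G A) * expect p G := by
  have := sum_mul_sq_le_sq_mul_sq univ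
    (fun A : Finset E => |F A| * √(p ^ #A * (1 - p) ^ #Aᶜ * G A))
    (fun A => √(p ^ #A * (1 - p) ^ #Aᶜ * G A))
  have hw : ∀ A : Finset E, √(p ^ #A * (1 - p) ^ #Aᶜ * G A) ^ 2 = p ^ #A * (1 - p) ^ #Aᶜ * G A :=
    fun A => Real.sq_sqrt (mul_nonneg (weight_nonneg h0 h1 A) (hG A))
  simp only [mul_pow, hw, sq_abs] at this
  have e1 : ∀ A : Finset E, |F A| * √(p ^ #A * (1 - p) ^ #Aᶜ * G A) *
      √(p ^ #A * (1 - p) ^ #Aᶜ * G A) = p ^ #A * (1 - p) ^ #Aᶜ * (|F A| * G A) := fun A => by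
    rw [mul_assoc, ← sq, hw]; ring
  have e2 : ∀ A : Finset E, F A ^ 2 * (p ^ #A * (1 - p) ^ #Aᶜ * G A) =
      p ^ #A * (1 - p) ^ #Aᶜ * (F A ^ 2 * G A) := fun A => by ring
  simp only [e1, e2] at this
  exact this

theorem sum_univ_split (B : Finset E) (H : Finset E → ℝ) :
    ∑ A, H A = ∑ x ∈ B.powerset ×ˢ Bᶜ.powerset, H (x.1 ∪ x.2) := by
  refine sum_nbij' (fun A => (A ∩ B, A ∩ Bᶜ)) (fun x => x.1 ∪ x.2) ?_ ?_ ?_ ?_ ?_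
  · intro A _; simp [inter_subset_right]
  · intro x _; simp
  · intro A _; simp [← inter_union_distrib_left]
  · rintro ⟨x, y⟩ h
    simp only [mem_product, mem_powerset] at h
    have h1 : Disjoint x Bᶜ := disjoint_compl_right.mono_left h.1
    have h2 : Disjoint y B := disjoint_compl_left.mono_left h.2
    ext a
    · simp only [mem_inter, mem_union]
      exact ⟨fun ⟨h3, h4⟩ => h3.resolve_right fun h5 => disjoint_left.1 h2 h5 h4,
        fun h3 => ⟨Or.inl h3, h.1 h3⟩⟩
    · simp only [mem_inter, mem_union]
      exact ⟨fun ⟨h3, h4⟩ => h3.resolve_left fun h5 => disjoint_left.1 h1 h5 h4,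
        fun h3 => ⟨Or.inr h3, h.2 h3⟩⟩
  · intro A _; simp [← inter_union_distrib_left]

theorem sum_weight_powerset (B : Finset E) :
    ∑ A ∈ B.powerset, p ^ #A * (1 - p) ^ #(B \ A) = 1 := by
  have := Finset.sum_pow_mul_eq_add_pow p (1 - p) B
  simp only [add_sub_cancel, one_pow] at this
  refine Eq.trans (sum_congr rfl fun A hA => ?_) this
  rw [card_sdiff_of_subset (mem_powerset.1 hA)]

/-- The weight of a set is the product of the weights of its parts in `B` and off `B`: independence
in finite form. -/
theorem expect_mul_eq_sum (hF : LocalOn B F) (hG : LocalOn Bᶜ G) :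
    expect p (fun A => F A * G A) =
      (∑ A ∈ B.powerset, p ^ #A * (1 - p) ^ #(B \ A) * F A) *
        ∑ A ∈ Bᶜ.powerset, p ^ #A * (1 - p) ^ #(Bᶜ \ A) * G A := by
  rw [expect, sum_univ_split B, sum_mul_sum, sum_product]
  refine sum_congr rfl fun x hx => sum_congr rfl fun y hy => ?_
  rw [mem_powerset] at hx hy
  have h1 : Disjoint x y := (disjoint_compl_right (a := B)).mono hx hy
  have h2 : (x ∪ y)ᶜ = (B \ x) ∪ (Bᶜ \ y) := by
    ext a
    simp only [mem_compl, mem_union, mem_sdiff, not_or]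
    have := @hx a; have := @hy a; simp only [mem_compl] at this
    tauto
  have h3 : Disjoint (B \ x) (Bᶜ \ y) :=
    (disjoint_compl_right (a := B)).mono sdiff_subset sdiff_subset
  have h4 : F (x ∪ y) = F x := by
    rw [← hF (x ∪ y), union_inter_distrib_right, inter_eq_left.2 hx,
      disjoint_iff_inter_eq_empty.1 ((disjoint_compl_left (a := B)).mono_left hy), union_empty]
  have h5 : G (x ∪ y) = G y := by
    rw [← hG (x ∪ y), union_inter_distrib_right, inter_eq_left.2 hy,
      disjoint_iff_inter_eq_empty.1 ((disjoint_compl_right (a := B)).mono_left hx), empty_union]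
  rw [h4, h5, h2, card_union_of_disjoint h1, card_union_of_disjoint h3, pow_add, pow_add]
  ring

theorem LocalOn.const {β : Type*} (B : Finset E) (c : β) : LocalOn B (fun _ => c) := fun _ => rfl

theorem LocalOn.mono {β : Type*} {F : Finset E → β} (hF : LocalOn B F) (h : B ⊆ C) :
    LocalOn C F := fun A => by
  rw [← hF (A ∩ C), ← hF A, inter_assoc, inter_eq_right.2 h]

theorem LocalOn.comp₂ {β γ δ : Type*} {F : Finset E → β} {G : Finset E → γ} (f : β → γ → δ)
    (hF : LocalOn B F) (hG : LocalOn B G) : LocalOn B (fun A => f (F A) (G A)) := fun A => by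
  simp only [hF A, hG A]

theorem LocalOn.comp {β γ : Type*} {F : Finset E → β} (f : β → γ) (hF : LocalOn B F) :
    LocalOn B (fun A => f (F A)) := fun A => by
  simp only [hF A]

theorem LocalOn.mul (hF : LocalOn B F) (hG : LocalOn B G) : LocalOn B (fun A => F A * G A) :=
  hF.comp₂ _ hG

theorem expect_eq_sum (hF : LocalOn B F) :
    expect p F = ∑ A ∈ B.powerset, p ^ #A * (1 - p) ^ #(B \ A) * F A := by
  have := expect_mul_eq_sum (p := p) hF (LocalOn.const Bᶜ (1 : ℝ))
  simpa [sum_weight_powerset] using this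

theorem expect_mul_of_local (hF : LocalOn B F) (hG : LocalOn C G) (h : Disjoint B C) :
    expect p (fun A => F A * G A) = expect p F * expect p G := by
  have hG' : LocalOn Bᶜ G := hG.mono (by rwa [subset_compl_comm, subset_compl_iff_disjoint_right])
  rw [expect_mul_eq_sum hF hG', expect_eq_sum hF, expect_eq_sum hG']

theorem ind_nonneg (B A : Finset E) : 0 ≤ ind B A := by
  unfold ind; split_ifs <;> norm_num

theorem ind_le_one (B A : Finset E) : ind B A ≤ 1 := by
  unfold ind; split_ifs <;> norm_num

theorem ind_mul_ind (B C A : Finset E) : ind B A * ind C A = ind (B ∪ C) A := by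
  unfold ind
  by_cases h1 : B ⊆ A <;> by_cases h2 : C ⊆ A <;> simp [h1, h2, union_subset_iff]

theorem ind_empty (A : Finset E) : ind ∅ A = 1 := by simp [ind]

theorem ind_mono (B : Finset E) {A A' : Finset E} (h : A ⊆ A') : ind B A ≤ ind B A' := by
  unfold ind
  by_cases h1 : B ⊆ A
  · simp [h1, h1.trans h]
  · simp only [h1, if_false]; split_ifs <;> norm_num

theorem ind_union_right (B C A : Finset E) : ind B (A ∪ C) = ind (B \ C) A := by
  have : B ⊆ A ∪ C ↔ B \ C ⊆ A := by rw [union_comm]; exact sdiff_le_iff.symm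
  simp only [ind, this]

theorem localOn_ind (B : Finset E) : LocalOn B (ind B) := fun A => by
  simp [ind, subset_inter_iff]

theorem expect_ind (B : Finset E) : expect p (ind B) = p ^ #B := by
  rw [expect_eq_sum (localOn_ind B), sum_eq_single B]
  · simp [ind]
  · intro A hA hAB
    rw [mem_powerset] at hA
    have : ¬B ⊆ A := fun h => hAB (hA.antisymm h)
    simp [ind, this]
  · simp

theorem localOn_union (F : Finset E → ℝ) (B : Finset E) : LocalOn Bᶜ (fun A => F (A ∪ B)) :=
  fun A => by
    refine congrArg F ?_
    ext a; simp only [mem_union, mem_inter, mem_compl]; tauto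

theorem localOn_sdiff (F : Finset E → ℝ) (B : Finset E) : LocalOn Bᶜ (fun A => F (A \ B)) :=
  fun A => by
    refine congrArg F ?_
    ext a; simp only [mem_sdiff, mem_inter, mem_compl]; tauto

/-- Conditioning on `B ⊆ A` does not affect the part of `A` off `B`, so the conditional law of `A`
is the law of `A ∪ B`. All size-bias couplings come from this. -/
theorem expect_ind_mul (B : Finset E) (F : Finset E → ℝ) :
    expect p (fun A => ind B A * F A) = p ^ #B * expect p (fun A => F (A ∪ B)) := by
  rw [← expect_ind, ← expect_mul_of_local (localOn_ind B) (localOn_union F B) disjoint_compl_right]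
  congr 1; ext A
  unfold ind
  split_ifs with h
  · rw [union_eq_left.2 h]
  · simp

end RandomSubset

end SubgraphCount

namespace SubgraphCount

open Finset

set_option linter.unusedSectionVars false

/-! ### The size-bias coupling and the first-order Stein identity. -/

section SizeBias

variable {E : Type*} [Fintype E] [DecidableEq E] {I : Type*} [Fintype I]

/-- The number of indices `i` such that the set `s i` is contained in `A`. -/
def count (s : I → Finset E) (A : Finset E) : ℝ := ∑ i, ind (s i) A

/-- The mean of `count s`. -/
def cmean (p : ℝ) (s : I → Finset E) : ℝ := ∑ i, p ^ #(s i)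

/-- The variance of `count s`. -/
def cvar (p : ℝ) (s : I → Finset E) : ℝ :=
  ∑ i, ∑ j, (p ^ #(s i ∪ s j) - p ^ (#(s i) + #(s j)))

/-- The standardized `count s`. -/
noncomputable def std (p : ℝ) (s : I → Finset E) (A : Finset E) : ℝ :=
  (count s A - cmean p s) / √(cvar p s)

/-- The increment of `ind (s j)` when `s i` is added to the random set. -/
def gain (s : I → Finset E) (i j : I) (A : Finset E) : ℝ :=
  ind (s j \ s i) A * (1 - ind (s i ∩ s j) A)

/-- The random variable multiplying the derivative in the first order expansion of the Stein
identity. -/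
noncomputable def steinVar (p : ℝ) (s : I → Finset E) (A : Finset E) : ℝ :=
  (cvar p s)⁻¹ * ∑ i, ∑ j, p ^ #(s i) * gain s i j A

/-- The random variable controlling the remainder in the first order expansion of the Stein
identity. -/
noncomputable def steinRem (p : ℝ) (s : I → Finset E) (A : Finset E) : ℝ :=
  (cvar p s)⁻¹ * ∑ i, ∑ j,
    (ind (s i) A * (ind (s j \ s i) A * (1 - p ^ #(s i ∩ s j))) - p ^ #(s i) * gain s i j A)

variable {p : ℝ} {s : I → Finset E}

theorem gain_nonneg (i j : I) (A : Finset E) : 0 ≤ gain s i j A :=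
  mul_nonneg (ind_nonneg _ _) (sub_nonneg.2 (ind_le_one _ _))

theorem ind_union_sub (i j : I) (A : Finset E) :
    ind (s j) (A ∪ s i) - ind (s j) A = gain s i j A := by
  have : ind (s j) A = ind (s j \ s i) A * ind (s i ∩ s j) A := by
    rw [ind_mul_ind, inter_comm, sdiff_union_inter]
  rw [ind_union_right, this, gain]; ring

theorem std_union (i : I) (A : Finset E) :
    std p s (A ∪ s i) = std p s A + (√(cvar p s))⁻¹ * ∑ j, gain s i j A := by
  simp only [← ind_union_sub, sum_sub_distrib, std, count]
  ring

theorem le_std_union (i : I) (A : Finset E) : std p s A ≤ std p s (A ∪ s i) := by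
  rw [std_union]
  have : 0 ≤ (√(cvar p s))⁻¹ * ∑ j, gain s i j A :=
    mul_nonneg (by positivity) (sum_nonneg fun j _ => gain_nonneg i j A)
  linarith

theorem std_mono {A A' : Finset E} (h : A ⊆ A') : std p s A ≤ std p s A' := by
  unfold std count
  gcongr with i _
  exact ind_mono _ h

/-- Each centred indicator in the leading factor `std` is traded, by `expect_ind_mul`, for an
increment of `g` along the coupling of `A` with `A ∪ s i`. -/
theorem size_bias (g : ℝ → ℝ) :
    expect p (fun A => std p s A * g (std p s A)) =
      (√(cvar p s))⁻¹ * ∑ i, p ^ #(s i) *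
        expect p (fun A => g (std p s (A ∪ s i)) - g (std p s A)) := by
  have : ∀ A, std p s A * g (std p s A) = (√(cvar p s))⁻¹ *
      ∑ i, (ind (s i) A * g (std p s A) - p ^ #(s i) * g (std p s A)) := fun A => by
    rw [sum_sub_distrib, ← sum_mul, ← sum_mul]
    nth_rw 1 [std]
    rw [count, cmean]; ring
  simp only [this, expect_const_mul, expect_sum, expect_sub]
  congr 1
  refine sum_congr rfl fun i _ => ?_
  rw [expect_ind_mul (s i) (fun A => g (std p s A))]
  ring

theorem inv_sqrt_mul_inv_sqrt (hv : 0 < cvar p s) :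
    (√(cvar p s))⁻¹ * (√(cvar p s))⁻¹ = (cvar p s)⁻¹ := by
  rw [← mul_inv, Real.mul_self_sqrt hv.le]

theorem steinVar_eq (hv : 0 < cvar p s) (A : Finset E) :
    steinVar p s A = (√(cvar p s))⁻¹ * ∑ i, p ^ #(s i) * (std p s (A ∪ s i) - std p s A) := by
  rw [steinVar, ← inv_sqrt_mul_inv_sqrt hv, mul_assoc]
  congr 1
  rw [mul_sum]
  refine sum_congr rfl fun i _ => ?_
  rw [std_union, add_sub_cancel_left, mul_sum, mul_sum, mul_sum]
  exact sum_congr rfl fun j _ => by ring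

/-- Left to right, this undoes the shift by `s i`. The factor `1 - ind (s i ∩ s j)` sees only `s i`,
so it is independent of the shifted function and may be replaced by its mean; the weight `p ^ #(s
i)` then turns back into the event `s i ⊆ A`. -/
theorem expect_gain_mul (i j : I) (F : Finset E → ℝ) :
    p ^ #(s i) * expect p (fun A => gain s i j A * F (A ∪ s i)) =
      expect p (fun A => ind (s i) A * (ind (s j \ s i) A * (1 - p ^ #(s i ∩ s j))) * F A) := by
  have h1 : ∀ A, ind (s i) A * (ind (s j \ s i) A * (1 - p ^ #(s i ∩ s j))) * F A =
      (1 - p ^ #(s i ∩ s j)) * (ind (s i) A * (ind (s j \ s i) A * F A)) := fun A => by ring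
  simp only [h1, expect_const_mul]
  rw [expect_ind_mul (s i) (fun A => ind (s j \ s i) A * F A)]
  have h2 : LocalOn (s i) (fun A => 1 - ind (s i ∩ s j) A) :=
    ((localOn_ind _).mono inter_subset_left).comp (fun x => 1 - x)
  have h3 := expect_mul_of_local (p := p) h2
    (localOn_union (fun A => ind (s j \ s i) A * F A) (s i)) disjoint_compl_right
  have h4 : ∀ A, (1 - ind (s i ∩ s j) A) * (ind (s j \ s i) (A ∪ s i) * F (A ∪ s i)) =
      gain s i j A * F (A ∪ s i) := fun A => by
    rw [ind_union_right, Finset.sdiff_idem, gain]; ring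
  simp only [h4] at h3
  rw [h3, expect_sub, expect_one, expect_ind]
  ring

/-- The mean of the Stein remainder against a function of the count is the total remainder. -/
theorem expect_steinRem_mul (hv : 0 < cvar p s) (M : ℝ → ℝ) :
    expect p (fun A => steinRem p s A * M (std p s A)) =
      (√(cvar p s))⁻¹ * ∑ i, p ^ #(s i) * expect p (fun A =>
        (std p s (A ∪ s i) - std p s A) * (M (std p s (A ∪ s i)) - M (std p s A))) := by
  have h1 : ∀ A, steinRem p s A * M (std p s A) = (cvar p s)⁻¹ * ∑ i, ∑ j,
      (ind (s i) A * (ind (s j \ s i) A * (1 - p ^ #(s i ∩ s j))) * M (std p s A) -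
        p ^ #(s i) * (gain s i j A * M (std p s A))) := fun A => by
    rw [steinRem, mul_assoc, sum_mul]
    simp only [sum_mul, sub_mul, mul_assoc]
  have h2 : ∀ i A, (std p s (A ∪ s i) - std p s A) * (M (std p s (A ∪ s i)) - M (std p s A)) =
      (√(cvar p s))⁻¹ * ∑ j, (gain s i j A * M (std p s (A ∪ s i)) -
        gain s i j A * M (std p s A)) := fun i A => by
    rw [sum_sub_distrib, ← sum_mul, ← sum_mul]
    rw [show std p s (A ∪ s i) - std p s A = (√(cvar p s))⁻¹ * ∑ j, gain s i j A by
      rw [std_union]; ring]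
    ring
  simp only [h1, h2, expect_const_mul, expect_sum, expect_sub]
  rw [← inv_sqrt_mul_inv_sqrt hv, mul_assoc]
  congr 1
  rw [mul_sum]
  refine sum_congr rfl fun i _ => ?_
  rw [mul_left_comm, mul_sum (univ : Finset I) _ (p ^ #(s i))]
  congr 1
  refine sum_congr rfl fun j _ => ?_
  rw [mul_sub, expect_gain_mul i j (fun A => M (std p s A))]

/-- First order Stein identity with remainder. -/
theorem abs_stein_sub_le (h0 : 0 ≤ p) (h1 : p ≤ 1) (hv : 0 < cvar p s) {g γ M : ℝ → ℝ}
    (h : ∀ w w', w ≤ w' → |g w' - g w - (w' - w) * γ w| ≤ (w' - w) * (M w' - M w)) :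
    |expect p (fun A => std p s A * g (std p s A)) -
      expect p (fun A => steinVar p s A * γ (std p s A))| ≤
      expect p (fun A => steinRem p s A * M (std p s A)) := by
  have e1 : expect p (fun A => steinVar p s A * γ (std p s A)) = (√(cvar p s))⁻¹ *
      ∑ i, p ^ #(s i) * expect p (fun A =>
        (std p s (A ∪ s i) - std p s A) * γ (std p s A)) := by
    simp only [steinVar_eq hv, mul_assoc, expect_const_mul, sum_mul, expect_sum]
  -- After `expect_steinRem_mul` both sides are sums over the same coupling, so `h` can be applied
  -- pointwise; its condition `w ≤ w'` holds because adding `s i` cannot decrease the count.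
  rw [expect_steinRem_mul hv, size_bias, e1, ← mul_sub, ← sum_sub_distrib, abs_mul,
    abs_of_nonneg (by positivity : 0 ≤ (√(cvar p s))⁻¹)]
  refine mul_le_mul_of_nonneg_left ((abs_sum_le_sum_abs _ _).trans (sum_le_sum fun i _ => ?_))
    (by positivity)
  rw [← mul_sub, ← expect_sub, abs_mul, abs_of_nonneg (pow_nonneg h0 _)]
  refine mul_le_mul_of_nonneg_left ?_ (pow_nonneg h0 _)
  exact (abs_expect_le h0 h1 _).trans (expect_mono h0 h1 fun A => h _ _ (le_std_union i A))

end SizeBias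

end SubgraphCount

namespace SubgraphCount

open Finset

set_option linter.unusedSectionVars false

/-! ### Moments of the function dominating the local terms. -/

section Majorant

variable {E : Type*} [Fintype E] [DecidableEq E] {I : Type*} [Fintype I]
  {p : ℝ} {s : I → Finset E} {e : ℕ}

/-- A function dominating the terms of `steinVar` and `steinRem`. -/
def majorant (p : ℝ) (s : I → Finset E) (i j : I) (A : Finset E) : ℝ :=
  p ^ #(s i) * gain s i j A + (1 - p) * p ^ #(s i ∪ s j) + (1 - p) * ind (s i ∪ s j) A

theorem majorant_nonneg (h0 : 0 ≤ p) (h1 : p ≤ 1) (i j : I) (A : Finset E) :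
    0 ≤ majorant p s i j A := by
  have := gain_nonneg (s := s) i j A
  have := ind_nonneg (s i ∪ s j) A
  have : 0 ≤ 1 - p := sub_nonneg.2 h1
  unfold majorant; positivity

/-- Bernoulli's inequality. It produces the factor `1 - p` that the estimates need when `p` is near
1. -/
theorem one_sub_pow_le (h0 : 0 ≤ p) (h1 : p ≤ 1) {n m : ℕ} (h : n ≤ m) :
    1 - p ^ n ≤ m * (1 - p) := by
  have := one_add_mul_sub_le_pow (show (-1 : ℝ) ≤ p by linarith) n
  have h2 : (n : ℝ) * (1 - p) ≤ m * (1 - p) := by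
    gcongr
  linarith

theorem localOn_gain (i j : I) : LocalOn (s i ∪ s j) (gain s i j) :=
  LocalOn.comp₂ (fun x y => x * (1 - y))
    ((localOn_ind _).mono (sdiff_subset.trans subset_union_right))
    ((localOn_ind _).mono (inter_subset_left.trans subset_union_left))

theorem localOn_majorant (i j : I) : LocalOn (s i ∪ s j) (majorant p s i j) :=
  LocalOn.comp₂ (fun x y => p ^ #(s i) * x + (1 - p) * p ^ #(s i ∪ s j) + (1 - p) * y)
    (localOn_gain i j) (localOn_ind _)

/-- Times `ind V`, the gain is a difference of two containment indicators whose sets differ by at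
most `e` elements of `s i ∩ s j`; the difference of their means carries the factor `1 - p`. -/
theorem expect_gain_ind_le (h0 : 0 ≤ p) (h1 : p ≤ 1) (he : ∀ i, #(s i) ≤ e) (i j : I)
    (V : Finset E) :
    p ^ #(s i) * expect p (fun A => gain s i j A * ind V A) ≤
      e * (1 - p) * p ^ #(s i ∪ s j ∪ V) := by
  have hq : 0 ≤ 1 - p := sub_nonneg.2 h1
  set B := s j \ s i ∪ V with hB
  have e1 : ∀ A, gain s i j A * ind V A = ind B A - ind (B ∪ (s i ∩ s j)) A := fun A => by
    rw [← ind_mul_ind B, hB, ← ind_mul_ind (s j \ s i), gain]; ring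
  simp only [e1, expect_sub, expect_ind]
  have e2 : #(B ∪ s i ∩ s j) = #B + #((s i ∩ s j) \ B) := by
    rw [← card_union_of_disjoint disjoint_sdiff, union_sdiff_self_eq_union]
  have h3 : #((s i ∩ s j) \ B) ≤ e :=
    (card_le_card (sdiff_subset.trans inter_subset_left)).trans (he i)
  have h4 : #(s i ∪ s j ∪ V) ≤ #(s i) + #B := by
    refine (card_le_card ?_).trans (card_union_le _ _)
    rw [hB, ← union_assoc, union_sdiff_self_eq_union]
  calc p ^ #(s i) * (p ^ #B - p ^ #(B ∪ s i ∩ s j))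
      = p ^ (#(s i) + #B) * (1 - p ^ #((s i ∩ s j) \ B)) := by rw [e2, pow_add, pow_add]; ring
    _ ≤ p ^ #(s i ∪ s j ∪ V) * (e * (1 - p)) := by
        refine mul_le_mul (pow_le_pow_of_le_one h0 h1 h4) (one_sub_pow_le h0 h1 h3) ?_ (by positivity)
        exact sub_nonneg.2 (pow_le_one₀ h0 h1)
    _ = _ := by ring

theorem pow_card_mul_le (h0 : 0 ≤ p) (h1 : p ≤ 1) {a : ℕ} {B C : Finset E}
    (h : #C ≤ a + #B) : p ^ a * p ^ #B ≤ p ^ #C := by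
  rw [← pow_add]; exact pow_le_pow_of_le_one h0 h1 h

theorem expect_majorant_ind_le (h0 : 0 ≤ p) (h1 : p ≤ 1) (he : ∀ i, #(s i) ≤ e) (i j : I)
    (V : Finset E) :
    expect p (fun A => majorant p s i j A * ind V A) ≤
      (e + 2) * (1 - p) * p ^ #(s i ∪ s j ∪ V) := by
  have hq : 0 ≤ 1 - p := sub_nonneg.2 h1
  have e1 : ∀ A, majorant p s i j A * ind V A = p ^ #(s i) * (gain s i j A * ind V A) +
      (1 - p) * p ^ #(s i ∪ s j) * ind V A + (1 - p) * ind (s i ∪ s j ∪ V) A := fun A => by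
    rw [← ind_mul_ind (s i ∪ s j) V, majorant]; ring
  simp only [e1, expect_add, expect_const_mul, expect_ind]
  have h2 := expect_gain_ind_le h0 h1 he i j V
  have h3 := pow_card_mul_le h0 h1 (card_union_le (s i ∪ s j) V)
  have h4 := mul_le_mul_of_nonneg_left h3 hq
  linarith

/-- The factors `1 - p` are given away here: in a product of two majorants only one of them has to
supply that factor. -/
theorem majorant_le (h0 : 0 ≤ p) (i j : I) (A : Finset E) :
    majorant p s i j A ≤
      p ^ #(s i) * ind (s j \ s i) A + p ^ #(s i ∪ s j) + ind (s i ∪ s j) A := by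
  have h2 : gain s i j A ≤ ind (s j \ s i) A :=
    mul_le_of_le_one_right (ind_nonneg _ _) (by linarith [ind_nonneg (s i ∩ s j) A])
  have h3 : p ^ #(s i) * gain s i j A ≤ p ^ #(s i) * ind (s j \ s i) A :=
    mul_le_mul_of_nonneg_left h2 (by positivity)
  have h4 : (1 - p) * p ^ #(s i ∪ s j) ≤ p ^ #(s i ∪ s j) :=
    mul_le_of_le_one_left (by positivity) (by linarith)
  have h5 : (1 - p) * ind (s i ∪ s j) A ≤ ind (s i ∪ s j) A :=
    mul_le_of_le_one_left (ind_nonneg _ _) (by linarith)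
  unfold majorant; linarith

theorem expect_majorant_majorant_ind_le (h0 : 0 ≤ p) (h1 : p ≤ 1) (he : ∀ i, #(s i) ≤ e)
    (i j k l : I) (V : Finset E) :
    expect p (fun A => majorant p s i j A * majorant p s k l A * ind V A) ≤
      3 * (e + 2) * (1 - p) * p ^ #(s i ∪ s j ∪ (s k ∪ s l) ∪ V) := by
  have hq : 0 ≤ 1 - p := sub_nonneg.2 h1
  have h2 : ∀ A, majorant p s i j A * majorant p s k l A * ind V A ≤
      p ^ #(s k) * (majorant p s i j A * ind ((s l \ s k) ∪ V) A) +
      p ^ #(s k ∪ s l) * (majorant p s i j A * ind V A) +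
      majorant p s i j A * ind (s k ∪ s l ∪ V) A := fun A => by
    have h3 := majorant_le (s := s) h0 k l A
    have h4 := mul_nonneg (majorant_nonneg (s := s) h0 h1 i j A) (ind_nonneg V A)
    have h5 := mul_le_mul_of_nonneg_left h3 h4
    rw [← ind_mul_ind _ V, ← ind_mul_ind _ V]
    linarith
  refine (expect_mono h0 h1 h2).trans ?_
  simp only [expect_add, expect_const_mul]
  have b1 := expect_majorant_ind_le h0 h1 he i j (s l \ s k ∪ V)
  have b2 := expect_majorant_ind_le h0 h1 he i j V
  have b3 := expect_majorant_ind_le h0 h1 he i j (s k ∪ s l ∪ V)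
  have c1 : p ^ #(s k) * p ^ #(s i ∪ s j ∪ (s l \ s k ∪ V)) ≤
      p ^ #(s i ∪ s j ∪ (s k ∪ s l) ∪ V) := by
    refine pow_card_mul_le h0 h1 ((card_le_card ?_).trans (card_union_le _ _))
    intro x
    simp only [mem_union, mem_sdiff]; tauto
  have c2 : p ^ #(s k ∪ s l) * p ^ #(s i ∪ s j ∪ V) ≤
      p ^ #(s i ∪ s j ∪ (s k ∪ s l) ∪ V) := by
    refine pow_card_mul_le h0 h1 ((card_le_card ?_).trans (card_union_le _ _))
    intro x
    simp only [mem_union]; tauto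
  have c3 : s i ∪ s j ∪ (s k ∪ s l ∪ V) = s i ∪ s j ∪ (s k ∪ s l) ∪ V :=
    (union_assoc _ _ _).symm
  rw [c3] at b3
  have d : 0 ≤ ((e : ℝ) + 2) * (1 - p) := by positivity
  have b1' := mul_le_mul_of_nonneg_left b1 (pow_nonneg h0 #(s k))
  have b2' := mul_le_mul_of_nonneg_left b2 (pow_nonneg h0 #(s k ∪ s l))
  have c1' := mul_le_mul_of_nonneg_left c1 d
  have c2' := mul_le_mul_of_nonneg_left c2 d
  linarith

end Majorant

/-! ### Effect of deleting edges on the exponential tilt. -/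

section Tilt

variable {E : Type*} [Fintype E] [DecidableEq E] {I : Type*} [Fintype I]
  {p t : ℝ} {s : I → Finset E}

/-- The indicator that `s k` meets `B`. -/
def meets (s : I → Finset E) (B : Finset E) (k : I) : ℝ := if Disjoint (s k) B then 0 else 1

/-- The decrease of the standardized count when `B` is removed from the random set. -/
noncomputable def loss (p : ℝ) (s : I → Finset E) (B A : Finset E) : ℝ :=
  (√(cvar p s))⁻¹ * ∑ k, meets s B k * ind (s k) A

/-- The part of the decrease of the standardized count due to the indices meeting `B` and `C`. -/
noncomputable def jointLoss (p : ℝ) (s : I → Finset E) (B C A : Finset E) : ℝ :=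
  (√(cvar p s))⁻¹ * ∑ k, meets s B k * meets s C k * ind (s k) A

theorem meets_nonneg (B : Finset E) (k : I) : 0 ≤ meets s B k := by
  unfold meets; split_ifs <;> norm_num

theorem meets_le_one (B : Finset E) (k : I) : meets s B k ≤ 1 := by
  unfold meets; split_ifs <;> norm_num

theorem meets_mono {B C : Finset E} (h : B ⊆ C) (k : I) : meets s B k ≤ meets s C k := by
  unfold meets
  by_cases h1 : Disjoint (s k) C
  · simp [h1, h1.mono_right h]
  · simp only [h1, if_false]; split_ifs <;> norm_num

theorem ind_sdiff (B A : Finset E) (k : I) :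
    ind (s k) (A \ B) = (1 - meets s B k) * ind (s k) A := by
  unfold ind meets
  by_cases h : Disjoint (s k) B <;> by_cases h' : s k ⊆ A <;>
    simp [h, h', subset_sdiff]

theorem std_sdiff (B A : Finset E) : std p s (A \ B) = std p s A - loss p s B A := by
  have : ∀ k, ind (s k) (A \ B) = ind (s k) A - meets s B k * ind (s k) A := fun k => by
    rw [ind_sdiff]; ring
  simp only [std, count, loss, this, sum_sub_distrib]
  ring

theorem loss_nonneg (B A : Finset E) : 0 ≤ loss p s B A :=
  mul_nonneg (by positivity) (sum_nonneg fun k _ => mul_nonneg (meets_nonneg _ _) (ind_nonneg _ _))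

theorem jointLoss_nonneg (B C A : Finset E) : 0 ≤ jointLoss p s B C A :=
  mul_nonneg (by positivity) (sum_nonneg fun k _ =>
    mul_nonneg (mul_nonneg (meets_nonneg _ _) (meets_nonneg _ _)) (ind_nonneg _ _))

theorem jointLoss_le (B C A : Finset E) : jointLoss p s B C A ≤ loss p s B A := by
  refine mul_le_mul_of_nonneg_left (sum_le_sum fun k _ => ?_) (by positivity)
  exact mul_le_mul_of_nonneg_right
    (mul_le_of_le_one_right (meets_nonneg _ _) (meets_le_one _ _)) (ind_nonneg _ _)

theorem loss_union (B C A : Finset E) :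
    loss p s (B ∪ C) A = loss p s B A + loss p s C A - jointLoss p s B C A := by
  have : ∀ k, meets s (B ∪ C) k * ind (s k) A = meets s B k * ind (s k) A +
      meets s C k * ind (s k) A - meets s B k * meets s C k * ind (s k) A := fun k => by
    unfold meets
    by_cases h1 : Disjoint (s k) B <;> by_cases h2 : Disjoint (s k) C <;>
      simp [h1, h2, disjoint_union_right]
  simp only [loss, jointLoss, this, sum_sub_distrib, sum_add_distrib]
  ring

/-- The second order mixed difference of an exponential. -/
theorem abs_second_difference_le {w x y r : ℝ} (hx : 0 ≤ x) (hy : 0 ≤ y) (hr : 0 ≤ r)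
    (hrx : r ≤ x) :
    |Real.exp w - Real.exp (w - x) - Real.exp (w - y) + Real.exp (w - (x + y - r))| ≤
      (x * y + r) * Real.exp w := by
  -- The first summand would be the whole difference if the losses `x` and `y` were additive; the
  -- second corrects for the shared loss `r`. Both are nonnegative.
  have e1 : Real.exp w - Real.exp (w - x) - Real.exp (w - y) + Real.exp (w - (x + y - r)) =
      Real.exp w * ((1 - Real.exp (-x)) * (1 - Real.exp (-y)) +
        Real.exp (-(x - r)) * Real.exp (-y) * (1 - Real.exp (-r))) := by
    have : Real.exp (-(x - r)) * Real.exp (-r) = Real.exp (-x) := by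
      rw [← Real.exp_add]; ring_nf
    rw [show w - (x + y - r) = w + (-(x - r) + -y) by ring, sub_eq_add_neg w x,
      sub_eq_add_neg w y, Real.exp_add, Real.exp_add, Real.exp_add, Real.exp_add]
    linear_combination Real.exp w * Real.exp (-y) * this
  have hle : ∀ z : ℝ, 0 ≤ z → 0 ≤ 1 - Real.exp (-z) ∧ 1 - Real.exp (-z) ≤ z := fun z hz =>
    ⟨by simpa using hz, by linarith [Real.add_one_le_exp (-z)]⟩
  obtain ⟨x1, x2⟩ := hle x hx
  obtain ⟨y1, y2⟩ := hle y hy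
  obtain ⟨r1, r2⟩ := hle r hr
  have h3 : Real.exp (-(x - r)) * Real.exp (-y) ≤ 1 := by
    rw [← Real.exp_add]; exact Real.exp_le_one_iff.2 (by linarith)
  have h4 : Real.exp (-(x - r)) * Real.exp (-y) * (1 - Real.exp (-r)) ≤ r :=
    (mul_le_of_le_one_left r1 h3).trans r2
  rw [e1, abs_of_nonneg (by positivity), mul_comm]
  gcongr

/-- Deleting `B` from `A` makes the exponential independent of `F` at the price of a factor e^c;
monotonicity of `std` then restores the full exponential for free. -/
theorem expect_mul_exp_le (h0 : 0 ≤ p) (h1 : p ≤ 1) (ht : 0 ≤ t) {c : ℝ} {B : Finset E}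
    (hc : ∀ A, t * loss p s B A ≤ c) {F : Finset E → ℝ} (hF : ∀ A, 0 ≤ F A) (hl : LocalOn B F) :
    expect p (fun A => F A * Real.exp (t * std p s A)) ≤
      Real.exp c * expect p F * expect p (fun A => Real.exp (t * std p s A)) := by
  calc expect p (fun A => F A * Real.exp (t * std p s A))
      ≤ expect p (fun A => Real.exp c * (F A * Real.exp (t * std p s (A \ B)))) := by
        refine expect_mono h0 h1 fun A => ?_
        rw [mul_left_comm, ← Real.exp_add]
        refine mul_le_mul_of_nonneg_left (Real.exp_le_exp.2 ?_) (hF A)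
        rw [std_sdiff]; linarith [hc A]
    _ = Real.exp c * (expect p F * expect p (fun A => Real.exp (t * std p s (A \ B)))) := by
        rw [expect_const_mul, expect_mul_of_local hl
          (localOn_sdiff (fun A => Real.exp (t * std p s A)) B) disjoint_compl_right]
    _ ≤ _ := by
        rw [mul_assoc]
        refine mul_le_mul_of_nonneg_left (mul_le_mul_of_nonneg_left (expect_mono h0 h1 fun A => ?_)
          (expect_nonneg h0 h1 hF)) (Real.exp_nonneg _)
        exact Real.exp_le_exp.2 (mul_le_mul_of_nonneg_left (std_mono sdiff_subset) ht)

/-- Decorrelation of centred local functions with disjoint supports under exponential tilting. -/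
theorem expect_mul_mul_exp_le (h0 : 0 ≤ p) (h1 : p ≤ 1) (ht : 0 ≤ t) {B C : Finset E}
    (hBC : Disjoint B C) {F G : Finset E → ℝ} (hF : LocalOn B F) (hG : LocalOn C G)
    (hF0 : expect p F = 0) (hG0 : expect p G = 0) :
    expect p (fun A => F A * G A * Real.exp (t * std p s A)) ≤
      expect p (fun A => |F A| * |G A| * ((t * loss p s B A) * (t * loss p s C A) +
        t * jointLoss p s B C A) * Real.exp (t * std p s A)) := by
  -- In each of `z1`, `z2`, `z3` a centred factor is independent of everything else. Adding these
  -- zero terms replaces the tilt by its mixed second difference in `B` and `C`.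
  have z1 : expect p (fun A => F A * (G A * Real.exp (t * std p s (A \ B)))) = 0 := by
    have hl : LocalOn Bᶜ (fun A => G A * Real.exp (t * std p s (A \ B))) :=
      LocalOn.mul (hG.mono (by
        rw [subset_compl_comm, subset_compl_iff_disjoint_right]; exact hBC))
        (localOn_sdiff (fun A => Real.exp (t * std p s A)) B)
    rw [expect_mul_of_local hF hl disjoint_compl_right, hF0, zero_mul]
  have z2 : expect p (fun A => G A * (F A * Real.exp (t * std p s (A \ C)))) = 0 := by
    have hl : LocalOn Cᶜ (fun A => F A * Real.exp (t * std p s (A \ C))) :=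
      LocalOn.mul (hF.mono (by
        rw [subset_compl_comm, subset_compl_iff_disjoint_right]; exact hBC.symm))
        (localOn_sdiff (fun A => Real.exp (t * std p s A)) C)
    rw [expect_mul_of_local hG hl disjoint_compl_right, hG0, zero_mul]
  have z3 : expect p (fun A => (F A * G A) * Real.exp (t * std p s (A \ (B ∪ C)))) = 0 := by
    rw [expect_mul_of_local ((hF.mono subset_union_left).mul (hG.mono subset_union_right))
      (localOn_sdiff (fun A => Real.exp (t * std p s A)) (B ∪ C)) disjoint_compl_right,
      expect_mul_of_local hF hG hBC, hF0, zero_mul, zero_mul]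
  have e1 : expect p (fun A => F A * G A * Real.exp (t * std p s A)) =
      expect p (fun A => F A * G A * (Real.exp (t * std p s A) - Real.exp (t * std p s (A \ B)) -
        Real.exp (t * std p s (A \ C)) + Real.exp (t * std p s (A \ (B ∪ C))))) := by
    have : ∀ A, F A * G A * (Real.exp (t * std p s A) - Real.exp (t * std p s (A \ B)) -
        Real.exp (t * std p s (A \ C)) + Real.exp (t * std p s (A \ (B ∪ C)))) =
        F A * G A * Real.exp (t * std p s A) - F A * (G A * Real.exp (t * std p s (A \ B))) -
        G A * (F A * Real.exp (t * std p s (A \ C))) +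
        F A * G A * Real.exp (t * std p s (A \ (B ∪ C))) := fun A => by ring
    simp only [this, expect_add, expect_sub, z1, z2, z3]
    ring
  rw [e1]
  refine expect_mono h0 h1 fun A => (le_abs_self _).trans ?_
  rw [abs_mul, abs_mul, mul_assoc (|F A| * |G A|)]
  refine mul_le_mul_of_nonneg_left ?_ (by positivity)
  have := abs_second_difference_le (w := t * std p s A)
    (mul_nonneg ht (loss_nonneg (p := p) (s := s) B A))
    (mul_nonneg ht (loss_nonneg (p := p) (s := s) C A))
    (mul_nonneg ht (jointLoss_nonneg (p := p) (s := s) B C A))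
    (mul_le_mul_of_nonneg_left (jointLoss_le B C A) ht)
  refine le_trans (le_of_eq ?_) this
  rw [std_sdiff, std_sdiff, std_sdiff, loss_union]
  ring_nf

end Tilt

end SubgraphCount

namespace SubgraphCount

open Finset

set_option linter.unusedSectionVars false

/-! ### Sums over tuples of overlapping index sets. -/

section TupleSums

variable {E : Type*} [Fintype E] [DecidableEq E] {I : Type*} [Fintype I]
  {p : ℝ} {s : I → Finset E} {e : ℕ} {L₁ L₂ : ℝ}

/-- The indicator that two sets intersect. -/
def overlap (B C : Finset E) : ℝ := if Disjoint B C then 0 else 1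

theorem overlap_union_le (U : Finset E) (k l : I) :
    overlap U (s k ∪ s l) ≤ meets s U k + meets s U l := by
  unfold overlap meets
  simp only [disjoint_comm (a := U)]
  by_cases h1 : Disjoint (s k) U <;> by_cases h2 : Disjoint (s l) U <;> simp [h1, h2]

theorem meets_le_overlap (U B : Finset E) (m : I) : meets s B m ≤ overlap (U ∪ s m) B := by
  unfold overlap meets
  simp only [disjoint_union_left]
  by_cases h1 : Disjoint (s m) B <;> by_cases h2 : Disjoint U B <;> simp [h1, h2]

theorem meets_comm (k l : I) : meets s (s k) l = meets s (s l) k := by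
  simp only [meets, disjoint_comm (a := s k)]

/-- Bounds on the sum of the probabilities of the sets `U ∪ s k`, over all `k` and over the `k`
for which `s k` meets `U`. -/
structure SumBounds (p : ℝ) (s : I → Finset E) (e : ℕ) (L₁ L₂ : ℝ) : Prop where
  p_nonneg : 0 ≤ p
  p_le_one : p ≤ 1
  card_le : ∀ i, #(s i) ≤ e
  nonneg₁ : 0 ≤ L₁
  nonneg₂ : 0 ≤ L₂
  sum_meets : ∀ U : Finset E, #U ≤ 5 * e → ∑ k, meets s U k * p ^ #(U ∪ s k) ≤ L₁ * p ^ #U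
  sum_all : ∀ U : Finset E, #U ≤ 5 * e → ∑ k, p ^ #(U ∪ s k) ≤ L₂ * p ^ #U

namespace SumBounds

variable (h : SumBounds p s e L₁ L₂)
include h

theorem sum_meets_mul_le {U : Finset E} (hU : #U ≤ 5 * e) {f : I → ℝ} {c : ℝ} (hc : 0 ≤ c)
    (hf : ∀ k, f k ≤ c * p ^ #(U ∪ s k)) : ∑ k, meets s U k * f k ≤ c * L₁ * p ^ #U := by
  calc ∑ k, meets s U k * f k ≤ ∑ k, c * (meets s U k * p ^ #(U ∪ s k)) := by
        refine sum_le_sum fun k _ => ?_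
        rw [mul_left_comm]
        exact mul_le_mul_of_nonneg_left (hf k) (meets_nonneg _ _)
    _ ≤ _ := by
        rw [← mul_sum, mul_assoc]
        exact mul_le_mul_of_nonneg_left (h.sum_meets U hU) hc

theorem sum_all_le {U : Finset E} (hU : #U ≤ 5 * e) {f : I → ℝ} {c : ℝ} (hc : 0 ≤ c)
    (hf : ∀ k, f k ≤ c * p ^ #(U ∪ s k)) : ∑ k, f k ≤ c * L₂ * p ^ #U := by
  calc ∑ k, f k ≤ ∑ k, c * p ^ #(U ∪ s k) := sum_le_sum fun k _ => hf k
    _ ≤ _ := by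
        rw [← mul_sum, mul_assoc]
        exact mul_le_mul_of_nonneg_left (h.sum_all U hU) hc

theorem card_union_le {U : Finset E} {n : ℕ} (hU : #U ≤ n * e) (k : I) :
    #(U ∪ s k) ≤ (n + 1) * e := by
  have := Finset.card_union_le U (s k)
  have := h.card_le k
  rw [add_mul]; omega

theorem card_le_of_le {U : Finset E} {n m : ℕ} (hU : #U ≤ n * e) (hnm : n ≤ m) : #U ≤ m * e :=
  hU.trans (Nat.mul_le_mul_right e hnm)

theorem sum_pairs_le {f : I → I → ℝ} {c : ℝ} (hc : 0 ≤ c)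
    (hf : ∀ i j, f i j ≤ c * p ^ #(s i ∪ s j)) :
    ∑ i, ∑ j, meets s (s i) j * f i j ≤ c * L₁ * L₂ := by
  have := h.sum_all_le (U := ∅) (by simp) (mul_nonneg hc h.nonneg₁)
    (f := fun i => ∑ j, meets s (s i) j * f i j) fun i => ?_
  · simpa using this
  · rw [empty_union]
    exact h.sum_meets_mul_le (h.card_le_of_le (n := 1) (by simpa using h.card_le i) (by norm_num))
      hc (hf i)

/-- If `s k ∪ s l` meets `U`, then `s k` or `s l` does. By symmetry one may start with the index
meeting `U`; the other meets its set, and each costs a factor `L₁`. -/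
theorem sum_overlap_le {U : Finset E} (hU : #U ≤ 3 * e) :
    ∑ k, ∑ l, meets s (s k) l * (overlap U (s k ∪ s l) * p ^ #(U ∪ (s k ∪ s l))) ≤
      2 * L₁ ^ 2 * p ^ #U := by
  have hp := h.p_nonneg
  have key : ∑ k, meets s U k * ∑ l, meets s (s k) l * p ^ #(U ∪ (s k ∪ s l)) ≤
      L₁ * L₁ * p ^ #U := by
    refine h.sum_meets_mul_le (h.card_le_of_le hU (by norm_num)) h.nonneg₁ fun k => ?_
    have := h.sum_meets_mul_le (U := U ∪ s k)
      (h.card_le_of_le (h.card_union_le hU k) (by norm_num)) zero_le_one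
      (f := fun l => p ^ #(U ∪ (s k ∪ s l))) (fun l => by rw [one_mul, union_assoc])
    rw [one_mul] at this
    refine le_trans (sum_le_sum fun l _ => ?_) this
    exact mul_le_mul_of_nonneg_right (meets_mono subset_union_right l) (by positivity)
  have key2 : ∑ k, ∑ l, meets s (s k) l * (meets s U l * p ^ #(U ∪ (s k ∪ s l))) ≤
      L₁ * L₁ * p ^ #U := by
    rw [sum_comm]
    refine le_trans (le_of_eq ?_) key
    refine sum_congr rfl fun k _ => ?_
    rw [mul_sum]
    refine sum_congr rfl fun l _ => ?_
    rw [meets_comm, union_comm (s l)]; ring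
  calc _ ≤ ∑ k, ∑ l, (meets s U k * (meets s (s k) l * p ^ #(U ∪ (s k ∪ s l))) +
        meets s (s k) l * (meets s U l * p ^ #(U ∪ (s k ∪ s l)))) := by
        refine sum_le_sum fun k _ => sum_le_sum fun l _ => ?_
        have h1 := mul_le_mul_of_nonneg_left
          (mul_le_mul_of_nonneg_right (overlap_union_le (s := s) U k l)
            (pow_nonneg hp #(U ∪ (s k ∪ s l)))) (meets_nonneg (s := s) (s k) l)
        linarith
    _ ≤ _ := by
        simp only [sum_add_distrib]
        simp only [mul_sum] at key
        linarith

/-- The index `k` is free and costs `L₂`, while `l` and `n` are tied to earlier sets and cost `L₁`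
each. The last sum is taken over a base set of up to `5 * e` elements, the size allowed in
`SumBounds`. -/
theorem sum_triples_le {U : Finset E} (hU : #U ≤ 3 * e) :
    ∑ k, ∑ l, meets s (s k) l * ∑ n, meets s (s k ∪ s l) n * p ^ #(U ∪ (s k ∪ s l) ∪ s n) ≤
      L₁ ^ 2 * L₂ * p ^ #U := by
  have hp := h.p_nonneg
  refine h.sum_all_le (h.card_le_of_le hU (by norm_num)) (by positivity) fun k => ?_
  rw [sq]
  have hk := h.card_union_le hU k
  refine le_trans (sum_le_sum fun l _ => mul_le_mul_of_nonneg_right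
    (meets_mono (subset_union_right (s₁ := U)) l) (sum_nonneg fun n _ => ?_))
    (h.sum_meets_mul_le (U := U ∪ s k) (h.card_le_of_le hk (by norm_num)) h.nonneg₁ fun l => ?_)
  · have := meets_nonneg (s := s) (s k ∪ s l) n
    positivity
  · have := h.sum_meets_mul_le (U := U ∪ s k ∪ s l)
      (h.card_le_of_le (h.card_union_le hk l) (by norm_num)) zero_le_one
      (f := fun n => p ^ #(U ∪ (s k ∪ s l) ∪ s n)) (fun n => by rw [one_mul, ← union_assoc U])
    rw [one_mul] at this
    refine le_trans (sum_le_sum fun n _ => ?_) this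
    refine mul_le_mul_of_nonneg_right (meets_mono ?_ n) (by positivity)
    rw [union_assoc]; exact subset_union_right

end SumBounds

end TupleSums

/-! ### Tilted second moments of centred local sums. -/

section SecondMoment

variable {E : Type*} [Fintype E] [DecidableEq E] {I : Type*} [Fintype I]
  {p t c κ L₁ L₂ : ℝ} {s : I → Finset E} {e : ℕ} {ξ : I → I → Finset E → ℝ}

/-- A family of centred local functions dominated by `majorant`. -/
structure CenteredFamily (p κ : ℝ) (s : I → Finset E) (ξ : I → I → Finset E → ℝ) : Prop where
  localOn : ∀ i j, LocalOn (s i ∪ s j) (ξ i j)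
  expect_eq_zero : ∀ i j, expect p (ξ i j) = 0
  eq_zero : ∀ i j, Disjoint (s i) (s j) → ∀ A, ξ i j A = 0
  abs_le : ∀ i j A, |ξ i j A| ≤ κ * majorant p s i j A

/-- The bound for the tilted covariance of two members of a centred family. -/
noncomputable def pairWeight (p t : ℝ) (s : I → Finset E) (i j k l : I) : ℝ :=
  overlap (s i ∪ s j) (s k ∪ s l) * p ^ #(s i ∪ s j ∪ (s k ∪ s l)) +
  t ^ 2 * (cvar p s)⁻¹ * (∑ m, ∑ n, meets s (s i ∪ s j) m * meets s (s k ∪ s l) n *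
    p ^ #(s i ∪ s j ∪ (s k ∪ s l) ∪ (s m ∪ s n))) +
  t * (√(cvar p s))⁻¹ * ∑ m, meets s (s i ∪ s j) m * meets s (s k ∪ s l) m *
    p ^ #(s i ∪ s j ∪ (s k ∪ s l) ∪ s m)

/-- The common factor of the bounds for the tilted covariances. -/
noncomputable def tiltConst (p t c κ : ℝ) (s : I → Finset E) (e : ℕ) : ℝ :=
  κ ^ 2 * (Real.exp c * (3 * (e + 2) * (1 - p)) * expect p (fun A => Real.exp (t * std p s A)))

variable (h : SumBounds p s e L₁ L₂) (hξ : CenteredFamily p κ s ξ) (ht : 0 ≤ t) (hκ : 0 ≤ κ)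
  (hc : ∀ B : Finset E, #B ≤ 6 * e → ∀ A, t * loss p s B A ≤ c)
include h hξ ht hκ hc

/-- The majorants and `ind V` depend only on four index sets and `V`, at most `6 * e` elements in
all, so by `hc` the tilt costs a factor e^c. -/
theorem expect_abs_mul_abs_mul_ind_le (i j k l : I) (V : Finset E) (hV : #V ≤ 2 * e) :
    expect p (fun A => |ξ i j A| * |ξ k l A| * ind V A * Real.exp (t * std p s A)) ≤
      tiltConst p t c κ s e * p ^ #(s i ∪ s j ∪ (s k ∪ s l) ∪ V) := by
  have h0 := h.p_nonneg
  have h1 := h.p_le_one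
  set B := s i ∪ s j ∪ (s k ∪ s l) ∪ V with hB
  have hBc : #B ≤ 6 * e := by
    have a1 := Finset.card_union_le (s i ∪ s j ∪ (s k ∪ s l)) V
    have a2 := Finset.card_union_le (s i ∪ s j) (s k ∪ s l)
    have a3 := Finset.card_union_le (s i) (s j)
    have a4 := Finset.card_union_le (s k) (s l)
    have := h.card_le i; have := h.card_le j; have := h.card_le k; have := h.card_le l
    rw [← hB] at a1; omega
  have hl : LocalOn B (fun A => majorant p s i j A * majorant p s k l A * ind V A) :=
    ((((localOn_majorant i j).mono subset_union_left).mul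
      ((localOn_majorant k l).mono subset_union_right)).mono subset_union_left).mul
      ((localOn_ind V).mono subset_union_right)
  have hn : ∀ A, 0 ≤ majorant p s i j A * majorant p s k l A * ind V A := fun A =>
    mul_nonneg (mul_nonneg (majorant_nonneg h0 h1 _ _ _) (majorant_nonneg h0 h1 _ _ _))
      (ind_nonneg _ _)
  have b1 := expect_mul_exp_le h0 h1 ht (hc B hBc) hn hl
  have b2 := expect_majorant_majorant_ind_le h0 h1 h.card_le i j k l V
  have hexp : 0 ≤ expect p (fun A => Real.exp (t * std p s A)) :=
    expect_nonneg h0 h1 fun A => Real.exp_nonneg _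
  calc _ ≤ expect p (fun A => κ ^ 2 * (majorant p s i j A * majorant p s k l A * ind V A *
          Real.exp (t * std p s A))) := by
        refine expect_mono h0 h1 fun A => ?_
        have := mul_le_mul (hξ.abs_le i j A) (hξ.abs_le k l A) (abs_nonneg _)
          (mul_nonneg hκ (majorant_nonneg h0 h1 _ _ _))
        have := mul_le_mul_of_nonneg_right this
          (mul_nonneg (ind_nonneg V A) (Real.exp_nonneg (t * std p s A)))
        refine le_trans (le_of_eq ?_) (this.trans (le_of_eq ?_)) <;> ring
    _ ≤ κ ^ 2 * (Real.exp c * (3 * (e + 2) * (1 - p) * p ^ #B) *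
          expect p (fun A => Real.exp (t * std p s A))) := by
        rw [expect_const_mul]
        refine mul_le_mul_of_nonneg_left (b1.trans ?_) (by positivity)
        gcongr
    _ = _ := by rw [tiltConst]; ring

theorem tiltConst_nonneg : 0 ≤ tiltConst p t c κ s e := by
  have h0 := h.p_nonneg
  have h1 : 0 ≤ 1 - p := sub_nonneg.2 h.p_le_one
  have hexp : 0 ≤ expect p (fun A => Real.exp (t * std p s A)) :=
    expect_nonneg h0 h.p_le_one fun A => Real.exp_nonneg _
  unfold tiltConst; positivity

/-- For overlapping supports absolute values suffice. For disjoint supports the decorrelation bound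
applies, with the product of losses expanded over `m`, `n` and the joint loss over `m`; these are
the last two terms of `pairWeight`. -/
theorem expect_pair_le (hv : 0 < cvar p s) (i j k l : I) :
    expect p (fun A => ξ i j A * ξ k l A * Real.exp (t * std p s A)) ≤
      tiltConst p t c κ s e *
        (meets s (s i) j * (meets s (s k) l * pairWeight p t s i j k l)) := by
  have h0 := h.p_nonneg
  have h1 := h.p_le_one
  have hT := tiltConst_nonneg h hξ ht hκ hc
  by_cases hij : Disjoint (s i) (s j)
  · have : meets s (s i) j = 0 := by simp [meets, hij.symm]
    simp only [hξ.eq_zero i j hij, zero_mul, expect_const, this, mul_zero, le_refl]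
  by_cases hkl : Disjoint (s k) (s l)
  · have : meets s (s k) l = 0 := by simp [meets, hkl.symm]
    simp only [hξ.eq_zero k l hkl, zero_mul, mul_zero, expect_const, this, le_refl]
  have m1 : meets s (s i) j = 1 := by simp [meets, disjoint_comm, hij]
  have m2 : meets s (s k) l = 1 := by simp [meets, disjoint_comm, hkl]
  rw [m1, m2, one_mul, one_mul]
  have hm : ∀ (B : Finset E) (m : I), 0 ≤ meets s B m := fun B m => meets_nonneg B m
  by_cases hd : Disjoint (s i ∪ s j) (s k ∪ s l)
  · refine (expect_mul_mul_exp_le h0 h1 ht hd (hξ.localOn i j) (hξ.localOn k l)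
      (hξ.expect_eq_zero i j) (hξ.expect_eq_zero k l)).trans ?_
    have e1 : ∀ A, |ξ i j A| * |ξ k l A| * ((t * loss p s (s i ∪ s j) A) *
        (t * loss p s (s k ∪ s l) A) + t * jointLoss p s (s i ∪ s j) (s k ∪ s l) A) *
        Real.exp (t * std p s A) =
        t ^ 2 * (cvar p s)⁻¹ * (∑ m, ∑ n, meets s (s i ∪ s j) m * meets s (s k ∪ s l) n *
          (|ξ i j A| * |ξ k l A| * ind (s m ∪ s n) A * Real.exp (t * std p s A))) +
        t * (√(cvar p s))⁻¹ * ∑ m, meets s (s i ∪ s j) m * meets s (s k ∪ s l) m *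
          (|ξ i j A| * |ξ k l A| * ind (s m) A * Real.exp (t * std p s A)) := fun A => by
      have a1 : ∑ m, ∑ n, meets s (s i ∪ s j) m * meets s (s k ∪ s l) n *
          (|ξ i j A| * |ξ k l A| * ind (s m ∪ s n) A * Real.exp (t * std p s A)) =
          (∑ m, meets s (s i ∪ s j) m * ind (s m) A) *
          (∑ n, meets s (s k ∪ s l) n * ind (s n) A) *
          (|ξ i j A| * |ξ k l A| * Real.exp (t * std p s A)) := by
        rw [sum_mul_sum]
        simp only [sum_mul]
        refine sum_congr rfl fun m _ => sum_congr rfl fun n _ => ?_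
        rw [← ind_mul_ind]; ring
      have a2 : ∑ m, meets s (s i ∪ s j) m * meets s (s k ∪ s l) m *
          (|ξ i j A| * |ξ k l A| * ind (s m) A * Real.exp (t * std p s A)) =
          (∑ m, meets s (s i ∪ s j) m * meets s (s k ∪ s l) m * ind (s m) A) *
          (|ξ i j A| * |ξ k l A| * Real.exp (t * std p s A)) := by
        rw [sum_mul]
        exact sum_congr rfl fun m _ => by ring
      rw [a1, a2, ← inv_sqrt_mul_inv_sqrt hv, loss, loss, jointLoss]
      ring
    simp only [e1, expect_add, expect_const_mul, expect_sum]
    rw [pairWeight, overlap, if_pos hd, zero_mul, zero_add, mul_add]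
    have b := fun V hV => expect_abs_mul_abs_mul_ind_le h hξ ht hκ hc i j k l V hV
    refine add_le_add ?_ ?_
    · rw [mul_left_comm]
      refine mul_le_mul_of_nonneg_left ?_ (by positivity)
      rw [mul_sum]
      refine sum_le_sum fun m _ => ?_
      rw [mul_sum]
      refine sum_le_sum fun n _ => ?_
      rw [mul_left_comm (tiltConst p t c κ s e)]
      refine mul_le_mul_of_nonneg_left (b _ ?_) (mul_nonneg (hm _ _) (hm _ _))
      have := Finset.card_union_le (s m) (s n)
      have := h.card_le m; have := h.card_le n
      omega
    · rw [mul_left_comm]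
      refine mul_le_mul_of_nonneg_left ?_ (by positivity)
      rw [mul_sum]
      refine sum_le_sum fun m _ => ?_
      rw [mul_left_comm (tiltConst p t c κ s e)]
      refine mul_le_mul_of_nonneg_left (b _ ?_) (mul_nonneg (hm _ _) (hm _ _))
      have := h.card_le m
      omega
  · have b := expect_abs_mul_abs_mul_ind_le h hξ ht hκ hc i j k l ∅ (by simp)
    rw [union_empty] at b
    refine le_trans (expect_mono h0 h1 fun A => ?_) (b.trans (mul_le_mul_of_nonneg_left ?_ hT))
    · rw [ind_empty, mul_one, ← abs_mul]
      exact mul_le_mul_of_nonneg_right (le_abs_self _) (Real.exp_nonneg _)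
    · rw [pairWeight, overlap, if_neg hd, one_mul, add_assoc]
      refine le_add_of_nonneg_right (add_nonneg ?_ ?_)
      · refine mul_nonneg (by positivity) (sum_nonneg fun m _ => sum_nonneg fun n _ => ?_)
        have := hm (s i ∪ s j) m; have := hm (s k ∪ s l) n
        positivity
      · refine mul_nonneg (by positivity) (sum_nonneg fun m _ => ?_)
        have := hm (s i ∪ s j) m; have := hm (s k ∪ s l) m
        positivity

omit hξ hκ hc in
-- Every index tied to an earlier set costs `L₁` and every free one costs `L₂`. In the three terms
-- of `pairWeight` the pair `k, l` is tied to the pair `i, j` directly, through `m` and `n`, or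
-- through `m` alone.
theorem sum_pairWeight_le (hv : 0 < cvar p s) :
    ∑ i, ∑ j, meets s (s i) j * ∑ k, ∑ l, meets s (s k) l * pairWeight p t s i j k l ≤
      (2 * L₁ ^ 2 + t ^ 2 * (cvar p s)⁻¹ * (L₁ ^ 2 * L₂ * L₁) +
        t * (√(cvar p s))⁻¹ * (2 * L₁ ^ 2 * L₁)) * L₁ * L₂ := by
  have h0 := h.p_nonneg
  have hL1 := h.nonneg₁
  have hL2 := h.nonneg₂
  refine h.sum_pairs_le (by positivity) fun i j => ?_
  set U := s i ∪ s j with hU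
  have hUc : #U ≤ 2 * e := by
    have := Finset.card_union_le (s i) (s j)
    have := h.card_le i; have := h.card_le j
    rw [hU]; omega
  have hUm : ∀ m, #(U ∪ s m) ≤ 3 * e := fun m => h.card_union_le hUc m
  have e1 : ∑ k, ∑ l, meets s (s k) l * pairWeight p t s i j k l =
      (∑ k, ∑ l, meets s (s k) l * (overlap U (s k ∪ s l) * p ^ #(U ∪ (s k ∪ s l)))) +
      t ^ 2 * (cvar p s)⁻¹ * (∑ m, meets s U m * ∑ k, ∑ l, meets s (s k) l *
        ∑ n, meets s (s k ∪ s l) n * p ^ #(U ∪ s m ∪ (s k ∪ s l) ∪ s n)) +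
      t * (√(cvar p s))⁻¹ * (∑ m, meets s U m * ∑ k, ∑ l, meets s (s k) l *
        (meets s (s k ∪ s l) m * p ^ #(U ∪ s m ∪ (s k ∪ s l)))) := by
    have a1 : ∑ m, meets s U m * ∑ k, ∑ l, meets s (s k) l *
        ∑ n, meets s (s k ∪ s l) n * p ^ #(U ∪ s m ∪ (s k ∪ s l) ∪ s n) =
        ∑ k, ∑ l, meets s (s k) l * ∑ m, ∑ n, meets s U m * meets s (s k ∪ s l) n *
          p ^ #(U ∪ (s k ∪ s l) ∪ (s m ∪ s n)) := by
      simp only [mul_sum]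
      rw [sum_comm]
      refine sum_congr rfl fun k _ => ?_
      rw [sum_comm]
      refine sum_congr rfl fun l _ => sum_congr rfl fun m _ => sum_congr rfl fun n _ => ?_
      rw [show U ∪ s m ∪ (s k ∪ s l) ∪ s n = U ∪ (s k ∪ s l) ∪ (s m ∪ s n) by
        ext x; simp only [mem_union]; tauto]
      ring
    have a2 : ∑ m, meets s U m * ∑ k, ∑ l, meets s (s k) l *
        (meets s (s k ∪ s l) m * p ^ #(U ∪ s m ∪ (s k ∪ s l))) =
        ∑ k, ∑ l, meets s (s k) l * ∑ m, meets s U m * meets s (s k ∪ s l) m *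
          p ^ #(U ∪ (s k ∪ s l) ∪ s m) := by
      simp only [mul_sum]
      rw [sum_comm]
      refine sum_congr rfl fun k _ => ?_
      rw [sum_comm]
      refine sum_congr rfl fun l _ => sum_congr rfl fun m _ => ?_
      rw [show U ∪ s m ∪ (s k ∪ s l) = U ∪ (s k ∪ s l) ∪ s m by
        ext x; simp only [mem_union]; tauto]
      ring
    rw [a1, a2]
    rw [mul_sum, mul_sum, ← sum_add_distrib, ← sum_add_distrib]
    refine sum_congr rfl fun k _ => ?_
    rw [mul_sum, mul_sum, ← sum_add_distrib, ← sum_add_distrib]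
    refine sum_congr rfl fun l _ => ?_
    rw [pairWeight, ← hU]
    ring
  rw [e1, add_mul, add_mul]
  refine add_le_add (add_le_add ?_ ?_) ?_
  · exact h.sum_overlap_le (h.card_le_of_le hUc (by norm_num))
  · rw [mul_assoc (t ^ 2 * (cvar p s)⁻¹)]
    refine mul_le_mul_of_nonneg_left ?_ (by positivity)
    exact h.sum_meets_mul_le (h.card_le_of_le hUc (by norm_num)) (by positivity)
      fun m => h.sum_triples_le (hUm m)
  · rw [mul_assoc (t * (√(cvar p s))⁻¹)]
    refine mul_le_mul_of_nonneg_left ?_ (by positivity)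
    refine h.sum_meets_mul_le (h.card_le_of_le hUc (by norm_num)) (by positivity) fun m => ?_
    refine le_trans (sum_le_sum fun k _ => sum_le_sum fun l _ => ?_) (h.sum_overlap_le (hUm m))
    refine mul_le_mul_of_nonneg_left ?_ (meets_nonneg _ _)
    exact mul_le_mul_of_nonneg_right (meets_le_overlap U _ m) (by positivity)

end SecondMoment

end SubgraphCount

namespace SubgraphCount

open Finset

set_option linter.unusedSectionVars false

/-! ### Tilted first moments, and the two error terms of the Stein identity. -/

section TiltedMoments

variable {E : Type*} [Fintype E] [DecidableEq E] {I : Type*} [Fintype I]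
  {p t c κ K L₁ L₂ : ℝ} {s : I → Finset E} {e : ℕ} {ξ : I → I → Finset E → ℝ}

theorem expect_sq_sum_mul_exp_le (h : SumBounds p s e L₁ L₂) (hξ : CenteredFamily p κ s ξ)
    (ht : 0 ≤ t) (hκ : 0 ≤ κ)
    (hc : ∀ B : Finset E, #B ≤ 6 * e → ∀ A, t * loss p s B A ≤ c) (hv : 0 < cvar p s) :
    expect p (fun A => ((cvar p s)⁻¹ * ∑ i, ∑ j, ξ i j A) ^ 2 * Real.exp (t * std p s A)) ≤
      ((cvar p s)⁻¹) ^ 2 * (tiltConst p t c κ s e *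
        ((2 * L₁ ^ 2 + t ^ 2 * (cvar p s)⁻¹ * (L₁ ^ 2 * L₂ * L₁) +
          t * (√(cvar p s))⁻¹ * (2 * L₁ ^ 2 * L₁)) * L₁ * L₂)) := by
  have e1 : ∀ A, ((cvar p s)⁻¹ * ∑ i, ∑ j, ξ i j A) ^ 2 * Real.exp (t * std p s A) =
      ((cvar p s)⁻¹) ^ 2 * ∑ i, ∑ j, ∑ k, ∑ l,
        ξ i j A * ξ k l A * Real.exp (t * std p s A) := fun A => by
    rw [mul_pow, sq (∑ i, ∑ j, ξ i j A), sum_mul, mul_assoc, sum_mul]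
    congr 1
    refine sum_congr rfl fun i _ => ?_
    rw [sum_mul, sum_mul]
    refine sum_congr rfl fun j _ => ?_
    rw [mul_sum, sum_mul]
    refine sum_congr rfl fun k _ => ?_
    rw [mul_sum, sum_mul]
  simp only [e1, expect_const_mul, expect_sum]
  refine mul_le_mul_of_nonneg_left ?_ (by positivity)
  refine le_trans ?_ (mul_le_mul_of_nonneg_left (sum_pairWeight_le h ht hv)
    (tiltConst_nonneg h hξ ht hκ hc))
  simp only [mul_sum]
  refine sum_le_sum fun i _ => sum_le_sum fun j _ => sum_le_sum fun k _ => sum_le_sum fun l _ => ?_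
  exact expect_pair_le h hξ ht hκ hc hv i j k l

/-- The constant in the bound for tilted first moments. -/
noncomputable def momentConst (e : ℕ) (c κ K : ℝ) : ℝ :=
  √(21 * (e + 2) * κ ^ 2 * Real.exp c * K ^ 3)

/-- Cauchy–Schwarz with weight e^{tW} reduces this to the second moment. The variance comparison
`hKv` then eliminates the variance, leaving only the ratio of `L₁` to `L₂ * (1 - p)`. -/
theorem expect_abs_sum_mul_exp_le (h : SumBounds p s e L₁ L₂) (hξ : CenteredFamily p κ s ξ)
    (ht : 0 ≤ t) (hκ : 0 ≤ κ)
    (hc : ∀ B : Finset E, #B ≤ 6 * e → ∀ A, t * loss p s B A ≤ c) (hv : 0 < cvar p s)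
    (hp : p < 1) (hL : 0 < L₁) (hLL : L₁ ≤ L₂) (hK : 1 ≤ K)
    (hKv : L₁ * L₂ * (1 - p) ≤ K * cvar p s) :
    expect p (fun A => |(cvar p s)⁻¹ * ∑ i, ∑ j, ξ i j A| * Real.exp (t * std p s A)) ≤
      momentConst e c κ K * (√(L₁ / (L₂ * (1 - p))) * (1 + t / √(1 - p))) *
        expect p (fun A => Real.exp (t * std p s A)) := by
  have h0 := h.p_nonneg
  have h1 := h.p_le_one
  have hq : 0 < 1 - p := sub_pos.2 hp
  have hL2 : 0 < L₂ := hL.trans_le hLL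
  set v := cvar p s with hvdef
  set q := 1 - p with hqdef
  set H := expect p (fun A => Real.exp (t * std p s A)) with hH
  have hH0 : 0 ≤ H := expect_nonneg h0 h1 fun A => Real.exp_nonneg _
  have main := expect_sq_sum_mul_exp_le h hξ ht hκ hc hv
  rw [← hvdef] at main
  have hσ : (√v)⁻¹ ^ 2 = v⁻¹ := by rw [inv_pow, Real.sq_sqrt hv.le]
  -- the sum over tuples
  have hS : (2 * L₁ ^ 2 + t ^ 2 * v⁻¹ * (L₁ ^ 2 * L₂ * L₁) +
          t * (√v)⁻¹ * (2 * L₁ ^ 2 * L₁)) * L₁ * L₂ ≤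
      4 * (L₁ ^ 3 * L₂) + 3 * t ^ 2 * (v⁻¹ * (L₁ ^ 4 * L₂ ^ 2)) := by
    -- From u ≤ 1 + u²: the term linear in `t` is absorbed into the other two, the quadratic one
    -- with the help of `L₁ ≤ L₂`.
    have a1 : t * (√v)⁻¹ * L₁ ≤ 1 + t ^ 2 * v⁻¹ * L₁ ^ 2 := by
      rw [← hσ]; nlinarith [sq_nonneg (t * (√v)⁻¹ * L₁ - 1), sq_nonneg (t * (√v)⁻¹ * L₁)]
    have a2 := mul_le_mul_of_nonneg_left a1 (by positivity : 0 ≤ 2 * (L₁ ^ 3 * L₂))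
    have a3 := mul_le_mul_of_nonneg_left hLL
      (by positivity : 0 ≤ 2 * t ^ 2 * v⁻¹ * (L₁ ^ 4 * L₂))
    nlinarith [a2, a3]
  -- In these variables the two remaining terms are multiples of y²ρ and y³ρt²/q, and `y ≤ K`.
  set y := L₁ * L₂ * q / v with hy
  set ρ := L₁ / (L₂ * q) with hρ
  have hy0 : 0 ≤ y := by positivity
  have hρ0 : 0 ≤ ρ := by positivity
  have hyK : y ≤ K := by rw [hy, div_le_iff₀ hv]; exact hKv
  have b1 : v⁻¹ ^ 2 * (q * (L₁ ^ 3 * L₂)) = y ^ 2 * ρ := by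
    rw [hy, hρ]; field_simp
  have b2 : v⁻¹ ^ 2 * (q * (v⁻¹ * (L₁ ^ 4 * L₂ ^ 2))) = y ^ 3 * ρ / q := by
    rw [hy, hρ]; field_simp
  have c1 : y ^ 2 ≤ K ^ 3 := (pow_le_pow_left₀ hy0 hyK 2).trans
    (pow_le_pow_right₀ hK (by norm_num))
  have c2 : y ^ 3 ≤ K ^ 3 := pow_le_pow_left₀ hy0 hyK 3
  have sq_bound : expect p (fun A => (v⁻¹ * ∑ i, ∑ j, ξ i j A) ^ 2 *
      Real.exp (t * std p s A)) ≤
      21 * (e + 2) * κ ^ 2 * Real.exp c * K ^ 3 * (ρ * (1 + t ^ 2 / q)) * H := by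
    refine main.trans ?_
    rw [tiltConst, ← hqdef, ← hH]
    have d1 : v⁻¹ ^ 2 * (q * (4 * (L₁ ^ 3 * L₂) + 3 * t ^ 2 * (v⁻¹ * (L₁ ^ 4 * L₂ ^ 2)))) ≤
        7 * K ^ 3 * (ρ * (1 + t ^ 2 / q)) := by
      have : v⁻¹ ^ 2 * (q * (4 * (L₁ ^ 3 * L₂) + 3 * t ^ 2 * (v⁻¹ * (L₁ ^ 4 * L₂ ^ 2)))) =
          4 * (y ^ 2 * ρ) + 3 * t ^ 2 * (y ^ 3 * ρ / q) := by
        rw [← b1, ← b2]; ring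
      rw [this]
      have f1 : y ^ 2 * ρ ≤ K ^ 3 * ρ := mul_le_mul_of_nonneg_right c1 hρ0
      have f2 : t ^ 2 * (y ^ 3 * ρ / q) ≤ K ^ 3 * ρ * (t ^ 2 / q) := by
        have := mul_le_mul_of_nonneg_right c2 (by positivity : 0 ≤ ρ * (t ^ 2 / q))
        refine le_trans (le_of_eq ?_) (this.trans (le_of_eq ?_)) <;> ring
      have f3 : 0 ≤ K ^ 3 * ρ := by positivity
      have f4 : 0 ≤ K ^ 3 * ρ * (t ^ 2 / q) := by positivity
      linarith
    have d2 := mul_le_mul_of_nonneg_left hS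
      (by positivity : 0 ≤ v⁻¹ ^ 2 * q * (κ ^ 2 * Real.exp c * (3 * (e + 2)) * H))
    have d3 := mul_le_mul_of_nonneg_right d1
      (by positivity : 0 ≤ κ ^ 2 * Real.exp c * (3 * (e + 2)) * H)
    refine le_trans (le_of_eq ?_) (d2.trans (le_trans (le_of_eq ?_) (d3.trans (le_of_eq ?_))))
    all_goals ring
  have cs := sq_expect_mul_le h0 h1 (fun A => v⁻¹ * ∑ i, ∑ j, ξ i j A)
    (fun A => Real.exp (t * std p s A)) fun A => Real.exp_nonneg _
  refine abs_le_of_sq_le_sq' (a := expect p (fun A => |v⁻¹ * ∑ i, ∑ j, ξ i j A| *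
    Real.exp (t * std p s A))) ?_ (by unfold momentConst; positivity) |>.2
  refine cs.trans ((mul_le_mul_of_nonneg_right sq_bound hH0).trans ?_)
  rw [mul_pow, mul_pow, mul_pow, momentConst, Real.sq_sqrt (by positivity), Real.sq_sqrt hρ0,
    mul_assoc _ H H, ← sq H]
  have g1 : 1 + t ^ 2 / q ≤ (1 + t / √q) ^ 2 := by
    have : (t / √q) ^ 2 = t ^ 2 / q := by rw [div_pow, Real.sq_sqrt hq.le]
    have : 0 ≤ t / √q := by positivity
    nlinarith
  gcongr

theorem expect_gain (i j : I) :
    expect p (gain s i j) = p ^ #(s j \ s i) * (1 - p ^ #(s i ∩ s j)) := by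
  have hd : Disjoint (s j \ s i) (s i ∩ s j) :=
    disjoint_sdiff_self_left.mono_right inter_subset_left
  have := expect_mul_of_local (p := p) (localOn_ind (s j \ s i))
    ((localOn_ind (s i ∩ s j)).comp (fun x => 1 - x)) hd
  rw [expect_sub, expect_one, expect_ind, expect_ind] at this
  exact this

theorem pow_card_union (i j : I) :
    p ^ #(s i) * p ^ #(s j \ s i) = p ^ #(s i ∪ s j) := by
  rw [← pow_add, ← card_union_of_disjoint disjoint_sdiff, union_sdiff_self_eq_union]

theorem gain_of_disjoint {i j : I} (h : Disjoint (s i) (s j)) (A : Finset E) :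
    gain s i j A = 0 := by
  rw [gain, disjoint_iff_inter_eq_empty.1 h, ind_empty, sub_self, mul_zero]

theorem centeredFamily_steinVar (h0 : 0 ≤ p) (h1 : p ≤ 1) (he : ∀ i, #(s i) ≤ e) :
    CenteredFamily p (e + 1) s (fun i j A => p ^ #(s i) *
      (gain s i j A - p ^ #(s j \ s i) * (1 - p ^ #(s i ∩ s j)))) where
  localOn i j := (localOn_gain i j).comp fun x => p ^ #(s i) *
      (x - p ^ #(s j \ s i) * (1 - p ^ #(s i ∩ s j)))
  expect_eq_zero i j := by
    rw [expect_const_mul, expect_sub, expect_const, expect_gain, sub_self, mul_zero]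
  eq_zero i j h A := by
    rw [gain_of_disjoint h, disjoint_iff_inter_eq_empty.1 h]; simp
  abs_le i j A := by
    have hq : 0 ≤ 1 - p := sub_nonneg.2 h1
    have a1 : 0 ≤ p ^ #(s i) * gain s i j A := mul_nonneg (by positivity) (gain_nonneg _ _ _)
    have a2 := one_sub_pow_le h0 h1 ((card_le_card inter_subset_left).trans (he i) :
      #(s i ∩ s j) ≤ e)
    have a3 : 0 ≤ 1 - p ^ #(s i ∩ s j) := sub_nonneg.2 (pow_le_one₀ h0 h1)
    have a4 := ind_nonneg (s i ∪ s j) A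
    have a5 : 0 ≤ p ^ #(s i ∪ s j) := by positivity
    have a6 := mul_le_mul_of_nonneg_left a2 a5
    have a7 := mul_nonneg a5 a3
    have e1 : p ^ #(s i) * (gain s i j A - p ^ #(s j \ s i) * (1 - p ^ #(s i ∩ s j))) =
        p ^ #(s i) * gain s i j A - p ^ #(s i ∪ s j) * (1 - p ^ #(s i ∩ s j)) := by
      rw [← pow_card_union i j]; ring
    have b1 : 0 ≤ (e : ℝ) * (p ^ #(s i) * gain s i j A) := by positivity
    have b2 : 0 ≤ (1 - p) * p ^ #(s i ∪ s j) := by positivity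
    have b3 : 0 ≤ ((e : ℝ) + 1) * ((1 - p) * ind (s i ∪ s j) A) := by positivity
    have b4 : 0 ≤ (e : ℝ) * ((1 - p) * p ^ #(s i ∪ s j)) := by positivity
    rw [e1, majorant, abs_le]
    constructor <;> nlinarith

/-- Centring is `expect_gain_mul` applied to a constant function, so the expansion remainder obeys
the same moment bound as the fluctuation of `steinVar`. -/
theorem centeredFamily_steinRem (h0 : 0 ≤ p) (h1 : p ≤ 1) (he : ∀ i, #(s i) ≤ e) :
    CenteredFamily p (e + 1) s (fun i j A =>
      ind (s i) A * (ind (s j \ s i) A * (1 - p ^ #(s i ∩ s j))) - p ^ #(s i) * gain s i j A) where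
  localOn i j :=
    LocalOn.comp₂ (fun x y => x - p ^ #(s i) * y)
      (((localOn_ind (s i)).mono subset_union_left).mul
        (((localOn_ind (s j \ s i)).mono (sdiff_subset.trans subset_union_right)).comp
          fun x => x * (1 - p ^ #(s i ∩ s j))))
      (localOn_gain i j)
  expect_eq_zero i j := by
    have := expect_gain_mul (p := p) (s := s) i j (fun _ => 1)
    simp only [mul_one] at this
    rw [expect_sub, expect_const_mul, ← this]
    exact sub_self _
  eq_zero i j h A := by
    rw [gain_of_disjoint h, disjoint_iff_inter_eq_empty.1 h]; simp
  abs_le i j A := by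
    have hq : 0 ≤ 1 - p := sub_nonneg.2 h1
    have a1 : 0 ≤ p ^ #(s i) * gain s i j A := mul_nonneg (by positivity) (gain_nonneg _ _ _)
    have a2 := one_sub_pow_le h0 h1 ((card_le_card inter_subset_left).trans (he i) :
      #(s i ∩ s j) ≤ e)
    have a3 : 0 ≤ 1 - p ^ #(s i ∩ s j) := sub_nonneg.2 (pow_le_one₀ h0 h1)
    have a4 := ind_nonneg (s i ∪ s j) A
    have a6 := mul_le_mul_of_nonneg_left a2 a4
    have a7 := mul_nonneg a4 a3
    have e1 : ind (s i) A * (ind (s j \ s i) A * (1 - p ^ #(s i ∩ s j))) =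
        ind (s i ∪ s j) A * (1 - p ^ #(s i ∩ s j)) := by
      rw [← mul_assoc, ind_mul_ind, union_sdiff_self_eq_union]
    have b1 : 0 ≤ (e : ℝ) * (p ^ #(s i) * gain s i j A) := by positivity
    have b2 : 0 ≤ ((e : ℝ) + 1) * ((1 - p) * p ^ #(s i ∪ s j)) := by positivity
    have b3 : 0 ≤ (1 - p) * ind (s i ∪ s j) A := by positivity
    rw [e1, majorant, abs_le]
    constructor <;> nlinarith

/-- The variance is exactly the mean of the double sum in `steinVar`, so subtracting 1 centres every
term. -/
theorem steinVar_sub_one (hv : 0 < cvar p s) (A : Finset E) :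
    steinVar p s A - 1 = (cvar p s)⁻¹ * ∑ i, ∑ j, p ^ #(s i) *
      (gain s i j A - p ^ #(s j \ s i) * (1 - p ^ #(s i ∩ s j))) := by
  have : cvar p s = ∑ i, ∑ j, p ^ #(s i) * (p ^ #(s j \ s i) * (1 - p ^ #(s i ∩ s j))) := by
    refine sum_congr rfl fun i _ => sum_congr rfl fun j _ => ?_
    rw [← card_union_add_card_inter (s i) (s j), pow_add, ← pow_card_union i j]
    ring
  have e2 : ∑ i, ∑ j, p ^ #(s i) *
      (gain s i j A - p ^ #(s j \ s i) * (1 - p ^ #(s i ∩ s j))) =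
      (∑ i, ∑ j, p ^ #(s i) * gain s i j A) - cvar p s := by
    rw [this]
    simp only [← sum_sub_distrib, ← mul_sub]
  rw [e2, mul_sub, inv_mul_cancel₀ hv.ne', steinVar]

/-- The two error terms of the tilted Stein identity. -/
structure TiltedErrors (p : ℝ) (s : I → Finset E) (t ε : ℝ) : Prop where
  var : expect p (fun A => |steinVar p s A - 1| * Real.exp (t * std p s A)) ≤
    ε * expect p (fun A => Real.exp (t * std p s A))
  rem : expect p (fun A => |steinRem p s A| * Real.exp (t * std p s A)) ≤
    ε * expect p (fun A => Real.exp (t * std p s A))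

theorem tiltedErrors (h : SumBounds p s e L₁ L₂)
    (ht : 0 ≤ t) (hc : ∀ B : Finset E, #B ≤ 6 * e → ∀ A, t * loss p s B A ≤ c)
    (hv : 0 < cvar p s) (hp : p < 1) (hL : 0 < L₁) (hLL : L₁ ≤ L₂) (hK : 1 ≤ K)
    (hKv : L₁ * L₂ * (1 - p) ≤ K * cvar p s) :
    TiltedErrors p s t (momentConst e c (e + 1) K *
      (√(L₁ / (L₂ * (1 - p))) * (1 + t / √(1 - p)))) where
  var := by
    simp only [steinVar_sub_one hv]
    exact expect_abs_sum_mul_exp_le h (centeredFamily_steinVar h.p_nonneg h.p_le_one h.card_le)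
      ht (by positivity) hc hv hp hL hLL hK hKv
  rem := expect_abs_sum_mul_exp_le h
    (centeredFamily_steinRem h.p_nonneg h.p_le_one h.card_le)
    ht (by positivity) hc hv hp hL hLL hK hKv

end TiltedMoments

end SubgraphCount

namespace SubgraphCount

/-! ### The normal distribution and its Mills ratio. -/

section Gaussian

open Filter Topology

/-- The standard normal density. -/
noncomputable def dens (x : ℝ) : ℝ := (√(2 * Real.pi))⁻¹ * Real.exp (-(x ^ 2 / 2))

theorem gaussianPDFReal_zero_one : gaussianPDFReal 0 1 = dens := by
  ext x; simp [gaussianPDFReal, dens, neg_div]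

theorem dens_pos (x : ℝ) : 0 < dens x := by
  unfold dens; positivity

theorem integrable_dens : Integrable dens := by
  rw [← gaussianPDFReal_zero_one]; exact integrable_gaussianPDFReal 0 1

theorem hasDerivAt_dens (x : ℝ) : HasDerivAt dens (-(x * dens x)) x := by
  have h := (((((hasDerivAt_id x).pow 2).div_const 2).neg).exp).const_mul (√(2 * Real.pi))⁻¹
  refine h.congr_deriv ?_
  simp [dens]; ring

theorem continuous_dens : Continuous dens := by unfold dens; fun_prop

theorem Phi_eq_integral (x : ℝ) : Phi x = ∫ y in Set.Iic x, dens y := by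
  rw [Phi, cdf_eq_real, Measure.real, gaussianReal_apply_eq_integral 0 one_ne_zero,
    gaussianPDFReal_zero_one, ENNReal.toReal_ofReal]
  exact setIntegral_nonneg measurableSet_Iic fun y _ => (dens_pos y).le

theorem one_sub_Phi_eq_integral (x : ℝ) : 1 - Phi x = ∫ y in Set.Ioi x, dens y := by
  have h := intervalIntegral.integral_Iic_add_Ioi (f := dens) (b := x) (μ := volume)
    integrable_dens.integrableOn integrable_dens.integrableOn
  rw [← Phi_eq_integral] at h
  have h1 : ∫ y, dens y = 1 := by
    rw [← gaussianPDFReal_zero_one]; exact integral_gaussianPDFReal_eq_one 0 one_ne_zero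
  linarith

theorem hasDerivAt_Phi (x : ℝ) : HasDerivAt Phi (dens x) x := by
  have h : Phi = fun y => Phi 0 + ∫ u in (0 : ℝ)..y, dens u := by
    ext y
    rw [Phi_eq_integral y, Phi_eq_integral 0, ← intervalIntegral.integral_Iic_sub_Iic
      integrable_dens.integrableOn integrable_dens.integrableOn]
    ring
  rw [h]
  exact (intervalIntegral.integral_hasDerivAt_right (continuous_dens.intervalIntegrable _ _)
    (continuous_dens.stronglyMeasurableAtFilter _ _) continuous_dens.continuousAt).const_add _

theorem Phi_nonneg (x : ℝ) : 0 ≤ Phi x := cdf_nonneg _ _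

theorem Phi_le_one (x : ℝ) : Phi x ≤ 1 := cdf_le_one _ _

theorem one_sub_Phi_pos (x : ℝ) : 0 < 1 - Phi x := by
  have hs : StrictMono Phi := strictMono_of_hasDerivAt_pos hasDerivAt_Phi dens_pos
  have := hs (lt_add_one x)
  linarith [Phi_le_one (x + 1)]

theorem Phi_neg (x : ℝ) : Phi (-x) = 1 - Phi x := by
  rw [one_sub_Phi_eq_integral, Phi_eq_integral, ← integral_comp_neg_Ioi]
  congr 1
  ext y; simp [dens]

/-- The Mills ratio of the standard normal distribution. -/
noncomputable def mills (x : ℝ) : ℝ := (1 - Phi x) * (√(2 * Real.pi) * Real.exp (x ^ 2 / 2))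

theorem mills_pos (x : ℝ) : 0 < mills x :=
  mul_pos (one_sub_Phi_pos x) (by positivity)

theorem dens_mul_exp (x : ℝ) : dens x * (√(2 * Real.pi) * Real.exp (x ^ 2 / 2)) = 1 := by
  have h : Real.exp (-(x ^ 2 / 2)) * Real.exp (x ^ 2 / 2) = 1 := by
    rw [← Real.exp_add]; simp
  have h2 : √(2 * Real.pi) ≠ 0 := by positivity
  rw [dens]
  field_simp
  exact h

/-- For y > x one has x · `dens y` ≤ y · `dens y`, and the right-hand side is the derivative of
-`dens`. -/
theorem mul_one_sub_Phi_le (x : ℝ) : x * (1 - Phi x) ≤ dens x := by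
  have hd : ∀ y ∈ Set.Ici x, HasDerivAt (fun y => -dens y) (y * dens y) y := fun y _ =>
    (hasDerivAt_dens y).neg.congr_deriv (neg_neg _)
  have hi : Integrable fun y => y * dens y := by
    have := integrable_mul_exp_neg_mul_sq (b := 1 / 2) (by norm_num)
    refine (this.const_mul (√(2 * Real.pi))⁻¹).congr (ae_of_all _ fun y => ?_)
    simp only [dens]
    ring_nf
  have hlim : Tendsto (fun y => -dens y) atTop (𝓝 0) := by
    have h1 : Tendsto (fun y : ℝ => y ^ 2 / 2) atTop atTop :=
      (tendsto_pow_atTop two_ne_zero).atTop_div_const (by norm_num)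
    have h2 := (Real.tendsto_exp_neg_atTop_nhds_zero.comp h1).const_mul (√(2 * Real.pi))⁻¹
    simpa [dens, Function.comp_def] using h2.neg
  have h := integral_Ioi_of_hasDerivAt_of_tendsto' hd hi.integrableOn hlim
  rw [one_sub_Phi_eq_integral, ← integral_const_mul]
  have h2 : ∫ y in Set.Ioi x, y * dens y = dens x := by rw [h]; ring
  rw [← h2]
  refine setIntegral_mono_on (integrable_dens.const_mul x).integrableOn hi.integrableOn
    measurableSet_Ioi fun y hy => ?_
  exact mul_le_mul_of_nonneg_right (le_of_lt hy) (dens_pos y).le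

theorem mul_mills_le_one (x : ℝ) : x * mills x ≤ 1 := by
  rw [← dens_mul_exp x, mills, ← mul_assoc]
  exact mul_le_mul_of_nonneg_right (mul_one_sub_Phi_le x) (by positivity)

theorem tendsto_mul_dens : Tendsto (fun y => y * dens y) atTop (𝓝 0) := by
  have h := tendsto_rpow_abs_mul_exp_neg_mul_sq_cocompact (a := 1 / 2) (by norm_num) 1
  have h1 : Tendsto (fun y : ℝ => |y| ^ (1 : ℝ) * Real.exp (-(1 / 2) * y ^ 2)) atTop (𝓝 0) :=
    h.mono_left atTop_le_cocompact
  have h2 := h1.const_mul (√(2 * Real.pi))⁻¹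
  rw [mul_zero] at h2
  refine h2.congr' ?_
  filter_upwards [eventually_ge_atTop 0] with y hy
  rw [abs_of_nonneg hy, Real.rpow_one, dens]
  ring_nf

/-- The difference of the two sides is decreasing, by `mul_one_sub_Phi_le`, and tends to 0 at
infinity. This inequality makes x · `mills x` increasing. -/
theorem le_one_add_sq_mul_one_sub_Phi (x : ℝ) : x * dens x ≤ (1 + x ^ 2) * (1 - Phi x) := by
  set B : ℝ → ℝ := fun y => (1 + y ^ 2) * (1 - Phi y) - y * dens y with hB
  have hd : ∀ y, HasDerivAt B (2 * (y * (1 - Phi y) - dens y)) y := fun y => by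
    have h := ((((hasDerivAt_id y).pow 2).const_add 1).mul ((hasDerivAt_Phi y).const_sub 1)).sub
      ((hasDerivAt_id y).mul (hasDerivAt_dens y))
    refine h.congr_deriv ?_
    simp; ring
  have hanti : Antitone B := antitone_of_hasDerivAt_nonpos hd fun y => by
    have := mul_one_sub_Phi_le y
    simp only [Pi.zero_apply]
    linarith
  have hlim : Tendsto B atTop (𝓝 0) := by
    have h1 : Tendsto (fun y => 1 - Phi y) atTop (𝓝 0) := by
      have := (tendsto_cdf_atTop (gaussianReal 0 1)).const_sub 1
      rwa [sub_self] at this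
    have h2 : Tendsto (fun y => y ^ 2 * (1 - Phi y)) atTop (𝓝 0) := by
      refine squeeze_zero' (Eventually.of_forall fun y => ?_) ?_ tendsto_mul_dens
      · have := (one_sub_Phi_pos y).le; positivity
      · filter_upwards [eventually_ge_atTop 0] with y hy
        rw [sq, mul_assoc]
        exact mul_le_mul_of_nonneg_left (mul_one_sub_Phi_le y) hy
    have h3 := (h1.add h2).sub tendsto_mul_dens
    simp only [add_zero, sub_zero] at h3
    refine h3.congr fun y => ?_
    simp only [hB]; ring
  have := hanti.le_of_tendsto hlim x
  simp only [hB] at this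
  linarith

theorem le_one_add_sq_mul_mills (x : ℝ) : x ≤ (1 + x ^ 2) * mills x := by
  have h := mul_le_mul_of_nonneg_right (le_one_add_sq_mul_one_sub_Phi x)
    (by positivity : 0 ≤ √(2 * Real.pi) * Real.exp (x ^ 2 / 2))
  rw [mul_assoc, dens_mul_exp, mul_one, mul_assoc] at h
  exact h

theorem hasDerivAt_mills (x : ℝ) : HasDerivAt mills (x * mills x - 1) x := by
  have h := ((hasDerivAt_Phi x).const_sub 1).mul
    (((((hasDerivAt_id x).pow 2).div_const 2).exp).const_mul (√(2 * Real.pi)))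
  refine h.congr_deriv ?_
  have := dens_mul_exp x
  simp only [mills, id, Pi.pow_apply]
  norm_num only [Nat.cast_ofNat]
  linear_combination -this

theorem mills_anti : Antitone mills :=
  antitone_of_hasDerivAt_nonpos hasDerivAt_mills fun x => by
    simp only [Pi.zero_apply]
    linarith [mul_mills_le_one x]

theorem mul_mills_mono : Monotone fun x => x * mills x := by
  refine monotone_of_hasDerivAt_nonneg (fun x => (hasDerivAt_id x).mul (hasDerivAt_mills x))
    fun x => ?_
  have := le_one_add_sq_mul_mills x
  simp only [id, Pi.zero_apply]
  linarith

theorem mills_zero_le : mills 0 ≤ 2 := by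
  have h1 : Phi 0 = 1 / 2 := by
    have := Phi_neg 0
    rw [neg_zero] at this; linarith
  have h2 : √(2 * Real.pi) ≤ 4 := by
    rw [Real.sqrt_le_left (by norm_num)]
    have := Real.pi_le_four
    linarith
  have h3 : Real.exp ((0 : ℝ) ^ 2 / 2) = 1 := by norm_num
  rw [mills, h1, h3]
  linarith

/-- For x ≥ 1 this follows from `le_one_add_sq_mul_mills`, and on [0, 1] from monotonicity and the
case x = 1. It limits the cost of dividing by the normal tail to a factor 1 + z. -/
theorem one_le_mul_mills {x : ℝ} (hx : 0 ≤ x) : 1 ≤ 2 * (1 + x) * mills x := by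
  have hp := mills_pos x
  rcases le_total 1 x with h | h
  · have := le_one_add_sq_mul_mills x
    have h1 : x * 1 ≤ x * (2 * (1 + x) * mills x) := by nlinarith
    exact le_of_mul_le_mul_left h1 (by linarith)
  · have h1 := mills_anti h
    have h2 := le_one_add_sq_mul_mills 1
    nlinarith

theorem mills_neg_mul (x : ℝ) : (1 - Phi x) * mills (-x) = Phi x * mills x := by
  rw [mills, mills, Phi_neg]; ring_nf

end Gaussian

/-! ### The Stein solution, its tilted version and a monotone decomposition of the derivative. -/

section SteinSolution

/-- The bounded solution `f` of `f' y = y * f y + 1_{y ≤ x} - Φ x`. -/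
noncomputable def steinSol (x y : ℝ) : ℝ :=
  if y ≤ x then (1 - Phi x) * mills (-y) else Phi x * mills y

theorem steinSol_of_le {x y : ℝ} (h : y ≤ x) : steinSol x y = (1 - Phi x) * mills (-y) := if_pos h

theorem steinSol_of_ge {x y : ℝ} (h : x ≤ y) : steinSol x y = Phi x * mills y := by
  rcases h.eq_or_lt with rfl | h
  · rw [steinSol_of_le le_rfl, mills_neg_mul]
  · exact if_neg (not_le.2 h)

theorem steinSol_nonneg (x y : ℝ) : 0 ≤ steinSol x y := by
  rcases le_total y x with h | h
  · rw [steinSol_of_le h]; exact mul_nonneg (one_sub_Phi_pos x).le (mills_pos _).le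
  · rw [steinSol_of_ge h]; exact mul_nonneg (Phi_nonneg x) (mills_pos _).le

theorem steinSol_monotoneOn {x y y' : ℝ} (h : y ≤ y') (h' : y' ≤ x) :
    steinSol x y ≤ steinSol x y' := by
  rw [steinSol_of_le (h.trans h'), steinSol_of_le h']
  exact mul_le_mul_of_nonneg_left (mills_anti (neg_le_neg h)) (one_sub_Phi_pos x).le

theorem steinSol_antitoneOn {x y y' : ℝ} (h : y ≤ y') (h' : x ≤ y) :
    steinSol x y' ≤ steinSol x y := by
  rw [steinSol_of_ge h', steinSol_of_ge (h'.trans h)]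
  exact mul_le_mul_of_nonneg_left (mills_anti h) (Phi_nonneg x)

theorem steinSol_le_self (x y : ℝ) : steinSol x y ≤ steinSol x x := by
  rcases le_total y x with h | h
  · exact steinSol_monotoneOn h le_rfl
  · exact steinSol_antitoneOn h le_rfl

theorem steinSol_le (x y : ℝ) : steinSol x y ≤ 2 := by
  refine (steinSol_le_self x y).trans ?_
  rcases le_total 0 x with h | h
  · rw [steinSol_of_ge le_rfl]
    have := (mills_anti h).trans mills_zero_le
    have := Phi_le_one x; have := Phi_nonneg x; have := mills_pos x
    nlinarith
  · rw [steinSol_of_le le_rfl]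
    have := (mills_anti (neg_nonneg.2 h)).trans mills_zero_le
    have := Phi_nonneg x; have := one_sub_Phi_pos x; have := mills_pos (-x)
    nlinarith

/-- On either side of `x` this is `mul_mills_mono`, at `-y` on the left and at `y` on the right; the
two branches agree at `x`. -/
theorem mul_steinSol_mono (x : ℝ) : Monotone fun y => y * steinSol x y := by
  have h1 : ∀ y y', y ≤ y' → y' ≤ x → y * steinSol x y ≤ y' * steinSol x y' := fun y y' h h' => by
    rw [steinSol_of_le (h.trans h'), steinSol_of_le h']
    have := mul_le_mul_of_nonneg_left (mul_mills_mono (neg_le_neg h)) (one_sub_Phi_pos x).le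
    simp only at this
    linarith
  have h2 : ∀ y y', y ≤ y' → x ≤ y → y * steinSol x y ≤ y' * steinSol x y' := fun y y' h h' => by
    rw [steinSol_of_ge h', steinSol_of_ge (h'.trans h)]
    have := mul_le_mul_of_nonneg_left (mul_mills_mono h) (Phi_nonneg x)
    simp only at this
    linarith
  intro y y' h
  rcases le_total y' x with h3 | h3
  · exact h1 y y' h h3
  rcases le_total x y with h4 | h4
  · exact h2 y y' h h4
  · exact (h1 y x h4 le_rfl).trans (h2 x y' h3 le_rfl)

theorem mul_steinSol_le_one (x y : ℝ) : y * steinSol x y ≤ 1 := by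
  refine (mul_steinSol_mono x (le_max_left y x)).trans ?_
  dsimp only
  rw [steinSol_of_ge (le_max_right y x)]
  have h1 := mul_mills_le_one (max y x)
  have h2 := Phi_nonneg x
  have h3 := Phi_le_one x
  nlinarith

theorem neg_one_le_mul_steinSol (x y : ℝ) : -1 ≤ y * steinSol x y := by
  refine le_trans ?_ (mul_steinSol_mono x (min_le_left y x))
  dsimp only
  rw [steinSol_of_le (min_le_right y x)]
  have h1 := mul_mills_le_one (-min y x)
  have h2 := Phi_nonneg x
  have h3 := one_sub_Phi_pos x
  nlinarith

/-- The derivative of `steinSol x`. -/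
noncomputable def steinSol' (x y : ℝ) : ℝ :=
  y * steinSol x y + (if y ≤ x then 1 else 0) - Phi x

theorem abs_steinSol'_le (x y : ℝ) : |steinSol' x y| ≤ 2 := by
  have h1 := mul_steinSol_le_one x y
  have h2 := neg_one_le_mul_steinSol x y
  have h3 := Phi_nonneg x
  have h4 := Phi_le_one x
  unfold steinSol'
  rw [abs_le]
  split_ifs <;> constructor <;> linarith

theorem hasDerivAt_steinSol {x y : ℝ} (h : y ≠ x) :
    HasDerivAt (steinSol x) (steinSol' x y) y := by
  rcases lt_or_gt_of_ne h with h | h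
  · have h1 := ((hasDerivAt_mills (-y)).comp y (hasDerivAt_neg y)).const_mul (1 - Phi x)
    have h2 : HasDerivAt (steinSol x) _ y := h1.congr_of_eventuallyEq
      (by filter_upwards [eventually_lt_nhds h] with u hu using steinSol_of_le hu.le)
    refine h2.congr_deriv ?_
    rw [steinSol', if_pos h.le, steinSol_of_le h.le]; ring
  · have h1 := (hasDerivAt_mills y).const_mul (Phi x)
    have h2 : HasDerivAt (steinSol x) _ y := h1.congr_of_eventuallyEq
      (by filter_upwards [eventually_gt_nhds h] with u hu using steinSol_of_ge hu.le)
    refine h2.congr_deriv ?_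
    rw [steinSol', if_neg (not_le.2 h), steinSol_of_ge h.le]; ring

theorem continuous_mills : Continuous mills :=
  continuous_iff_continuousAt.2 fun x => (hasDerivAt_mills x).continuousAt

theorem continuous_steinSol (x : ℝ) : Continuous (steinSol x) := by
  have := continuous_mills
  refine Continuous.if_le (by fun_prop) (by fun_prop) continuous_id continuous_const ?_
  rintro y rfl
  exact mills_neg_mul y

/-- The mean value inequality for a continuous function with one possible kink `c`: if `c` is
interior, the interval is split there. -/
theorem abs_sub_le_of_hasDerivAt_off_point {g g' : ℝ → ℝ} {a b c K d : ℝ} (hab : a ≤ b)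
    (hg : Continuous g) (hd : ∀ u ≠ c, HasDerivAt g (g' u) u)
    (hK : ∀ u ∈ Set.Icc a b, |g' u - d| ≤ K) : |g b - g a - (b - a) * d| ≤ (b - a) * K := by
  have key : ∀ a' b', a ≤ a' → a' ≤ b' → b' ≤ b → c ∉ Set.Ioo a' b' →
      |g b' - g a' - (b' - a') * d| ≤ (b' - a') * K := by
    intro a' b' h1 h2 h3 h4
    rcases h2.eq_or_lt with rfl | h2
    · simp
    obtain ⟨u, hu, hu'⟩ := exists_hasDerivAt_eq_slope g g' h2 hg.continuousOn
      fun u hu => hd u fun huc => h4 (huc ▸ hu)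
    have h5 : g b' - g a' = (b' - a') * g' u := by
      rw [hu']; field_simp [(sub_pos.2 h2).ne']
    rw [h5, ← mul_sub, abs_mul, abs_of_pos (sub_pos.2 h2)]
    exact mul_le_mul_of_nonneg_left (hK u ⟨h1.trans hu.1.le, hu.2.le.trans h3⟩) (sub_pos.2 h2).le
  by_cases hc : c ∈ Set.Ioo a b
  · have k1 := abs_le.1 (key a c le_rfl hc.1.le hc.2.le fun h => lt_irrefl _ h.2)
    have k2 := abs_le.1 (key c b hc.1.le hc.2.le le_rfl fun h => lt_irrefl _ h.1)
    rw [abs_le]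
    constructor <;> linarith [k1.1, k1.2, k2.1, k2.2]
  · exact key a b le_rfl hab le_rfl hc

/-- The test function of the tilted Stein identity. -/
noncomputable def tiltSol (t x w : ℝ) : ℝ := steinSol x (w - t) * Real.exp (t * w)

/-- The derivative of `tiltSol`. -/
noncomputable def tiltSol' (t x w : ℝ) : ℝ :=
  (steinSol' x (w - t) + t * steinSol x (w - t)) * Real.exp (t * w)

/-- The increasing part of `tiltSol'`. -/
noncomputable def incPart (t x w : ℝ) : ℝ :=
  ((w - t) * steinSol x (w - t) + 1) * Real.exp (t * w) +
    min (Real.exp (t * w)) (Real.exp (t * (x + t))) +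
    t * (steinSol x (min (w - t) x) * Real.exp (t * w))

/-- The decreasing part of `tiltSol'`, with the opposite sign. -/
noncomputable def decPart (t x w : ℝ) : ℝ :=
  (1 + Phi x) * Real.exp (t * w) + (if w - t ≤ x then 0 else Real.exp (t * (x + t))) +
    t * ((steinSol x x - steinSol x (max (w - t) x)) * Real.exp (t * w))

variable {t : ℝ} (ht : 0 ≤ t) (x : ℝ)
include ht

theorem monotone_exp_mul : Monotone fun w => Real.exp (t * w) := fun w w' h => by
  dsimp only; gcongr

/-- The cut-off exponential is a minimum minus a step function, and `steinSol x`, which rises up to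
`x` and falls afterwards, is its value stopped at `x` minus its later drop. Each summand of the
derivative is thus a difference of increasing functions. -/
theorem incPart_sub_decPart (w : ℝ) : incPart t x w - decPart t x w = tiltSol' t x w := by
  unfold incPart decPart tiltSol' steinSol'
  by_cases h : w - t ≤ x
  · have h1 : Real.exp (t * w) ≤ Real.exp (t * (x + t)) :=
      monotone_exp_mul ht (by linarith : w ≤ x + t)
    rw [if_pos h, if_pos h, min_eq_left h1, min_eq_left h, max_eq_right h]
    ring
  · have h1 : Real.exp (t * (x + t)) ≤ Real.exp (t * w) :=
      monotone_exp_mul ht (by linarith : x + t ≤ w)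
    rw [if_neg h, if_neg h, min_eq_right h1, min_eq_right (not_le.1 h).le,
      max_eq_left (not_le.1 h).le]
    ring

theorem incPart_mono : Monotone (incPart t x) := by
  have he := monotone_exp_mul ht
  have hsub : Monotone fun w : ℝ => w - t := fun w w' h => sub_le_sub_right h t
  refine Monotone.add (Monotone.add (Monotone.mul ?_ he (fun w => ?_) fun w => (Real.exp_pos _).le)
    (he.min monotone_const)) (Monotone.const_mul (Monotone.mul ?_ he (fun w => steinSol_nonneg _ _)
      fun w => (Real.exp_pos _).le) ht)
  · exact ((mul_steinSol_mono x).comp hsub).add_const 1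
  · linarith [neg_one_le_mul_steinSol x (w - t)]
  · intro w w' h
    exact steinSol_monotoneOn (min_le_min_right x (hsub h)) (min_le_right _ _)

theorem decPart_mono : Monotone (decPart t x) := by
  have he := monotone_exp_mul ht
  have hsub : Monotone fun w : ℝ => w - t := fun w w' h => sub_le_sub_right h t
  refine Monotone.add (Monotone.add (he.const_mul (by linarith [Phi_nonneg x])) ?_)
    (Monotone.const_mul (Monotone.mul ?_ he (fun w => sub_nonneg.2 (steinSol_le_self _ _))
      fun w => (Real.exp_pos _).le) ht)
  · intro w w' h
    have := (Real.exp_pos (t * (x + t))).le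
    dsimp only
    split_ifs with h1 h2
    · exact le_rfl
    · exact this
    · linarith
    · exact le_rfl
  · intro w w' h
    exact sub_le_sub_left (steinSol_antitoneOn (max_le_max_right x (hsub h)) (le_max_right _ _)) _

theorem incPart_add_decPart_nonneg (w : ℝ) : 0 ≤ incPart t x w + decPart t x w := by
  have h1 := neg_one_le_mul_steinSol x (w - t)
  have h2 := Phi_nonneg x
  have h3 := steinSol_nonneg x (min (w - t) x)
  have h4 := sub_nonneg.2 (steinSol_le_self x (max (w - t) x))
  have h5 : 0 ≤ (w - t) * steinSol x (w - t) + 1 := by linarith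
  have h6 : 0 ≤ if w - t ≤ x then 0 else Real.exp (t * (x + t)) := by
    split_ifs <;> positivity
  unfold incPart decPart
  positivity

theorem incPart_add_decPart_le (w : ℝ) :
    incPart t x w + decPart t x w ≤ (6 + 4 * t) * Real.exp (t * w) := by
  have he := (Real.exp_pos (t * w)).le
  have h1 := mul_le_mul_of_nonneg_right (mul_steinSol_le_one x (w - t)) he
  have h2 := mul_le_mul_of_nonneg_right (Phi_le_one x) he
  have h3 := mul_le_mul_of_nonneg_left
    (mul_le_mul_of_nonneg_right (steinSol_le x (min (w - t) x)) he) ht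
  have h4 : steinSol x x - steinSol x (max (w - t) x) ≤ 2 := by
    linarith [steinSol_le x x, steinSol_nonneg x (max (w - t) x)]
  have h5 := mul_le_mul_of_nonneg_left (mul_le_mul_of_nonneg_right h4 he) ht
  have h6 : (if w - t ≤ x then 0 else Real.exp (t * (x + t))) ≤ Real.exp (t * w) := by
    split_ifs with h
    · exact he
    · exact monotone_exp_mul ht (by linarith : x + t ≤ w)
  have h7 := min_le_left (Real.exp (t * w)) (Real.exp (t * (x + t)))
  unfold incPart decPart
  linarith

/-- If the derivative is a difference of increasing functions, its oscillation on an interval is at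
most the increment of their sum. That sum therefore serves as `M` in `abs_stein_sub_le`. -/
theorem abs_tiltSol_sub_le {w w' : ℝ} (h : w ≤ w') :
    |tiltSol t x w' - tiltSol t x w - (w' - w) * tiltSol' t x w| ≤
      (w' - w) * ((incPart t x w' + decPart t x w') - (incPart t x w + decPart t x w)) := by
  refine abs_sub_le_of_hasDerivAt_off_point (g := tiltSol t x) (g' := tiltSol' t x) (c := x + t)
    h ?_ (fun u hu => ?_) fun u hu => ?_
  · have := continuous_steinSol x
    unfold tiltSol; fun_prop
  · have h1 : u - t ≠ x := fun h => hu (by linarith)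
    have h2 := ((hasDerivAt_steinSol h1).comp u ((hasDerivAt_id u).sub_const t)).mul
      ((((hasDerivAt_id u).const_mul t)).exp)
    refine h2.congr_deriv ?_
    simp [tiltSol']; ring
  · rw [← incPart_sub_decPart ht, ← incPart_sub_decPart ht, abs_le]
    have a1 := incPart_mono ht x hu.1
    have a2 := incPart_mono ht x hu.2
    have a3 := decPart_mono ht x hu.1
    have a4 := decPart_mono ht x hu.2
    constructor <;> linarith

theorem abs_tiltSol'_le (w : ℝ) : |tiltSol' t x w| ≤ (2 + 2 * t) * Real.exp (t * w) := by
  have h1 := abs_steinSol'_le x (w - t)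
  have h2 := steinSol_le x (w - t)
  have h3 := steinSol_nonneg x (w - t)
  rw [tiltSol', abs_mul, Real.abs_exp]
  refine mul_le_mul_of_nonneg_right ((abs_add_le _ _).trans ?_) (Real.exp_pos _).le
  rw [abs_of_nonneg (mul_nonneg ht h3)]
  nlinarith

end SteinSolution

end SubgraphCount

namespace SubgraphCount

open Finset

/-! ### Normal approximation of the tilted law, and the moment generating function. -/

section TiltedNormalApproximation

variable {E : Type*} [Fintype E] [DecidableEq E] {I : Type*} [Fintype I]
  {p t z ε D : ℝ} {s : I → Finset E}

/-- The moment generating function of the standardized count. -/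
noncomputable def mgfStd (p : ℝ) (s : I → Finset E) (t : ℝ) : ℝ :=
  expect p (fun A => Real.exp (t * std p s A))

theorem mgfStd_zero : mgfStd p s 0 = 1 := by
  simp [mgfStd, expect_one]

theorem mgfStd_pos (h0 : 0 ≤ p) (h1 : p < 1) (t : ℝ) : 0 < mgfStd p s t := by
  refine sum_pos' (fun A _ => mul_nonneg (weight_nonneg h0 h1.le A) (Real.exp_pos _).le)
    ⟨∅, mem_univ _, ?_⟩
  have : 0 < 1 - p := sub_pos.2 h1
  simp only [card_empty, pow_zero, one_mul]
  positivity

/-- Berry–Esseen bound for the standardized count under exponential tilting. -/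
theorem abs_tilted_cdf_sub_le (h0 : 0 ≤ p) (h1 : p ≤ 1) (hv : 0 < cvar p s) (ht : 0 ≤ t)
    (he : TiltedErrors p s t ε) (x : ℝ) :
    |expect p (fun A => (if std p s A ≤ x + t then 1 else 0) * Real.exp (t * std p s A)) -
      Phi x * mgfStd p s t| ≤ (8 + 6 * t) * ε * mgfStd p s t := by
  have hs := abs_stein_sub_le h0 h1 hv (g := tiltSol t x) (γ := tiltSol' t x)
    (M := fun w => incPart t x w + decPart t x w) fun w w' h => abs_tiltSol_sub_le ht x h
  have hrem : expect p (fun A => steinRem p s A *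
      (incPart t x (std p s A) + decPart t x (std p s A))) ≤
      (6 + 4 * t) * (ε * mgfStd p s t) := by
    refine le_trans (expect_mono h0 h1 (G := fun A => (6 + 4 * t) *
      (|steinRem p s A| * Real.exp (t * std p s A))) fun A => ?_) ?_
    · calc _ ≤ |steinRem p s A| * (incPart t x (std p s A) + decPart t x (std p s A)) :=
            mul_le_mul_of_nonneg_right (le_abs_self _) (incPart_add_decPart_nonneg ht x _)
        _ ≤ |steinRem p s A| * ((6 + 4 * t) * Real.exp (t * std p s A)) :=
            mul_le_mul_of_nonneg_left (incPart_add_decPart_le ht x _) (abs_nonneg _)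
        _ = _ := by ring
    · rw [expect_const_mul]
      exact mul_le_mul_of_nonneg_left he.rem (by positivity)
  have hvar : |expect p (fun A => (steinVar p s A - 1) * tiltSol' t x (std p s A))| ≤
      (2 + 2 * t) * (ε * mgfStd p s t) := by
    refine (abs_expect_le h0 h1 _).trans (le_trans (expect_mono h0 h1 (G := fun A => (2 + 2 * t) *
      (|steinVar p s A - 1| * Real.exp (t * std p s A))) fun A => ?_) ?_)
    · rw [abs_mul]
      calc _ ≤ |steinVar p s A - 1| * ((2 + 2 * t) * Real.exp (t * std p s A)) :=
            mul_le_mul_of_nonneg_left (abs_tiltSol'_le ht x _) (abs_nonneg _)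
        _ = _ := by ring
    · rw [expect_const_mul]
      exact mul_le_mul_of_nonneg_left he.var (by positivity)
  -- The shift of the Stein solution by `t` cancels the derivative of e^{tw}: f' - w f is exactly
  -- (1_{w ≤ x + t} - Φ(x)) e^{tw}.
  have e1 : expect p (fun A => (if std p s A ≤ x + t then 1 else 0) *
      Real.exp (t * std p s A)) - Phi x * mgfStd p s t =
      -((expect p (fun A => std p s A * tiltSol t x (std p s A)) -
      expect p (fun A => steinVar p s A * tiltSol' t x (std p s A))) +
      expect p (fun A => (steinVar p s A - 1) * tiltSol' t x (std p s A))) := by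
    rw [mgfStd, ← expect_const_mul, ← expect_sub, ← expect_sub, ← expect_add, ← neg_one_mul,
      ← expect_const_mul]
    congr 1; ext A
    have h2 : std p s A - t ≤ x ↔ std p s A ≤ x + t := sub_le_iff_le_add
    simp only [tiltSol, tiltSol', steinSol', h2]
    ring
  rw [e1, abs_neg]
  refine (abs_add_le _ _).trans ?_
  linarith [hs.trans hrem]

theorem hasDerivAt_mgfStd (t : ℝ) :
    HasDerivAt (mgfStd p s) (expect p (fun A => std p s A * Real.exp (t * std p s A))) t := by
  unfold mgfStd expect
  refine HasDerivAt.fun_sum fun A _ => HasDerivAt.const_mul _ ?_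
  refine (((hasDerivAt_id t).mul_const (std p s A)).exp).congr_deriv ?_
  simp; ring

theorem abs_exp_sub_le (ht : 0 ≤ t) {w w' : ℝ} (h : w ≤ w') :
    |Real.exp (t * w') - Real.exp (t * w) - (w' - w) * (t * Real.exp (t * w))| ≤
      (w' - w) * (t * Real.exp (t * w') - t * Real.exp (t * w)) := by
  refine abs_sub_le_of_hasDerivAt_off_point (g := fun u => Real.exp (t * u))
    (g' := fun u => t * Real.exp (t * u)) (c := 0) h (by fun_prop) (fun u _ => ?_) fun u hu => ?_
  · refine (((hasDerivAt_id u).const_mul t).exp).congr_deriv ?_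
    simp; ring
  · have h1 := monotone_exp_mul ht hu.1
    have h2 := monotone_exp_mul ht hu.2
    dsimp only at h1 h2
    rw [← mul_sub, ← mul_sub, abs_mul, abs_of_nonneg ht, abs_of_nonneg (sub_nonneg.2 h1)]
    exact mul_le_mul_of_nonneg_left (sub_le_sub_right h2 _) ht

/-- Stein's identity for e^{tw}. Its derivative is increasing, so it is its own `M`; the outcome is
an approximate form of H' = tH. -/
theorem abs_deriv_mgfStd_sub_le (h0 : 0 ≤ p) (h1 : p ≤ 1) (hv : 0 < cvar p s) (ht : 0 ≤ t)
    (he : TiltedErrors p s t ε) :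
    |expect p (fun A => std p s A * Real.exp (t * std p s A)) - t * mgfStd p s t| ≤
      2 * t * ε * mgfStd p s t := by
  have hs := abs_stein_sub_le h0 h1 hv (g := fun w => Real.exp (t * w))
    (γ := fun w => t * Real.exp (t * w)) (M := fun w => t * Real.exp (t * w))
    fun w w' h => abs_exp_sub_le ht h
  have hrem : expect p (fun A => steinRem p s A * (t * Real.exp (t * std p s A))) ≤
      t * (ε * mgfStd p s t) := by
    refine le_trans (expect_mono h0 h1 (G := fun A => t *
      (|steinRem p s A| * Real.exp (t * std p s A))) fun A => ?_) ?_
    · rw [mul_left_comm]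
      exact mul_le_mul_of_nonneg_left
        (mul_le_mul_of_nonneg_right (le_abs_self _) (Real.exp_pos _).le) ht
    · rw [expect_const_mul]
      exact mul_le_mul_of_nonneg_left he.rem ht
  have hvar : |expect p (fun A => (steinVar p s A - 1) * (t * Real.exp (t * std p s A)))| ≤
      t * (ε * mgfStd p s t) := by
    refine (abs_expect_le h0 h1 _).trans (le_trans (le_of_eq ?_)
      (mul_le_mul_of_nonneg_left he.var ht))
    rw [← expect_const_mul]
    congr 1; ext A
    rw [abs_mul, abs_mul, abs_of_nonneg ht, Real.abs_exp]; ring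
  have e1 : expect p (fun A => std p s A * Real.exp (t * std p s A)) - t * mgfStd p s t =
      (expect p (fun A => std p s A * Real.exp (t * std p s A)) -
        expect p (fun A => steinVar p s A * (t * Real.exp (t * std p s A)))) +
      expect p (fun A => (steinVar p s A - 1) * (t * Real.exp (t * std p s A))) := by
    rw [mgfStd, ← expect_const_mul, ← expect_sub, ← expect_sub, ← expect_add]
    congr 1; ext A
    ring
  rw [e1]
  refine (abs_add_le _ _).trans ?_
  linarith [hs.trans hrem]

theorem abs_log_mgfStd_sub_le (h0 : 0 ≤ p) (h1 : p < 1) (hv : 0 < cvar p s) (hz : 0 ≤ z)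
    (hε : 0 ≤ ε) (he : ∀ t, 0 ≤ t → t ≤ z → TiltedErrors p s t ε) :
    |Real.log (mgfStd p s z) - z ^ 2 / 2| ≤ 2 * z ^ 2 * ε := by
  have hpos : ∀ t, 0 < mgfStd p s t := mgfStd_pos h0 h1
  have hd : ∀ t, HasDerivAt (fun t => Real.log (mgfStd p s t) - t ^ 2 / 2)
      (expect p (fun A => std p s A * Real.exp (t * std p s A)) / mgfStd p s t - t) t := fun t => by
    refine (((hasDerivAt_mgfStd t).log (hpos t).ne').sub
      (((hasDerivAt_id t).pow 2).div_const 2)).congr_deriv ?_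
    simp
  -- The logarithmic derivative differs from `t` by at most 2tε ≤ 2zε on [0, z]. There is no kink,
  -- so the exceptional point -1 is a dummy.
  have := abs_sub_le_of_hasDerivAt_off_point (c := -1) (d := 0) (K := 2 * z * ε) hz
    (continuous_iff_continuousAt.2 fun t => (hd t).continuousAt) (fun t _ => hd t) fun t ht => by
      have h2 := abs_deriv_mgfStd_sub_le h0 h1.le hv ht.1 (he t ht.1 ht.2)
      rw [sub_zero, div_sub' (hpos t).ne', abs_div, abs_of_pos (hpos t), div_le_iff₀ (hpos t),
        mul_comm (mgfStd p s t)]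
      refine h2.trans ?_
      have := (hpos t).le
      gcongr
      exact ht.2
  simp only [mgfStd_zero, Real.log_one, mul_zero, sub_zero] at this
  norm_num at this
  linarith

theorem abs_mgfStd_mul_exp_sub_one_le (h0 : 0 ≤ p) (h1 : p < 1) (hv : 0 < cvar p s) (hz : 0 ≤ z)
    (hε : 0 ≤ ε) (he : ∀ t, 0 ≤ t → t ≤ z → TiltedErrors p s t ε) (hD : z ^ 2 * ε ≤ D) :
    mgfStd p s z * Real.exp (-(z ^ 2 / 2)) ≤ Real.exp (2 * D) ∧
    |mgfStd p s z * Real.exp (-(z ^ 2 / 2)) - 1| ≤ 2 * z ^ 2 * ε * Real.exp (2 * D) := by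
  have h := abs_log_mgfStd_sub_le h0 h1 hv hz hε he
  set k := Real.log (mgfStd p s z) - z ^ 2 / 2 with hk
  have e1 : mgfStd p s z * Real.exp (-(z ^ 2 / 2)) = Real.exp k := by
    rw [hk, sub_eq_add_neg, Real.exp_add, Real.exp_log (mgfStd_pos h0 h1 z)]
  obtain ⟨l1, l2⟩ := abs_le.1 h
  rw [e1]
  have hkD : k ≤ 2 * D := by linarith
  have hexp : Real.exp k ≤ Real.exp (2 * D) := Real.exp_le_exp.2 hkD
  refine ⟨hexp, ?_⟩
  have hz2 : 0 ≤ 2 * z ^ 2 * ε := by positivity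
  have hD1 : 1 ≤ Real.exp (2 * D) := Real.one_le_exp (by linarith)
  rw [abs_le]
  constructor
  · have := Real.add_one_le_exp k
    nlinarith
  · have h3 : Real.exp k - 1 ≤ k * Real.exp k := by
      have h4 := Real.add_one_le_exp (-k)
      have h5 : Real.exp (-k) * Real.exp k = 1 := by rw [← Real.exp_add]; simp
      nlinarith [Real.exp_pos k]
    have h6 : k * Real.exp k ≤ 2 * z ^ 2 * ε * Real.exp k :=
      mul_le_mul_of_nonneg_right l2 (Real.exp_pos k).le
    have h7 : 2 * z ^ 2 * ε * Real.exp k ≤ 2 * z ^ 2 * ε * Real.exp (2 * D) :=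
      mul_le_mul_of_nonneg_left hexp hz2
    linarith

end TiltedNormalApproximation

/-! ### Exponentials as mixtures of indicators. -/

section LayerCake

variable {z : ℝ}

theorem integral_Ioi_mul_exp (hz : 0 < z) (a : ℝ) :
    IntegrableOn (fun x => z * Real.exp (-(z * x))) (Set.Ioi a) ∧
      ∫ x in Set.Ioi a, z * Real.exp (-(z * x)) = Real.exp (-(z * a)) := by
  have h1 : ∀ x : ℝ, z * Real.exp (-(z * x)) = z * Real.exp (-z * x) := fun x => by rw [neg_mul]
  simp only [h1]
  refine ⟨(integrableOn_exp_mul_Ioi (neg_lt_zero.2 hz) a).const_mul z, ?_⟩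
  rw [integral_const_mul, integral_exp_mul_Ioi (neg_lt_zero.2 hz)]
  field_simp

/-- On y > 0 the exponential is a mixture of the indicators of y ≤ x, so estimates for distribution
functions pass to exponential moments. -/
theorem integral_Ioi_indicator_mul_exp (hz : 0 < z) (y : ℝ) :
    IntegrableOn (fun x => z * Real.exp (-(z * x)) * (if 0 < y ∧ y ≤ x then 1 else 0))
      (Set.Ioi 0) ∧
    ∫ x in Set.Ioi 0, z * Real.exp (-(z * x)) * (if 0 < y ∧ y ≤ x then 1 else 0) =
      if 0 < y then Real.exp (-(z * y)) else 0 := by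
  by_cases hy : 0 < y
  · have e1 : (fun x => z * Real.exp (-(z * x)) * (if 0 < y ∧ y ≤ x then (1 : ℝ) else 0)) =
        (Set.Ici y).indicator fun x => z * Real.exp (-(z * x)) := by
      ext x
      by_cases hx : y ≤ x <;> simp [Set.indicator, hy, hx]
    have hsub : Set.Ici y ∩ Set.Ioi 0 = Set.Ici y :=
      Set.inter_eq_left.2 fun x hx => lt_of_lt_of_le hy hx
    rw [e1, if_pos hy]
    constructor
    · exact (integral_Ioi_mul_exp hz 0).1.indicator measurableSet_Ici
    · rw [integral_indicator measurableSet_Ici, Measure.restrict_restrict measurableSet_Ici, hsub,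
        integral_Ici_eq_integral_Ioi]
      exact (integral_Ioi_mul_exp hz y).2
  · simp [hy]

/-- An explicit primitive exists because completing the square gives e^{z²/2} `dens (x + z)` =
e^{-zx} `dens x`. -/
theorem integral_Ioi_Phi_mul_exp (hz : 0 < z) :
    IntegrableOn (fun x => z * Real.exp (-(z * x)) * (Phi x - Phi 0)) (Set.Ioi 0) ∧
    ∫ x in Set.Ioi 0, z * Real.exp (-(z * x)) * (Phi x - Phi 0) =
      Real.exp (z ^ 2 / 2) * (1 - Phi z) := by
  have hd : ∀ x ∈ Set.Ici (0 : ℝ), HasDerivAt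
      (fun x => Real.exp (z ^ 2 / 2) * Phi (x + z) - Real.exp (-(z * x)) * (Phi x - Phi 0))
      (z * Real.exp (-(z * x)) * (Phi x - Phi 0)) x := fun x _ => by
    have h1 := (((hasDerivAt_Phi (x + z)).comp x ((hasDerivAt_id x).add_const z)).const_mul
      (Real.exp (z ^ 2 / 2))).sub
      ((((hasDerivAt_id x).const_mul z).neg.exp).mul ((hasDerivAt_Phi x).sub_const (Phi 0)))
    refine h1.congr_deriv ?_
    have h2 : Real.exp (z ^ 2 / 2) * dens (x + z) = Real.exp (-(z * x)) * dens x := by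
      rw [dens, dens, mul_left_comm, mul_left_comm (Real.exp (-(z * x))), ← Real.exp_add,
        ← Real.exp_add]
      congr 2; ring
    simp only [id, Pi.neg_apply, mul_one]
    linear_combination h2
  have hn : ∀ x ∈ Set.Ioi (0 : ℝ), 0 ≤ z * Real.exp (-(z * x)) * (Phi x - Phi 0) := fun x hx => by
    have : 0 ≤ Phi x - Phi 0 := sub_nonneg.2 (monotone_cdf _ (le_of_lt hx))
    positivity
  have hlim : Filter.Tendsto
      (fun x => Real.exp (z ^ 2 / 2) * Phi (x + z) - Real.exp (-(z * x)) * (Phi x - Phi 0))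
      Filter.atTop (nhds (Real.exp (z ^ 2 / 2) * 1 - 0 * (1 - Phi 0))) := by
    have hPhi : Filter.Tendsto Phi Filter.atTop (nhds 1) := tendsto_cdf_atTop _
    refine ((hPhi.comp (Filter.tendsto_atTop_add_const_right _ z Filter.tendsto_id)).const_mul
      _).sub (Filter.Tendsto.mul ?_ (hPhi.sub_const _))
    exact Real.tendsto_exp_neg_atTop_nhds_zero.comp (Filter.tendsto_id.const_mul_atTop hz)
  refine ⟨integrableOn_Ioi_deriv_of_nonneg' hd hn hlim, ?_⟩
  rw [integral_Ioi_of_hasDerivAt_of_nonneg' hd hn hlim]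
  simp; ring

end LayerCake

/-! ### Removing the tilt: relative error of the tail. -/

section ModerateDeviation

variable {E : Type*} [Fintype E] [DecidableEq E] {I : Type*} [Fintype I]
  {p z ε δ D : ℝ} {s : I → Finset E}

/-- The mass of (z, x + z] is a difference of two values of the tilted distribution function, hence
known up to 2δ; the weight z e^{-zx} against which it is integrated has total mass 1. -/
theorem abs_expect_exp_indicator_sub_le (hz : 0 < z)
    (hδ : ∀ x, |expect p (fun A => (if std p s A ≤ x + z then 1 else 0) *
      Real.exp (z * std p s A)) - Phi x * mgfStd p s z| ≤ δ) :
    |expect p (fun A => (if z < std p s A then Real.exp (-(z * (std p s A - z))) else 0) *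
      Real.exp (z * std p s A)) - Real.exp (z ^ 2 / 2) * (1 - Phi z) * mgfStd p s z| ≤
      2 * δ := by
  set F : ℝ → ℝ := fun x => expect p (fun A =>
    (if 0 < std p s A - z ∧ std p s A - z ≤ x then 1 else 0) * Real.exp (z * std p s A)) with hF
  have hFx : ∀ x, 0 < x → |F x - (Phi x - Phi 0) * mgfStd p s z| ≤ 2 * δ := fun x hx => by
    have e1 : F x - (Phi x - Phi 0) * mgfStd p s z =
        (expect p (fun A => (if std p s A ≤ x + z then 1 else 0) *
          Real.exp (z * std p s A)) - Phi x * mgfStd p s z) -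
        (expect p (fun A => (if std p s A ≤ 0 + z then 1 else 0) *
          Real.exp (z * std p s A)) - Phi 0 * mgfStd p s z) := by
      have : F x = expect p (fun A => (if std p s A ≤ x + z then 1 else 0) *
          Real.exp (z * std p s A)) - expect p (fun A => (if std p s A ≤ 0 + z then 1 else 0) *
          Real.exp (z * std p s A)) := by
        rw [← expect_sub, hF]
        dsimp only
        congr 1; ext A
        by_cases h1 : std p s A ≤ z
        · have h2 : std p s A ≤ x + z := by linarith
          have h3 : ¬ z < std p s A := not_lt.2 h1
          simp [h1, h2, h3]
        · have h3 : z < std p s A := not_le.1 h1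
          have h4 : std p s A - z ≤ x ↔ std p s A ≤ x + z := sub_le_iff_le_add
          simp [h1, h3, h4]
      rw [this]; ring
    rw [e1]
    refine (abs_sub _ _).trans ?_
    linarith [hδ x, hδ 0]
  have hI : ∀ A, IntegrableOn (fun x => p ^ #A * (1 - p) ^ #Aᶜ * Real.exp (z * std p s A) *
      (z * Real.exp (-(z * x)) *
        (if 0 < std p s A - z ∧ std p s A - z ≤ x then 1 else 0))) (Set.Ioi 0) := fun A =>
    ((integral_Ioi_indicator_mul_exp hz (std p s A - z)).1).const_mul _
  have hFe : ∀ x, z * Real.exp (-(z * x)) * F x = ∑ A, p ^ #A * (1 - p) ^ #Aᶜ *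
      Real.exp (z * std p s A) * (z * Real.exp (-(z * x)) *
        (if 0 < std p s A - z ∧ std p s A - z ≤ x then 1 else 0)) := fun x => by
    rw [hF]
    dsimp only
    rw [expect, mul_sum]
    exact sum_congr rfl fun A _ => by ring
  have hFi : IntegrableOn (fun x => z * Real.exp (-(z * x)) * F x) (Set.Ioi 0) := by
    simp only [hFe]
    exact integrable_finsetSum _ fun A _ => hI A
  have e2 : expect p (fun A => (if z < std p s A then Real.exp (-(z * (std p s A - z))) else 0) *
      Real.exp (z * std p s A)) = ∫ x in Set.Ioi 0, z * Real.exp (-(z * x)) * F x := by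
    simp only [hFe]
    rw [integral_finsetSum _ fun A _ => hI A]
    refine sum_congr rfl fun A _ => ?_
    rw [integral_const_mul, (integral_Ioi_indicator_mul_exp hz (std p s A - z)).2]
    simp only [sub_pos]
    ring
  obtain ⟨hPi, hPe⟩ := integral_Ioi_Phi_mul_exp hz
  obtain ⟨hei, hee⟩ := integral_Ioi_mul_exp hz 0
  rw [e2, ← hPe, ← integral_mul_const, ← integral_sub hFi (hPi.mul_const _)]
  have := norm_integral_le_of_norm_le (μ := volume.restrict (Set.Ioi (0 : ℝ)))
    (f := fun x => z * Real.exp (-(z * x)) * F x -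
      z * Real.exp (-(z * x)) * (Phi x - Phi 0) * mgfStd p s z)
    (hei.mul_const (2 * δ)) ?_
  · rw [integral_mul_const, hee] at this
    simpa using this
  · refine (ae_restrict_iff' measurableSet_Ioi).2 (ae_of_all _ fun x hx => ?_)
    rw [mul_assoc _ (Phi x - Phi 0), ← mul_sub, Real.norm_eq_abs, abs_mul,
      abs_of_nonneg (by positivity : 0 ≤ z * Real.exp (-(z * x)))]
    exact mul_le_mul_of_nonneg_left (hFx x hx) (by positivity)

/-- On W > z the product e^{-z(W-z)} e^{zW} is the constant e^{z²}, so the tail is a tilted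
expectation. The error splits into that of H(z)e^{-z²/2} and that of the tilted law. The latter has
size (8 + 6z)ε, and dividing by the Gaussian value costs another factor 8(1 + z); hence (1 + z)². -/
theorem abs_tail_div_sub_one_le (h0 : 0 ≤ p) (h1 : p < 1) (hv : 0 < cvar p s) (hz : 0 ≤ z)
    (hε : 0 ≤ ε) (he : ∀ t, 0 ≤ t → t ≤ z → TiltedErrors p s t ε) (hD : z ^ 2 * ε ≤ D) :
    |expect p (fun A => if z < std p s A then 1 else 0) / (1 - Phi z) - 1| ≤
      130 * Real.exp (2 * D) * ((1 + z) ^ 2 * ε) := by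
  have hD0 : 0 ≤ D := le_trans (by positivity) hD
  have hD1 : 1 ≤ Real.exp (2 * D) := Real.one_le_exp (by linarith)
  have hQ := one_sub_Phi_pos z
  rcases hz.eq_or_lt with rfl | hz'
  -- At z = 0 the exponential mixture degenerates, and the untilted Berry–Esseen bound at 0 is used
  -- directly.
  · have h2 := abs_tilted_cdf_sub_le h0 h1.le hv le_rfl (he 0 le_rfl le_rfl) 0
    rw [mgfStd_zero] at h2
    have h3 : Phi 0 = 1 / 2 := by
      have := Phi_neg 0
      rw [neg_zero] at this; linarith
    have h4 : expect p (fun A => if 0 < std p s A then (1 : ℝ) else 0) = 1 -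
        expect p (fun A => (if std p s A ≤ 0 + 0 then 1 else 0) * Real.exp (0 * std p s A)) := by
      have h5 := expect_sub (p := p) (fun _ : Finset E => (1 : ℝ))
        (fun A => (if std p s A ≤ 0 + 0 then 1 else 0) * Real.exp (0 * std p s A))
      rw [expect_one] at h5
      rw [← h5]
      congr 1; ext A
      by_cases h : std p s A ≤ 0
      · simp [h, not_lt.2 h]
      · simp [h, not_le.1 h]
    rw [h4]
    rw [h3] at h2 ⊢
    set X := expect p (fun A => (if std p s A ≤ 0 + 0 then 1 else 0) * Real.exp (0 * std p s A))
    have h5 : (1 - X) / (1 - 1 / 2) - 1 = -2 * (X - 1 / 2 * 1) := by ring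
    rw [h5, abs_mul]
    norm_num at h2 ⊢
    nlinarith
  obtain ⟨hr1, hr2⟩ := abs_mgfStd_mul_exp_sub_one_le h0 h1 hv hz hε he hD
  have hδ := abs_expect_exp_indicator_sub_le hz'
    fun x => abs_tilted_cdf_sub_le h0 h1.le hv hz (he z hz le_rfl) x
  set X := expect p (fun A => (if z < std p s A then Real.exp (-(z * (std p s A - z))) else 0) *
      Real.exp (z * std p s A)) with hX
  set H := mgfStd p s z with hH
  have hH0 : 0 < H := mgfStd_pos h0 h1 z
  have e1 : expect p (fun A => if z < std p s A then (1 : ℝ) else 0) =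
      Real.exp (-z ^ 2) * X := by
    rw [hX, ← expect_const_mul]
    congr 1; ext A
    split_ifs
    · rw [← Real.exp_add, ← Real.exp_add]
      ring_nf
      simp
    · simp
  set A₀ := Real.exp (z ^ 2 / 2) * (1 - Phi z) with hA₀
  have hA₀pos : 0 < A₀ := by positivity
  clear_value A₀
  have hm : mills z = √(2 * Real.pi) * A₀ := by rw [mills, hA₀]; ring
  have h2pi : √(2 * Real.pi) ≤ 4 := by
    rw [Real.sqrt_le_left (by norm_num)]
    have := Real.pi_le_four
    linarith
  have hAlow : 1 ≤ 8 * (1 + z) * A₀ := by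
    have h3 := one_le_mul_mills hz
    rw [hm] at h3
    have : 2 * (1 + z) * (√(2 * Real.pi) * A₀) ≤ 2 * (1 + z) * (4 * A₀) := by gcongr
    linarith
  have e2 : Real.exp (-z ^ 2) * X / (1 - Phi z) - 1 =
      (H * Real.exp (-(z ^ 2 / 2)) - 1) +
        Real.exp (-(z ^ 2 / 2)) * ((X - A₀ * H) / A₀) := by
    have a1 : Real.exp (-z ^ 2) = Real.exp (-(z ^ 2 / 2)) * Real.exp (-(z ^ 2 / 2)) := by
      rw [← Real.exp_add]; ring_nf
    have a2 : Real.exp (-(z ^ 2 / 2)) * Real.exp (z ^ 2 / 2) = 1 := by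
      rw [← Real.exp_add]; simp
    have a3 : (1 - Phi z)⁻¹ = Real.exp (z ^ 2 / 2) * A₀⁻¹ := by
      rw [hA₀, mul_inv, ← mul_assoc, mul_inv_cancel₀ (Real.exp_pos _).ne', one_mul]
    rw [div_eq_mul_inv, a3, a1, sub_div, mul_div_cancel_left₀ _ hA₀pos.ne', div_eq_mul_inv X]
    generalize Real.exp (-(z ^ 2 / 2)) = r at a2 ⊢
    generalize Real.exp (z ^ 2 / 2) = R at a2 ⊢
    linear_combination (r * X * A₀⁻¹) * a2
  rw [e1, e2]
  have h4 : |Real.exp (-(z ^ 2 / 2)) * ((X - A₀ * H) / A₀)| ≤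
      (2 * ((8 + 6 * z) * ε)) * (8 * (1 + z)) * Real.exp (2 * D) := by
    rw [abs_mul, abs_div, Real.abs_exp, abs_of_pos hA₀pos]
    calc _ ≤ Real.exp (-(z ^ 2 / 2)) * ((2 * ((8 + 6 * z) * ε * H)) * (8 * (1 + z))) := by
          refine mul_le_mul_of_nonneg_left ?_ (Real.exp_pos _).le
          rw [div_le_iff₀ hA₀pos, mul_assoc (2 * ((8 + 6 * z) * ε * H))]
          refine hδ.trans (le_mul_of_one_le_right ?_ hAlow)
          positivity
      _ = (2 * ((8 + 6 * z) * ε)) * (8 * (1 + z)) * (H * Real.exp (-(z ^ 2 / 2))) := by ring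
      _ ≤ _ := mul_le_mul_of_nonneg_left hr1 (by positivity)
  refine (abs_add_le _ _).trans ((add_le_add hr2 h4).trans ?_)
  have h5 : 2 * z ^ 2 + 16 * (8 + 6 * z) * (1 + z) ≤ 130 * (1 + z) ^ 2 := by nlinarith
  have h6 := mul_le_mul_of_nonneg_right h5 (by positivity : 0 ≤ ε * Real.exp (2 * D))
  linarith

end ModerateDeviation

end SubgraphCount

namespace SubgraphCount

open Finset

/-! ### Counting embeddings: overlap sums and the variance in terms of ψ. -/

section Embeddings

variable {V : Type*} [Fintype V] {G : SimpleGraph V} {N : ℕ} {p : ℝ}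

/-- The edges of the complete graph on `N` vertices. -/
abbrev Edge (N : ℕ) := {x : Sym2 (Fin N) // ¬x.IsDiag}

/-- The edges of `G`, as a finite set. -/
noncomputable def edgeFin (G : SimpleGraph V) : Finset (Sym2 V) := (Set.toFinite G.edgeSet).toFinset

theorem mem_edgeFin {f : Sym2 V} : f ∈ edgeFin G ↔ f ∈ G.edgeSet := by simp [edgeFin]

theorem card_edgeFin : #(edgeFin G) = G.edgeSet.ncard :=
  (Set.ncard_eq_toFinset_card _ _).symm

open Classical in
/-- The image of the edges of `G` under an embedding of the vertices. -/
noncomputable def edgeImage (G : SimpleGraph V) (φ : V ↪ Fin N) : Finset (Edge N) :=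
  {x | ∃ f ∈ edgeFin G, f.map φ = x.1}

open Classical in
/-- The edges of `G` mapped into `U` by an embedding of the vertices. -/
noncomputable def edgePreimage (G : SimpleGraph V) (U : Finset (Edge N)) (φ : V ↪ Fin N) :
    Finset (Sym2 V) :=
  {f ∈ edgeFin G | ∃ x ∈ U, f.map φ = x.1}

open Classical in
/-- The vertices incident to the edges in `D`. -/
noncomputable def incVerts (D : Finset (Sym2 V)) : Finset V := {a | ∃ f ∈ D, a ∈ f}

theorem mem_edgeImage {φ : V ↪ Fin N} {x : Edge N} :
    x ∈ edgeImage G φ ↔ ∃ f ∈ edgeFin G, f.map φ = x.1 := by simp [edgeImage]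

theorem mem_edgePreimage {U : Finset (Edge N)} {φ : V ↪ Fin N} {f : Sym2 V} :
    f ∈ edgePreimage G U φ ↔ f ∈ edgeFin G ∧ ∃ x ∈ U, f.map φ = x.1 := by simp [edgePreimage]

theorem mem_incVerts {D : Finset (Sym2 V)} {a : V} : a ∈ incVerts D ↔ ∃ f ∈ D, a ∈ f := by
  simp [incVerts]

theorem map_not_isDiag (φ : V ↪ Fin N) {f : Sym2 V} (hf : f ∈ edgeFin G) :
    ¬(f.map φ).IsDiag := by
  rw [Sym2.isDiag_map φ.injective]
  exact G.not_isDiag_of_mem_edgeSet (mem_edgeFin.1 hf)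

theorem card_inter_edgeImage (U : Finset (Edge N)) (φ : V ↪ Fin N) :
    #(U ∩ edgeImage G φ) = #(edgePreimage G U φ) := by
  symm
  refine card_bij (fun f hf => ⟨f.map φ, map_not_isDiag φ (mem_edgePreimage.1 hf).1⟩) ?_ ?_ ?_
  · intro f hf
    obtain ⟨h1, x, hx, hfx⟩ := mem_edgePreimage.1 hf
    refine mem_inter.2 ⟨?_, mem_edgeImage.2 ⟨f, h1, rfl⟩⟩
    convert hx
  · intro f hf f' hf' h
    exact Sym2.map.injective φ.injective (Subtype.ext_iff.1 h)
  · intro x hx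
    obtain ⟨h1, h2⟩ := mem_inter.1 hx
    obtain ⟨f, hf, hfx⟩ := mem_edgeImage.1 h2
    exact ⟨f, mem_edgePreimage.2 ⟨hf, x, h1, hfx⟩, Subtype.ext hfx⟩

theorem card_edgeImage (φ : V ↪ Fin N) : #(edgeImage G φ) = G.edgeSet.ncard := by
  have h := card_inter_edgeImage (G := G) univ φ
  rw [univ_inter] at h
  rw [h, ← card_edgeFin]
  congr 1
  ext f
  rw [mem_edgePreimage]
  exact ⟨fun h => h.1, fun h => ⟨h, ⟨f.map φ, map_not_isDiag φ h⟩, mem_univ _, rfl⟩⟩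

theorem card_union_edgeImage (U : Finset (Edge N)) (φ : V ↪ Fin N) :
    #(U ∪ edgeImage G φ) = #U + (G.edgeSet.ncard - #(edgePreimage G U φ)) := by
  have h1 := card_union_add_card_inter U (edgeImage G φ)
  rw [card_inter_edgeImage, card_edgeImage] at h1
  have h2 : #(edgePreimage G U φ) ≤ G.edgeSet.ncard := by
    rw [← card_edgeFin]; exact card_le_card (filter_subset _ _)
  omega

/-- The edges in `D` with their end vertices form a subgraph that competes in the minimum. -/
theorem psi_le (hG : G.edgeSet.Nonempty) {D : Finset (Sym2 V)} (hD : D ⊆ edgeFin G)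
    (hne : D.Nonempty) : psi G N p ≤ (N : ℝ) ^ #(incVerts D) * p ^ #D := by
  let H : G.Subgraph :=
    { verts := incVerts D
      Adj := fun a b => s(a, b) ∈ D
      adj_sub := fun h => mem_edgeFin.1 (hD h)
      edge_vert := fun {a b} h => mem_coe.2 (mem_incVerts.2 ⟨_, h, Sym2.mem_mk_left a b⟩)
      symm := ⟨fun a b h => by rwa [Sym2.eq_swap]⟩ }
  have hE : H.edgeSet = D := by
    ext f
    induction f with | _ a b => rfl
  refine (psi_isLeast G hG N p).2 ⟨H, ?_, ?_⟩
  · rw [hE]; exact hne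
  · rw [hE, Set.ncard_coe_finset]
    congr 2
    exact (Set.ncard_coe_finset _).symm

theorem psi_pos (hG : G.edgeSet.Nonempty) (hN : 0 < N) (hp : 0 < p) : 0 < psi G N p := by
  obtain ⟨⟨H, _, h⟩, _⟩ := psi_isLeast G hG N p
  rw [h]; positivity

open Classical in
theorem card_embeddings_le (W : Finset V) (T : Finset (Fin N)) :
    (#{φ : V ↪ Fin N | ∀ a ∈ W, φ a ∈ T} : ℝ) ≤
      (#T : ℝ) ^ #W * (N : ℝ) ^ (Fintype.card V - #W) := by
  have h1 : #{φ : V ↪ Fin N | ∀ a ∈ W, φ a ∈ T} ≤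
      #(Fintype.piFinset fun a : V => if a ∈ W then T else univ) := by
    refine card_le_card_of_injOn (fun φ => φ) ?_ fun φ _ φ' _ h => DFunLike.coe_injective h
    intro φ hφ
    have h2 : ∀ a ∈ W, φ a ∈ T := by simpa using hφ
    refine mem_coe.2 (Fintype.mem_piFinset.2 fun a => ?_)
    split_ifs with ha
    · exact h2 a ha
    · exact mem_univ _
  have h3 : #(Fintype.piFinset fun a : V => if a ∈ W then T else univ) =
      #T ^ #W * N ^ (Fintype.card V - #W) := by
    rw [Fintype.card_piFinset]
    have : ∀ a, #(if a ∈ W then T else univ) = if a ∈ W then #T else N := fun a => by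
      split_ifs <;> simp
    simp only [this]
    rw [prod_ite, prod_const, prod_const, filter_mem_eq_inter, univ_inter]
    congr 2
    rw [filter_not, filter_mem_eq_inter, univ_inter, card_univ_sdiff]
  exact_mod_cast h3 ▸ h1

open Classical in
/-- The vertices incident to the edges in `U`. -/
noncomputable def endVerts (U : Finset (Edge N)) : Finset (Fin N) := U.biUnion fun x => x.1.toFinset

theorem card_endVerts_le (U : Finset (Edge N)) : #(endVerts U) ≤ 2 * #U := by
  rw [mul_comm]
  refine card_biUnion_le_card_mul _ _ _ fun x _ => ?_
  rw [Sym2.card_toFinset_of_not_isDiag _ x.2]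

theorem mem_endVerts_of_mem_incVerts {U : Finset (Edge N)} {φ : V ↪ Fin N} {a : V}
    (ha : a ∈ incVerts (edgePreimage G U φ)) : φ a ∈ endVerts U := by
  obtain ⟨f, hf, haf⟩ := mem_incVerts.1 ha
  obtain ⟨_, x, hx, hfx⟩ := mem_edgePreimage.1 hf
  refine mem_biUnion.2 ⟨x, hx, ?_⟩
  rw [Sym2.mem_toFinset, ← hfx]
  exact Sym2.mem_map.2 ⟨a, haf, rfl⟩

/-- The constant in the bounds for sums over embeddings. -/
def embConst (v e : ℕ) : ℝ := 2 ^ e * (12 * e + 1) ^ v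

/-- Embeddings are grouped by the nonempty set D of edges they send into `U`. The w vertices on D
have boundedly many possible images, leaving O(N^{v-w}) embeddings of weight p^{#U+e-#D}; since N^w
p^{#D} ≥ ψ, the total is O(N^v p^e/ψ) p^{#U}. -/
theorem sum_meets_edgeImage_le (hG : G.edgeSet.Nonempty) (hN : 0 < N) (hp : 0 < p)
    {U : Finset (Edge N)} (hU : #U ≤ 6 * G.edgeSet.ncard) :
    ∑ φ : V ↪ Fin N, meets (edgeImage G) U φ * p ^ #(U ∪ edgeImage G φ) ≤
      embConst (Fintype.card V) G.edgeSet.ncard *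
        ((N : ℝ) ^ Fintype.card V * p ^ G.edgeSet.ncard / psi G N p) * p ^ #U := by
  classical
  set v := Fintype.card V
  set e := G.edgeSet.ncard with he
  have hψ := psi_pos hG hN hp
  have hNr : (0 : ℝ) < N := by exact_mod_cast hN
  have h1 : ∀ φ : V ↪ Fin N, meets (edgeImage G) U φ * p ^ #(U ∪ edgeImage G φ) ≤
      ∑ D ∈ (edgeFin G).powerset.erase ∅,
        if ∀ a ∈ incVerts D, φ a ∈ endVerts U then p ^ #U * p ^ (e - #D) else 0 := fun φ => by
    have hn : ∀ D : Finset (Sym2 V),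
        0 ≤ if ∀ a ∈ incVerts D, φ a ∈ endVerts U then p ^ #U * p ^ (e - #D) else 0 := fun D => by
      split_ifs <;> positivity
    unfold meets
    split_ifs with hd
    · rw [zero_mul]; exact sum_nonneg fun D _ => hn D
    · rw [one_mul, card_union_edgeImage, pow_add]
      have hD : edgePreimage G U φ ∈ (edgeFin G).powerset.erase ∅ := by
        refine mem_erase.2 ⟨fun h => hd ?_, mem_powerset.2 (filter_subset _ _)⟩
        have := card_inter_edgeImage (G := G) U φ
        rw [h, card_empty, card_eq_zero] at this
        rw [disjoint_comm]
        exact disjoint_iff_inter_eq_empty.2 this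
      refine le_trans (le_of_eq ?_) (single_le_sum (fun D _ => hn D) hD)
      rw [if_pos fun a ha => mem_endVerts_of_mem_incVerts ha]
  refine (sum_le_sum fun φ _ => h1 φ).trans ?_
  rw [sum_comm]
  have h2 : ∀ D ∈ (edgeFin G).powerset.erase ∅,
      ∑ φ : V ↪ Fin N, (if ∀ a ∈ incVerts D, φ a ∈ endVerts U then p ^ #U * p ^ (e - #D) else 0) ≤
        (12 * e + 1) ^ v * ((N : ℝ) ^ v * p ^ e / psi G N p) * p ^ #U := fun D hD => by
    obtain ⟨hD0, hD1⟩ := mem_erase.1 hD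
    rw [mem_powerset] at hD1
    rw [← sum_filter, sum_const, nsmul_eq_mul]
    have hDe : #D ≤ e := by rw [he, ← card_edgeFin]; exact card_le_card hD1
    have hWv : #(incVerts D) ≤ v := card_le_univ _
    have a1 := card_embeddings_le (incVerts D) (endVerts U)
    -- At most 6e edges have at most 12e ends; the extra 1 keeps the base at least 1, so the
    -- exponent can be raised to `v`.
    have a2 : (#(endVerts U) : ℝ) ^ #(incVerts D) ≤ (12 * e + 1) ^ v := by
      have : (#(endVerts U) : ℝ) ≤ 12 * e + 1 := by
        have := card_endVerts_le U
        exact_mod_cast (by omega : #(endVerts U) ≤ 12 * e + 1)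
      calc (#(endVerts U) : ℝ) ^ #(incVerts D) ≤ (12 * e + 1 : ℝ) ^ #(incVerts D) := by gcongr
        _ ≤ _ := pow_le_pow_right₀ (by linarith [(Nat.cast_nonneg e : (0 : ℝ) ≤ e)]) hWv
    have a3 : (N : ℝ) ^ (v - #(incVerts D)) * p ^ (e - #D) ≤ (N : ℝ) ^ v * p ^ e / psi G N p := by
      rw [le_div_iff₀ hψ]
      calc _ ≤ (N : ℝ) ^ (v - #(incVerts D)) * p ^ (e - #D) *
            ((N : ℝ) ^ #(incVerts D) * p ^ #D) := by
            have := psi_le (N := N) (p := p) hG hD1 (nonempty_iff_ne_empty.2 hD0)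
            gcongr
        _ = ((N : ℝ) ^ (v - #(incVerts D)) * (N : ℝ) ^ #(incVerts D)) *
            (p ^ (e - #D) * p ^ #D) := by ring
        _ = _ := by rw [← pow_add, ← pow_add, Nat.sub_add_cancel hWv, Nat.sub_add_cancel hDe]
    calc _ ≤ ((#(endVerts U) : ℝ) ^ #(incVerts D) * (N : ℝ) ^ (v - #(incVerts D))) *
          (p ^ #U * p ^ (e - #D)) := by gcongr
      _ = (#(endVerts U) : ℝ) ^ #(incVerts D) *
          ((N : ℝ) ^ (v - #(incVerts D)) * p ^ (e - #D)) * p ^ #U := by ring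
      _ ≤ _ := by gcongr
  refine (sum_le_sum h2).trans ?_
  rw [sum_const, nsmul_eq_mul, embConst]
  have h3 : (#((edgeFin G).powerset.erase ∅) : ℝ) ≤ 2 ^ e := by
    have : #((edgeFin G).powerset.erase ∅) ≤ 2 ^ e := by
      refine (card_le_card (erase_subset _ _)).trans ?_
      rw [card_powerset, card_edgeFin]
    exact_mod_cast this
  calc _ ≤ (2 : ℝ) ^ e * ((12 * e + 1) ^ v * ((N : ℝ) ^ v * p ^ e / psi G N p) * p ^ #U) := by
        gcongr
    _ = _ := by ring

theorem card_embeddings_eq_le : (Fintype.card (V ↪ Fin N) : ℝ) ≤ (N : ℝ) ^ Fintype.card V := by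
  rw [Fintype.card_embedding_eq, Fintype.card_fin]
  exact_mod_cast Nat.descFactorial_le_pow _ _

/-- Embeddings meeting `U` are covered by the previous sum, where ψ ≥ 1 discards the denominator;
for the others the two edge sets are disjoint and the probabilities multiply. -/
theorem sum_pow_edgeImage_le (hG : G.edgeSet.Nonempty) (hN : 0 < N) (hp : 0 < p)
    (hψ : 1 ≤ psi G N p) {U : Finset (Edge N)} (hU : #U ≤ 6 * G.edgeSet.ncard) :
    ∑ φ : V ↪ Fin N, p ^ #(U ∪ edgeImage G φ) ≤
      (embConst (Fintype.card V) G.edgeSet.ncard + 1) *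
        ((N : ℝ) ^ Fintype.card V * p ^ G.edgeSet.ncard) * p ^ #U := by
  set P := (N : ℝ) ^ Fintype.card V * p ^ G.edgeSet.ncard with hP
  have h1 : ∀ φ : V ↪ Fin N, p ^ #(U ∪ edgeImage G φ) ≤
      meets (edgeImage G) U φ * p ^ #(U ∪ edgeImage G φ) + p ^ #U * p ^ G.edgeSet.ncard :=
    fun φ => by
      unfold meets
      split_ifs with hd
      · rw [card_union_of_disjoint hd.symm, card_edgeImage, pow_add]; linarith
      · rw [one_mul]
        have : 0 ≤ p ^ #U * p ^ G.edgeSet.ncard := by positivity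
        linarith
  refine (sum_le_sum fun φ _ => h1 φ).trans ?_
  rw [sum_add_distrib, sum_const, nsmul_eq_mul, card_univ, add_mul, add_mul, one_mul]
  refine add_le_add ((sum_meets_edgeImage_le hG hN hp hU).trans ?_) ?_
  · have : 0 ≤ embConst (Fintype.card V) G.edgeSet.ncard := by unfold embConst; positivity
    gcongr
    exact div_le_self (by positivity) hψ
  · have := card_embeddings_eq_le (V := V) (N := N)
    calc _ ≤ (N : ℝ) ^ Fintype.card V * (p ^ #U * p ^ G.edgeSet.ncard) := by gcongr
      _ = _ := by rw [hP]; ring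

theorem le_psi (hG : G.edgeSet.Nonempty) (hN : 0 < N) (h0 : 0 ≤ p) (h1 : p ≤ 1) :
    (N : ℝ) ^ 2 * p ^ G.edgeSet.ncard ≤ psi G N p := by
  have hNr : (1 : ℝ) ≤ N := by exact_mod_cast hN
  obtain ⟨⟨H, hH, h⟩, _⟩ := psi_isLeast G hG N p
  have hv : 2 ≤ H.verts.ncard := by
    obtain ⟨f, hf⟩ := hH
    induction f with | _ a b =>
    have hab : H.Adj a b := hf
    rw [← Set.ncard_pair hab.ne]
    refine Set.ncard_le_ncard ?_ (Set.toFinite _)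
    rintro x (rfl | rfl)
    · exact H.edge_vert hab
    · exact H.edge_vert hab.symm
  rw [h]
  exact mul_le_mul (pow_le_pow_right₀ hNr hv)
    (pow_le_pow_of_le_one h0 h1 (Set.ncard_le_ncard H.edgeSet_subset (Set.toFinite _)))
    (by positivity) (by positivity)

/-- At `p = 1` the weighted sum becomes a plain count, and ψ is at least N². -/
theorem sum_meets_le (hG : G.edgeSet.Nonempty) (hN : 0 < N) {U : Finset (Edge N)}
    (hU : #U ≤ 6 * G.edgeSet.ncard) :
    ∑ φ : V ↪ Fin N, meets (edgeImage G) U φ ≤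
      embConst (Fintype.card V) G.edgeSet.ncard * ((N : ℝ) ^ Fintype.card V / (N : ℝ) ^ 2) := by
  have h := sum_meets_edgeImage_le (p := 1) hG hN one_pos hU
  simp only [one_pow, mul_one] at h
  refine h.trans ?_
  have hNr : (1 : ℝ) ≤ N := by exact_mod_cast hN
  have hψ : (N : ℝ) ^ 2 ≤ psi G N 1 := by simpa using le_psi (p := 1) hG hN zero_le_one le_rfl
  have : 0 ≤ embConst (Fintype.card V) G.edgeSet.ncard := by unfold embConst; positivity
  have hN0 : (0 : ℝ) < N := by linarith
  gcongr

theorem pow_card_le_card_embeddings (hN : Fintype.card V ≤ N) :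
    (N : ℝ) ^ Fintype.card V ≤
      (Fintype.card V : ℝ) ^ Fintype.card V * Fintype.card (V ↪ Fin N) := by
  rw [Fintype.card_embedding_eq, Fintype.card_fin]
  have h := Nat.pow_sub_le_descFactorial N (Fintype.card V)
  set v := Fintype.card V
  have h1 : N ≤ v * (N + 1 - v) ∨ v = 0 := by
    rcases Nat.eq_zero_or_pos v with h0 | h0
    · exact Or.inr h0
    · left
      obtain ⟨k, rfl⟩ := Nat.exists_eq_add_of_le hN
      rw [show v + k + 1 - v = k + 1 by omega]
      nlinarith
  rcases h1 with h1 | h1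
  · have h2 : N ^ v ≤ v ^ v * N.descFactorial v := by
      calc N ^ v ≤ (v * (N + 1 - v)) ^ v := Nat.pow_le_pow_left h1 v
        _ = v ^ v * (N + 1 - v) ^ v := mul_pow _ _ _
        _ ≤ _ := Nat.mul_le_mul_left _ h
    exact_mod_cast h2
  · simp [h1]

open Classical in
-- Cauchy–Schwarz for the sizes of the fibres of `f`.
theorem sq_card_le_card_mul_sum_eq {α β : Type*} [Fintype α] [Fintype β] (f : α → β) :
    (Fintype.card α : ℝ) ^ 2 ≤
      Fintype.card β * ∑ a, ∑ a', if f a = f a' then (1 : ℝ) else 0 := by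
  have h1 : (Fintype.card α : ℝ) = ∑ b, (#{a | f a = b} : ℝ) := by
    rw [← card_univ, card_eq_sum_card_fiberwise (f := f) (t := univ) (by simp)]
    push_cast
    rfl
  have h2 : ∑ a, ∑ a', (if f a = f a' then (1 : ℝ) else 0) = ∑ b, (#{a | f a = b} : ℝ) ^ 2 := by
    rw [← sum_fiberwise univ f]
    refine sum_congr rfl fun b _ => ?_
    have h3 : ∀ a ∈ ({a | f a = b} : Finset α), ∑ a', (if f a = f a' then (1 : ℝ) else 0) =
        (#{a | f a = b} : ℝ) := fun a ha => by
      rw [(mem_filter.1 ha).2, sum_boole]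
      simp only [eq_comm]
    rw [sum_congr rfl h3, sum_const, nsmul_eq_mul, sq]
  rw [h1, h2]
  have := sq_sum_le_card_mul_sum_sq (s := univ) (f := fun b : β => (#{a | f a = b} : ℝ))
  simpa using this

/-- Let H attain ψ, with w vertices and h edges. All covariances are nonnegative, and two embeddings
that agree on the vertices of H share at least h edges, so their covariance is at least
p^{2e-h}(1-p). By Cauchy–Schwarz over the N^w maps on those vertices, at least M²/N^w pairs agree,
where M is the number of embeddings. -/
theorem cvar_edgeImage_ge (hG : G.edgeSet.Nonempty) (hN : Fintype.card V ≤ N) (hp : 0 < p)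
    (hp1 : p ≤ 1) :
    ((N : ℝ) ^ Fintype.card V * p ^ G.edgeSet.ncard) ^ 2 * (1 - p) / psi G N p ≤
      ((Fintype.card V : ℝ) ^ Fintype.card V) ^ 2 *
        cvar p (edgeImage G : (V ↪ Fin N) → Finset (Edge N)) := by
  classical
  have hV : 0 < Fintype.card V := by
    obtain ⟨f, _⟩ := hG
    induction f with | _ a b => exact Fintype.card_pos_iff.2 ⟨a⟩
  have hN0 : 0 < N := hV.trans_le hN
  have hNr : (0 : ℝ) < N := by exact_mod_cast hN0
  set v := Fintype.card V
  set e := G.edgeSet.ncard with he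
  have hψ := psi_pos hG hN0 hp
  obtain ⟨⟨H, hH, hHψ⟩, _⟩ := psi_isLeast G hG N p
  set w := H.verts.ncard with hw
  set h := H.edgeSet.ncard with hh
  have hh1 : 1 ≤ h := (Set.ncard_pos (Set.toFinite _)).2 hH
  have hhe : h ≤ e := Set.ncard_le_ncard H.edgeSet_subset (Set.toFinite _)
  set res : (V ↪ Fin N) → (H.verts → Fin N) := fun φ a => φ a with hres
  have hcard : (Fintype.card (H.verts → Fin N) : ℝ) = (N : ℝ) ^ w := by
    rw [Fintype.card_fun, Fintype.card_fin, hw, ← Nat.card_coe_set_eq, Nat.card_eq_fintype_card]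
    push_cast; rfl
  have hCS := sq_card_le_card_mul_sum_eq res
  rw [hcard] at hCS
  have hterm : ∀ φ φ' : V ↪ Fin N, (if res φ = res φ' then (1 : ℝ) else 0) *
      (p ^ (2 * e - h) * (1 - p)) ≤ p ^ #(edgeImage G φ ∪ edgeImage G φ') -
        p ^ (#(edgeImage G φ) + #(edgeImage G φ')) := fun φ φ' => by
    have hk := card_union_add_card_inter (edgeImage G φ) (edgeImage G φ')
    rw [card_edgeImage, card_edgeImage] at hk ⊢
    have hke : #(edgeImage G φ ∩ edgeImage G φ') ≤ e := by
      rw [he, ← card_edgeImage (G := G) φ]; exact card_le_card inter_subset_left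
    set k := #(edgeImage G φ ∩ edgeImage G φ')
    have e1 : p ^ #(edgeImage G φ ∪ edgeImage G φ') - p ^ (e + e) =
        p ^ (2 * e - k) * (1 - p ^ k) := by
      rw [mul_sub, mul_one, ← pow_add]
      congr 2 <;> omega
    rw [e1]
    have hpk : 0 ≤ 1 - p ^ k := sub_nonneg.2 (pow_le_one₀ hp.le hp1)
    split_ifs with hr
    · rw [one_mul]
      have hkh : h ≤ k := by
        rw [hh, ← Set.ncard_image_of_injective H.edgeSet (Sym2.map.injective φ.injective)]
        have : (Sym2.map φ '' H.edgeSet) ⊆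
            Subtype.val '' ((edgeImage G φ ∩ edgeImage G φ' : Finset (Edge N)) : Set (Edge N)) := by
          rintro _ ⟨f, hf, rfl⟩
          have hfG : f ∈ edgeFin G := mem_edgeFin.2 (H.edgeSet_subset hf)
          have hff : f.map φ = f.map φ' := by
            induction f with | _ a b =>
            have hab : H.Adj a b := hf
            have ha := congrFun hr ⟨a, H.edge_vert hab⟩
            have hb := congrFun hr ⟨b, H.edge_vert hab.symm⟩
            simp only [hres] at ha hb
            simp [ha, hb]
          refine ⟨⟨f.map φ, map_not_isDiag φ hfG⟩, ?_, rfl⟩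
          rw [mem_coe, mem_inter, mem_edgeImage, mem_edgeImage]
          exact ⟨⟨f, hfG, rfl⟩, ⟨f, hfG, hff.symm⟩⟩
        refine (Set.ncard_le_ncard this (Set.toFinite _)).trans ?_
        rw [Set.ncard_image_of_injective _ Subtype.val_injective, Set.ncard_coe_finset]
      refine mul_le_mul (pow_le_pow_of_le_one hp.le hp1 (by omega)) ?_ (sub_nonneg.2 hp1)
        (by positivity)
      have : p ^ k ≤ p ^ 1 := pow_le_pow_of_le_one hp.le hp1 (by omega)
      linarith
    · rw [zero_mul]; positivity
  have hsum : (∑ φ : V ↪ Fin N, ∑ φ' : V ↪ Fin N, if res φ = res φ' then (1 : ℝ) else 0) *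
      (p ^ (2 * e - h) * (1 - p)) ≤ cvar p (edgeImage G : (V ↪ Fin N) → Finset (Edge N)) := by
    rw [sum_mul]
    refine sum_le_sum fun φ _ => ?_
    rw [sum_mul]
    exact sum_le_sum fun φ' _ => hterm φ φ'
  have hM := pow_card_le_card_embeddings (V := V) hN
  set M : ℝ := ((Fintype.card (V ↪ Fin N) : ℕ) : ℝ)
  set Z := ∑ φ : V ↪ Fin N, ∑ φ' : V ↪ Fin N, if res φ = res φ' then (1 : ℝ) else 0
  have hq : 0 ≤ 1 - p := sub_nonneg.2 hp1
  have hCS' : M ^ 2 ≤ (N : ℝ) ^ w * Z := by convert hCS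
  rw [div_le_iff₀ hψ]
  have hpe : (p ^ e) ^ 2 = p ^ (2 * e - h) * p ^ h := by
    rw [← pow_mul, ← pow_add]; congr 1; omega
  calc ((N : ℝ) ^ v * p ^ e) ^ 2 * (1 - p)
      = ((N : ℝ) ^ v) ^ 2 * (p ^ (2 * e - h) * (1 - p) * p ^ h) := by
        rw [mul_pow, hpe]; ring
    _ ≤ ((v : ℝ) ^ v * M) ^ 2 * (p ^ (2 * e - h) * (1 - p) * p ^ h) := by gcongr
    _ = ((v : ℝ) ^ v) ^ 2 * M ^ 2 * (p ^ (2 * e - h) * (1 - p) * p ^ h) := by ring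
    _ ≤ ((v : ℝ) ^ v) ^ 2 * ((N : ℝ) ^ w * Z) * (p ^ (2 * e - h) * (1 - p) * p ^ h) := by gcongr
    _ = ((v : ℝ) ^ v) ^ 2 * (Z * (p ^ (2 * e - h) * (1 - p))) * ((N : ℝ) ^ w * p ^ h) := by ring
    _ ≤ ((v : ℝ) ^ v) ^ 2 * cvar p (edgeImage G : (V ↪ Fin N) → Finset (Edge N)) *
        ((N : ℝ) ^ w * p ^ h) := by gcongr
    _ = _ := by rw [hHψ]

end Embeddings

end SubgraphCount

namespace SubgraphCount

open Finset

/-! ### Copies as embeddings modulo automorphisms. -/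

section Copies

variable {V : Type*} [Fintype V] {G : SimpleGraph V} {N : ℕ}

open Classical in
/-- The edges of a graph on `Fin N`, as a finite set of edges of the complete graph. -/
noncomputable def graphEdges (Γ : SimpleGraph (Fin N)) : Finset (Edge N) := {x | x.1 ∈ Γ.edgeSet}

theorem mem_graphEdges {Γ : SimpleGraph (Fin N)} {x : Edge N} :
    x ∈ graphEdges Γ ↔ x.1 ∈ Γ.edgeSet := by simp [graphEdges]

/-- Graphs on `Fin N` correspond to sets of edges of the complete graph. -/
noncomputable def graphEquiv (N : ℕ) : SimpleGraph (Fin N) ≃ Finset (Edge N) where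
  toFun := graphEdges
  invFun A := SimpleGraph.fromEdgeSet (Subtype.val '' (A : Set (Edge N)))
  left_inv Γ := by
    ext a b
    rw [SimpleGraph.fromEdgeSet_adj]
    constructor
    · rintro ⟨⟨x, hx, hxe⟩, _⟩
      have := mem_graphEdges.1 hx
      rwa [hxe] at this
    · intro h
      refine ⟨⟨⟨s(a, b), by simpa using h.ne⟩, mem_graphEdges.2 h, rfl⟩, h.ne⟩
  right_inv A := by
    ext ⟨x, hx⟩
    rw [mem_graphEdges, SimpleGraph.edgeSet_fromEdgeSet]
    constructor
    · rintro ⟨⟨y, hy, rfl⟩, _⟩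
      exact hy
    · intro h
      exact ⟨⟨⟨x, hx⟩, h, rfl⟩, fun h' => hx (by simpa using h')⟩

open Classical in
theorem edgeImage_subset_iff {Γ : SimpleGraph (Fin N)} {φ : V ↪ Fin N} :
    edgeImage G φ ⊆ graphEdges Γ ↔ ∀ a b, G.Adj a b → Γ.Adj (φ a) (φ b) := by
  constructor
  · intro h a b hab
    have hf : s(a, b) ∈ edgeFin G := mem_edgeFin.2 hab
    have := @h ⟨s(a, b).map φ, map_not_isDiag φ hf⟩ (mem_edgeImage.2 ⟨_, hf, rfl⟩)
    exact mem_graphEdges.1 this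
  · intro h x hx
    obtain ⟨f, hf, hfx⟩ := mem_edgeImage.1 hx
    rw [mem_graphEdges, ← hfx]
    rw [mem_edgeFin] at hf
    induction f with | _ a b =>
    exact h a b hf

open Classical in
theorem count_graphEdges (Γ : SimpleGraph (Fin N)) :
    count (edgeImage G) (graphEdges Γ) = Fintype.card (G.Copy Γ) := by
  have h1 : count (edgeImage G) (graphEdges Γ) =
      #{φ : V ↪ Fin N | ∀ a b, G.Adj a b → Γ.Adj (φ a) (φ b)} := by
    rw [count, ← sum_boole]
    refine sum_congr rfl fun φ _ => ?_
    simp only [ind, edgeImage_subset_iff]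
  rw [h1, ← card_univ]
  norm_cast
  refine card_bij' (fun φ hφ => ⟨⟨φ, fun {a b} h => (mem_filter.1 hφ).2 a b h⟩, φ.injective⟩)
    (fun f _ => f.toEmbedding) (fun _ _ => mem_univ _) (fun f _ => ?_) (fun _ _ => rfl)
    (fun _ _ => rfl)
  exact mem_filter.2 ⟨mem_univ _, fun a b h => f.toHom.map_adj h⟩

open Classical in
noncomputable instance fintypeIso : Fintype (G ≃g G) :=
  .ofInjective (fun f => (f : V → V)) DFunLike.coe_injective

open Classical in
-- Two labelled copies with the same image differ by a unique automorphism of `G`.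
theorem card_copies_toSubgraph_eq {Γ : SimpleGraph (Fin N)} (f₀ : G.Copy Γ) :
    #{f : G.Copy Γ | f.toSubgraph = f₀.toSubgraph} = Fintype.card (G ≃g G) := by
  rw [← card_univ]
  symm
  have hval : ∀ (f : G.Copy Γ) (H : Γ.Subgraph), f.toSubgraph = H →
      ∃ β : G ≃g H.coe, ∀ a, (β a).1 = f a := by
    rintro f _ rfl
    exact ⟨f.isoToSubgraph, fun a => rfl⟩
  refine card_bij (fun α _ => f₀.comp α.toCopy) ?_ ?_ ?_
  · intro α _
    refine mem_filter.2 ⟨mem_univ _, ?_⟩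
    ext x y
    · simp only [SimpleGraph.Subgraph.map_verts, Set.mem_image, SimpleGraph.Subgraph.verts_top,
        Set.mem_univ, true_and]
      constructor
      · rintro ⟨a, rfl⟩; exact ⟨α a, rfl⟩
      · rintro ⟨a, rfl⟩
        refine ⟨α.symm a, ?_⟩
        change f₀ (α (α.symm a)) = f₀ a
        rw [α.apply_symm_apply]
    · simp only [SimpleGraph.Subgraph.map_adj, Relation.Map, SimpleGraph.Subgraph.top_adj]
      constructor
      · rintro ⟨a, b, hab, rfl, rfl⟩; exact ⟨α a, α b, α.map_adj_iff.2 hab, rfl, rfl⟩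
      · rintro ⟨a, b, hab, rfl, rfl⟩
        refine ⟨α.symm a, α.symm b, α.symm.map_adj_iff.2 hab, ?_, ?_⟩
        · change f₀ (α (α.symm a)) = f₀ a
          rw [α.apply_symm_apply]
        · change f₀ (α (α.symm b)) = f₀ b
          rw [α.apply_symm_apply]
  · intro α _ β _ h
    ext a
    have : f₀ (α a) = f₀ (β a) := DFunLike.congr_fun h a
    exact f₀.injective this
  · intro f hf
    obtain ⟨β, hβ⟩ := hval f _ (mem_filter.1 hf).2
    obtain ⟨β₀, hβ₀⟩ := hval f₀ _ rfl
    refine ⟨β.trans β₀.symm, mem_univ _, ?_⟩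
    ext a
    change (f₀ (β₀.symm (β a)) : ℕ) = f a
    rw [← hβ₀, β₀.apply_symm_apply, hβ]

open Classical in
theorem card_copy_eq (Γ : SimpleGraph (Fin N)) :
    Fintype.card (G.Copy Γ) = Γ.copyCount G * Fintype.card (G ≃g G) := by
  rw [SimpleGraph.copyCount_eq_card_image_copyToSubgraph, ← card_univ,
    card_eq_sum_card_image SimpleGraph.Copy.toSubgraph, ← smul_eq_mul, ← sum_const]
  refine sum_congr rfl fun H hH => ?_
  obtain ⟨f₀, _, rfl⟩ := mem_image.1 hH
  exact card_copies_toSubgraph_eq f₀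

/-- The constant is 1/|Aut G|; being positive, it cancels in the standardized count. -/
theorem exists_S_eq_count (G : SimpleGraph V) : ∃ c : ℝ, 0 < c ∧ ∀ (N : ℕ) (Γ : SimpleGraph (Fin N)),
    S G Γ = c * count (edgeImage G) (graphEdges Γ) := by
  classical
  have hc : 0 < Fintype.card (G ≃g G) := Fintype.card_pos_iff.2 ⟨SimpleGraph.Iso.refl⟩
  have hc' : (0 : ℝ) < Fintype.card (G ≃g G) := by exact_mod_cast hc
  refine ⟨(Fintype.card (G ≃g G) : ℝ)⁻¹, inv_pos.2 hc', fun N Γ => ?_⟩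
  rw [count_graphEdges, card_copy_eq, S]
  push_cast
  field_simp

end Copies

/-! ### The binomial random graph as a random set of edges. -/

section RandomGraph

variable {N : ℕ}

theorem measurableSet_graph (s : Set (SimpleGraph (Fin N))) : MeasurableSet s := by
  have h : s = SimpleGraph.edgeSet ⁻¹' (SimpleGraph.edgeSet '' s) :=
    (Set.preimage_image_eq s SimpleGraph.edgeSet_injective).symm
  rw [h]
  have : MeasurableSingletonClass (Set (Sym2 (Fin N))) :=
    inferInstanceAs (MeasurableSingletonClass (Sym2 (Fin N) → Prop))
  exact SimpleGraph.measurable_edgeSet (Set.toFinite _).measurableSet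

theorem binomialRandom_real_singleton (p : unitInterval) (Γ : SimpleGraph (Fin N)) :
    (SimpleGraph.binomialRandom (Fin N) p).real {Γ} =
      (p : ℝ) ^ #(graphEdges Γ) * (1 - (p : ℝ)) ^ #(graphEdges Γ)ᶜ := by
  have h1 : Γ.edgeSet.ncard = #(graphEdges Γ) := by
    rw [← Set.ncard_coe_finset, ← Set.ncard_image_of_injective _ Subtype.val_injective]
    congr 1
    ext x
    constructor
    · intro hx
      exact ⟨⟨x, Γ.not_isDiag_of_mem_edgeSet hx⟩, mem_graphEdges.2 hx, rfl⟩
    · rintro ⟨y, hy, rfl⟩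
      exact mem_graphEdges.1 hy
  have h2 : Fintype.card (Edge N) = N.choose 2 := by
    rw [Sym2.card_subtype_not_diag, Fintype.card_fin]
  rw [Measure.real, SimpleGraph.binomialRandom_singleton, h1, card_compl, h2, Nat.card_fin]
  simp

theorem integral_binomialRandom (p : unitInterval) (F : Finset (Edge N) → ℝ) :
    ∫ Γ, F (graphEdges Γ) ∂(SimpleGraph.binomialRandom (Fin N) p) = expect (p : ℝ) F := by
  classical
  have : MeasurableSingletonClass (SimpleGraph (Fin N)) := ⟨fun _ => measurableSet_graph _⟩
  rw [integral_fintype .of_finite, expect, ← (graphEquiv N).sum_comp]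
  refine sum_congr rfl fun Γ _ => ?_
  rw [binomialRandom_real_singleton, smul_eq_mul]
  rfl

open Classical in
theorem binomialRandom_real (p : unitInterval) (P : Finset (Edge N) → Prop) :
    (SimpleGraph.binomialRandom (Fin N) p).real {Γ | P (graphEdges Γ)} =
      expect (p : ℝ) (fun A => if P A then 1 else 0) := by
  rw [← integral_binomialRandom, ← integral_indicator_one (measurableSet_graph _)]
  rfl

end RandomGraph

/-! ### Mean and variance of the count, and identification of `W` with `std`. -/

section Standardization

variable {E : Type*} [Fintype E] [DecidableEq E] {I : Type*} [Fintype I] {p : ℝ}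
  {s : I → Finset E}

theorem expect_count : expect p (count s) = cmean p s := by
  unfold count cmean
  rw [expect_sum]
  exact sum_congr rfl fun i _ => expect_ind _

theorem expect_sq_count_sub : expect p (fun A => (count s A - cmean p s) ^ 2) = cvar p s := by
  have h1 : ∀ A, (count s A - cmean p s) ^ 2 =
      (∑ i, ∑ j, ind (s i ∪ s j) A) - 2 * cmean p s * count s A + cmean p s ^ 2 := fun A => by
    have : ∑ i, ∑ j, ind (s i ∪ s j) A = count s A * count s A := by
      rw [count, sum_mul_sum]
      simp only [ind_mul_ind]
    rw [this]; ring
  simp only [h1]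
  rw [expect_add, expect_sub, expect_const, expect_const_mul, expect_count, expect_sum]
  simp only [expect_sum, expect_ind]
  have h2 : cmean p s ^ 2 = ∑ i, ∑ j, p ^ (#(s i) + #(s j)) := by
    rw [sq, cmean, sum_mul_sum]
    simp only [pow_add]
  rw [cvar]
  simp only [sum_sub_distrib]
  rw [← h2]; ring

theorem W_eq_std {V : Type*} [Fintype V] (G : SimpleGraph V) (N : ℕ) (p : unitInterval)
    (Γ : SimpleGraph (Fin N)) :
    W G N p Γ = std (p : ℝ) (edgeImage G : (V ↪ Fin N) → Finset (Edge N)) (graphEdges Γ) := by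
  obtain ⟨c, hc, hS⟩ := exists_S_eq_count G
  have hmean : mean G N p = c * cmean (p : ℝ) (edgeImage G : (V ↪ Fin N) → Finset (Edge N)) := by
    rw [mean]
    simp only [hS]
    rw [integral_binomialRandom p (fun A => c * count (edgeImage G) A), expect_const_mul,
      expect_count]
  have hvar : variance (fun Γ => S G Γ) (SimpleGraph.binomialRandom (Fin N) p) =
      c ^ 2 * cvar (p : ℝ) (edgeImage G : (V ↪ Fin N) → Finset (Edge N)) := by
    rw [variance_eq_integral
      (Measurable.aemeasurable fun s _ => measurableSet_graph _)]
    have h1 : ∫ Γ, S G Γ ∂(SimpleGraph.binomialRandom (Fin N) p) = mean G N p := rfl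
    rw [h1, hmean]
    have h2 : ∀ Γ : SimpleGraph (Fin N), (S G Γ -
        c * cmean (p : ℝ) (edgeImage G : (V ↪ Fin N) → Finset (Edge N))) ^ 2 =
        c ^ 2 * (count (edgeImage G) (graphEdges Γ) -
          cmean (p : ℝ) (edgeImage G : (V ↪ Fin N) → Finset (Edge N))) ^ 2 := fun Γ => by
      rw [hS]; ring
    simp only [h2]
    rw [integral_binomialRandom p (fun A => c ^ 2 * (count (edgeImage G) A -
      cmean (p : ℝ) (edgeImage G : (V ↪ Fin N) → Finset (Edge N))) ^ 2), expect_const_mul,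
      expect_sq_count_sub]
  rw [W, sd, hvar, hmean, hS, Real.sqrt_mul (by positivity), Real.sqrt_sq hc.le, ← mul_sub,
    mul_div_mul_left _ _ hc.ne', std]

end Standardization

end SubgraphCount

namespace SubgraphCount

open Finset

/-! ### The tilted errors for subgraph counts. -/

section TiltedSubgraphCounts

variable {V : Type*} [Fintype V] {G : SimpleGraph V} {N : ℕ} {p z t : ℝ}

theorem TiltedErrors.mono {E : Type*} [Fintype E] [DecidableEq E] {I : Type*} [Fintype I]
    {s : I → Finset E} {ε ε' : ℝ} (h : TiltedErrors p s t ε) (h0 : 0 ≤ p) (h1 : p < 1)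
    (hε : ε ≤ ε') : TiltedErrors p s t ε' := by
  have hm := (mgfStd_pos (s := s) h0 h1 t).le
  exact ⟨h.var.trans (mul_le_mul_of_nonneg_right hε hm),
    h.rem.trans (mul_le_mul_of_nonneg_right hε hm)⟩

theorem cvar_edgeImage_pos (hG : G.edgeSet.Nonempty) (hN : Fintype.card V ≤ N) (hN0 : 0 < N)
    (hp : 0 < p) (hp1 : p < 1) : 0 < cvar p (edgeImage G : (V ↪ Fin N) → Finset (Edge N)) := by
  have h := cvar_edgeImage_ge hG hN hp hp1.le
  have hψ := psi_pos hG hN0 hp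
  have hq : 0 < 1 - p := sub_pos.2 hp1
  have hNr : (0 : ℝ) < N := by exact_mod_cast hN0
  by_contra! hc
  have h2 := mul_nonpos_of_nonneg_of_nonpos
    (show (0 : ℝ) ≤ ((Fintype.card V : ℝ) ^ Fintype.card V) ^ 2 by positivity) hc
  have : 0 < ((N : ℝ) ^ Fintype.card V * p ^ G.edgeSet.ncard) ^ 2 * (1 - p) / psi G N p := by
    positivity
  linarith

theorem embConst_nonneg (v e : ℕ) : 0 ≤ embConst v e := by unfold embConst; positivity

theorem embConst_pos (v e : ℕ) : 0 < embConst v e := by unfold embConst; positivity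

/-- In the range of `z` of the moderate deviation bound, removing boundedly many edges changes
`t * std` by a bounded amount. -/
theorem mul_loss_edgeImage_le (hG : G.edgeSet.Nonempty) (hN : Fintype.card V ≤ N) (hN0 : 0 < N)
    (hp : 0 < p) (hp1 : p < 1) (ht : 0 ≤ t)
    (htz : t ≤ (1 - p) * (N : ℝ) ^ 2 * p ^ G.edgeSet.ncard / √(psi G N p))
    {B : Finset (Edge N)} (hB : #B ≤ 6 * G.edgeSet.ncard) (A : Finset (Edge N)) :
    t * loss p (edgeImage G : (V ↪ Fin N) → Finset (Edge N)) B A ≤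
      embConst (Fintype.card V) G.edgeSet.ncard * (Fintype.card V : ℝ) ^ Fintype.card V := by
  have hψ := psi_pos hG hN0 hp
  have hq : 0 < 1 - p := sub_pos.2 hp1
  have hNr : (0 : ℝ) < N := by exact_mod_cast hN0
  have hv := cvar_edgeImage_pos hG hN hN0 hp hp1
  have hge := cvar_edgeImage_ge hG hN hp hp1.le
  have hK := embConst_nonneg (Fintype.card V) G.edgeSet.ncard
  set K := embConst (Fintype.card V) G.edgeSet.ncard
  set c := cvar p (edgeImage G : (V ↪ Fin N) → Finset (Edge N))
  set vv : ℝ := (Fintype.card V : ℝ) ^ Fintype.card V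
  set e := G.edgeSet.ncard
  set ψ := psi G N p
  set M : ℝ := (N : ℝ) ^ Fintype.card V
  have hM : 0 < M := by positivity
  have hvv : 0 ≤ vv := by positivity
  have hsum : ∑ k, meets (edgeImage G : (V ↪ Fin N) → Finset (Edge N)) B k * ind (edgeImage G k) A ≤
      K * (M / (N : ℝ) ^ 2) := by
    refine (sum_le_sum fun k _ => ?_).trans (sum_meets_le hG hN0 hB)
    exact mul_le_of_le_one_right (meets_nonneg ..) (ind_le_one ..)
  -- The square root of the variance bound `cvar_edgeImage_ge`.
  have hsd : M * p ^ e * √(1 - p) / √ψ ≤ vv * √c := by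
    refine le_of_sq_le_sq ?_ (by positivity)
    rw [div_pow, mul_pow _ √(1 - p), Real.sq_sqrt hq.le, Real.sq_sqrt hψ.le, mul_pow vv,
      Real.sq_sqrt hv.le]
    exact hge
  have hqs : 1 - p ≤ √(1 - p) := Real.le_sqrt_of_sq_le (by nlinarith)
  have hs : 0 < √c := Real.sqrt_pos.2 hv
  have hψs : 0 < √ψ := Real.sqrt_pos.2 hψ
  rw [loss, ← mul_assoc, mul_comm t, mul_assoc, inv_mul_le_iff₀ hs]
  -- At most K N^{v-2} embeddings are affected, and the factor N² in the range of `t` compensates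
  -- for that; what is left is at most a constant times the standard deviation.
  calc t * _ ≤ t * (K * (M / (N : ℝ) ^ 2)) := mul_le_mul_of_nonneg_left hsum ht
    _ ≤ (1 - p) * (N : ℝ) ^ 2 * p ^ e / √ψ * (K * (M / (N : ℝ) ^ 2)) := by gcongr
    _ = K * (M * p ^ e * (1 - p) / √ψ) := by field_simp
    _ ≤ K * (M * p ^ e * √(1 - p) / √ψ) := by gcongr
    _ ≤ K * (vv * √c) := by gcongr
    _ = _ := by ring

theorem sumBounds_edgeImage (hG : G.edgeSet.Nonempty) (hN0 : 0 < N) (hp : 0 < p) (hp1 : p < 1)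
    (hψ1 : 1 ≤ psi G N p) :
    SumBounds p (edgeImage G : (V ↪ Fin N) → Finset (Edge N)) G.edgeSet.ncard
      (embConst (Fintype.card V) G.edgeSet.ncard *
        ((N : ℝ) ^ Fintype.card V * p ^ G.edgeSet.ncard / psi G N p))
      ((embConst (Fintype.card V) G.edgeSet.ncard + 1) *
        ((N : ℝ) ^ Fintype.card V * p ^ G.edgeSet.ncard)) where
  p_nonneg := hp.le
  p_le_one := hp1.le
  card_le φ := (card_edgeImage φ).le
  nonneg₁ := by
    have := embConst_nonneg (Fintype.card V) G.edgeSet.ncard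
    have := psi_pos hG hN0 hp
    positivity
  nonneg₂ := by
    have := embConst_nonneg (Fintype.card V) G.edgeSet.ncard
    positivity
  sum_meets U hU := sum_meets_edgeImage_le hG hN0 hp (by omega)
  sum_all U hU := sum_pow_edgeImage_le hG hN0 hp hψ1 (by omega)

/-- Here L₁/L₂ is at most 1/ψ, and L₁L₂(1-p) is of the order of the lower bound for the variance.
The condition ψ ≥ 1 gives L₁ ≤ L₂. -/
theorem exists_tiltedErrors_edgeImage (hG : G.edgeSet.Nonempty) :
    ∃ C : ℝ, 0 ≤ C ∧ ∀ (N : ℕ) (p z : ℝ), Fintype.card V ≤ N → 0 < N → 0 < p → p < 1 →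
      1 ≤ psi G N p → z ≤ (1 - p) * (N : ℝ) ^ 2 * p ^ G.edgeSet.ncard / √(psi G N p) →
      ∀ t, 0 ≤ t → t ≤ z → TiltedErrors p (edgeImage G : (V ↪ Fin N) → Finset (Edge N)) t
        (C * (1 / √(psi G N p * (1 - p)) * (1 + z / √(1 - p)))) := by
  have hK := embConst_pos (Fintype.card V) G.edgeSet.ncard
  set e := G.edgeSet.ncard
  set v := Fintype.card V
  set K := embConst v e
  set vv : ℝ := (v : ℝ) ^ v
  refine ⟨momentConst e (K * vv) (e + 1) (K * (K + 1) * vv ^ 2 + 1), Real.sqrt_nonneg _,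
    fun N p z hN hN0 hp hp1 hψ1 hz t ht htz => ?_⟩
  have hψ := psi_pos hG hN0 hp
  have hq : 0 < 1 - p := sub_pos.2 hp1
  have hNr : (0 : ℝ) < N := by exact_mod_cast hN0
  have hv := cvar_edgeImage_pos hG hN hN0 hp hp1
  have hge := cvar_edgeImage_ge hG hN hp hp1.le
  have hP : 0 < (N : ℝ) ^ v * p ^ e := by positivity
  have h := tiltedErrors (sumBounds_edgeImage hG hN0 hp hp1 hψ1) ht
    (fun B hB A => mul_loss_edgeImage_le hG hN hN0 hp hp1 ht (htz.trans hz) hB A) hv hp1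
    (by positivity)
    (mul_le_mul (by linarith) (div_le_self hP.le hψ1) (div_pos hP hψ).le (by linarith))
    (K := K * (K + 1) * vv ^ 2 + 1)
    (by have : 0 ≤ K * (K + 1) * vv ^ 2 := by positivity
        linarith)
    (by
      calc K * ((N : ℝ) ^ v * p ^ e / psi G N p) * ((K + 1) * ((N : ℝ) ^ v * p ^ e)) * (1 - p)
          = K * (K + 1) * (((N : ℝ) ^ v * p ^ e) ^ 2 * (1 - p) / psi G N p) := by ring
        _ ≤ K * (K + 1) *
            (vv ^ 2 * cvar p (edgeImage G : (V ↪ Fin N) → Finset (Edge N))) := by gcongr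
        _ ≤ _ := by linarith)
  refine h.mono hp.le hp1 (mul_le_mul_of_nonneg_left ?_ (Real.sqrt_nonneg _))
  have h1 : √(K * ((N : ℝ) ^ v * p ^ e / psi G N p) /
      ((K + 1) * ((N : ℝ) ^ v * p ^ e) * (1 - p))) ≤ 1 / √(psi G N p * (1 - p)) := by
    rw [one_div (√_), ← Real.sqrt_inv, ← one_div]
    refine Real.sqrt_le_sqrt ?_
    have e1 : K * ((N : ℝ) ^ v * p ^ e / psi G N p) / ((K + 1) * ((N : ℝ) ^ v * p ^ e) * (1 - p)) =
        K / (K + 1) * (1 / (psi G N p * (1 - p))) := by field_simp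
    rw [e1]
    exact mul_le_of_le_one_left (by positivity) ((div_le_one (by positivity)).2 (by linarith))
  gcongr

end TiltedSubgraphCounts

end SubgraphCount

namespace SubgraphCount

open Finset

/-! ### Comparison of the tilted error with the stated rates. -/

section Rates

variable {V : Type*} [Fintype V] {G : SimpleGraph V} {N : ℕ} {p z : ℝ}

omit [Fintype V] in
theorem b_zero : b G N p 0 = berryEsseenRate G N p := by
  unfold b berryEsseenRate
  split_ifs <;> simp

omit [Fintype V] in
theorem berryEsseenRate_le_b (hz : 0 ≤ z) : berryEsseenRate G N p ≤ b G N p z := by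
  unfold b berryEsseenRate
  split_ifs
  · exact le_mul_of_one_le_right (by positivity) (by linarith)
  · exact le_mul_of_one_le_right (by positivity)
      (by have : 0 ≤ z / √(1 - p) := by positivity
          linarith)

/-- From ψ ≥ N²p^e and p ≥ 1/2. The power of 2 is not optimal. -/
theorem le_two_pow_mul_sqrt_psi (hG : G.edgeSet.Nonempty) (hN0 : 0 < N) (hp : 1 / 2 ≤ p)
    (hp1 : p ≤ 1) : (N : ℝ) ≤ 2 ^ G.edgeSet.ncard * √(psi G N p) := by
  have h := le_psi hG hN0 (by linarith) hp1
  set e := G.edgeSet.ncard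
  have h2 : 1 ≤ (2 : ℝ) ^ e * p ^ e := by
    rw [← mul_pow]; exact one_le_pow₀ (by linarith)
  have h3 : (1 : ℝ) ≤ 2 ^ e := one_le_pow₀ (by norm_num)
  have hψ : 0 ≤ psi G N p := le_trans (by positivity) h
  refine le_of_sq_le_sq ?_ (by positivity)
  rw [mul_pow, Real.sq_sqrt hψ]
  calc (N : ℝ) ^ 2 ≤ (N : ℝ) ^ 2 * (2 ^ e * p ^ e) := le_mul_of_one_le_right (by positivity) h2
    _ = 2 ^ e * ((N : ℝ) ^ 2 * p ^ e) := by ring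
    _ ≤ 2 ^ e * psi G N p := by gcongr
    _ ≤ (2 ^ e) ^ 2 * psi G N p := by
      gcongr
      rw [sq]; exact le_mul_of_one_le_left (by positivity) h3

/-- For p ≤ 1/2 the factors √(1-p) are bounded below and can be dropped; for p > 1/2 the quantity √ψ
is at least of order N. -/
theorem tilted_rate_le_b (hG : G.edgeSet.Nonempty) (hN0 : 0 < N) (hp : 0 < p) (hp1 : p < 1)
    (hz : 0 ≤ z) :
    1 / √(psi G N p * (1 - p)) * (1 + z / √(1 - p)) ≤
      4 * 2 ^ G.edgeSet.ncard * b G N p z := by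
  have hψ := psi_pos hG hN0 hp
  have hq : 0 < 1 - p := sub_pos.2 hp1
  have hqs : 0 < √(1 - p) := Real.sqrt_pos.2 hq
  have hψs : 0 < √(psi G N p) := Real.sqrt_pos.2 hψ
  have hNr : (0 : ℝ) < N := by exact_mod_cast hN0
  have h3 : (1 : ℝ) ≤ 2 ^ G.edgeSet.ncard := one_le_pow₀ (by norm_num)
  rw [Real.sqrt_mul hψ.le]
  unfold b
  split_ifs with h
  · have hq2 : 1 / 2 ≤ √(1 - p) := Real.le_sqrt_of_sq_le (by linarith)
    have h4 : z / √(1 - p) ≤ 2 * z := by rw [div_le_iff₀ hqs]; nlinarith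
    have h5 : 1 / (√(psi G N p) * √(1 - p)) ≤ 2 * (1 / √(psi G N p)) := by
      rw [div_le_iff₀ (by positivity)]
      have e1 : 2 * (1 / √(psi G N p)) * (√(psi G N p) * √(1 - p)) = 2 * √(1 - p) := by
        field_simp
      rw [e1]; linarith
    calc 1 / (√(psi G N p) * √(1 - p)) * (1 + z / √(1 - p))
        ≤ 2 * (1 / √(psi G N p)) * (2 * (1 + z)) := by
          gcongr; linarith
      _ = 4 * 1 * (1 / √(psi G N p) * (1 + z)) := by ring
      _ ≤ _ := by gcongr
  · have h1 := le_two_pow_mul_sqrt_psi hG hN0 (not_le.1 h).le hp1.le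
    have h5 : 1 / (√(psi G N p) * √(1 - p)) ≤ 2 ^ G.edgeSet.ncard * (1 / (N * √(1 - p))) := by
      rw [mul_one_div, div_le_div_iff₀ (by positivity) (by positivity), one_mul, ← mul_assoc]
      gcongr
    calc 1 / (√(psi G N p) * √(1 - p)) * (1 + z / √(1 - p))
        ≤ 2 ^ G.edgeSet.ncard * (1 / (N * √(1 - p))) * (1 + z / √(1 - p)) := by gcongr
      _ = 1 * 2 ^ G.edgeSet.ncard * (1 / (N * √(1 - p)) * (1 + z / √(1 - p))) := by ring
      _ ≤ _ := by
        gcongr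
        norm_num

/-- When ψ ≤ 1 the rate is bounded below, so the theorem only asks for bounded errors. -/
theorem one_le_two_pow_mul_berryEsseenRate (hG : G.edgeSet.Nonempty) (hN0 : 0 < N) (hp : 0 < p)
    (hp1 : p < 1) (hψ1 : psi G N p ≤ 1) :
    1 ≤ 2 ^ G.edgeSet.ncard * berryEsseenRate G N p := by
  have hψ := psi_pos hG hN0 hp
  have hψs : 0 < √(psi G N p) := Real.sqrt_pos.2 hψ
  have hψs1 : √(psi G N p) ≤ 1 := Real.sqrt_le_one.2 hψ1
  have hqs : 0 < √(1 - p) := Real.sqrt_pos.2 (sub_pos.2 hp1)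
  have hqs1 : √(1 - p) ≤ 1 := Real.sqrt_le_one.2 (by linarith)
  have hNr : (0 : ℝ) < N := by exact_mod_cast hN0
  unfold berryEsseenRate
  split_ifs with h
  · exact one_le_mul_of_one_le_of_one_le (one_le_pow₀ (by norm_num))
      ((one_le_div hψs).2 hψs1)
  · have h1 := le_two_pow_mul_sqrt_psi hG hN0 (not_le.1 h).le hp1.le
    rw [mul_one_div, one_le_div (by positivity)]
    calc (N : ℝ) * √(1 - p) ≤ N * 1 := by gcongr
      _ ≤ 2 ^ G.edgeSet.ncard * √(psi G N p) := by simpa using h1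
      _ ≤ 2 ^ G.edgeSet.ncard * 1 := by gcongr
      _ = _ := mul_one _

end Rates

/-! ### Transfer to the law of `W`, and crude bounds. -/

section Distribution

variable {V : Type*} [Fintype V] (G : SimpleGraph V) (N : ℕ) (p : unitInterval) (z : ℝ)

theorem binomialRandom_real_W_le :
    (SimpleGraph.binomialRandom (Fin N) p).real {Γ | W G N p Γ ≤ z} =
      expect (p : ℝ) (fun A => if std (p : ℝ) (edgeImage G : (V ↪ Fin N) → Finset (Edge N)) A ≤ z
        then 1 else 0) := by
  simp only [W_eq_std]
  rw [binomialRandom_real p fun A => std (p : ℝ) (edgeImage G : (V ↪ Fin N) → _) A ≤ z]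

theorem binomialRandom_real_lt_W :
    (SimpleGraph.binomialRandom (Fin N) p).real {Γ | z < W G N p Γ} =
      expect (p : ℝ) (fun A => if z < std (p : ℝ) (edgeImage G : (V ↪ Fin N) → Finset (Edge N)) A
        then 1 else 0) := by
  simp only [W_eq_std]
  rw [binomialRandom_real p fun A => z < std (p : ℝ) (edgeImage G : (V ↪ Fin N) → _) A]

variable {G N p z}

theorem abs_W_cdf_sub_le {ε : ℝ} (hp : (p : ℝ) < 1)
    (hv : 0 < cvar (p : ℝ) (edgeImage G : (V ↪ Fin N) → Finset (Edge N)))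
    (he : TiltedErrors (p : ℝ) (edgeImage G : (V ↪ Fin N) → Finset (Edge N)) 0 ε) (z : ℝ) :
    |(SimpleGraph.binomialRandom (Fin N) p).real {Γ | W G N p Γ ≤ z} - Phi z| ≤ 8 * ε := by
  have := abs_tilted_cdf_sub_le p.2.1 hp.le hv le_rfl he z
  rw [binomialRandom_real_W_le]
  simpa [mgfStd_zero] using this

theorem abs_measureReal_sub_Phi_le_one (s : Set (SimpleGraph (Fin N))) :
    |(SimpleGraph.binomialRandom (Fin N) p).real s - Phi z| ≤ 1 := by
  have h1 := Phi_nonneg z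
  have h2 := Phi_le_one z
  have h3 : (SimpleGraph.binomialRandom (Fin N) p).real s ≤ 1 := measureReal_le_one
  have h4 : 0 ≤ (SimpleGraph.binomialRandom (Fin N) p).real s := measureReal_nonneg
  rw [abs_le]
  constructor <;> linarith

theorem abs_measureReal_div_sub_one_le (s : Set (SimpleGraph (Fin N))) {T : ℝ} (hz : z ≤ T) :
    |(SimpleGraph.binomialRandom (Fin N) p).real s / (1 - Phi z) - 1| ≤ 1 / (1 - Phi T) + 1 := by
  have h3 : (SimpleGraph.binomialRandom (Fin N) p).real s ≤ 1 := measureReal_le_one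
  have h4 : 0 ≤ (SimpleGraph.binomialRandom (Fin N) p).real s := measureReal_nonneg
  have hQ := one_sub_Phi_pos T
  have hQz := one_sub_Phi_pos z
  have hm : Phi z ≤ Phi T := monotone_cdf _ hz
  have h5 : (SimpleGraph.binomialRandom (Fin N) p).real s / (1 - Phi z) ≤ 1 / (1 - Phi T) := by
    gcongr
  have h6 : 0 ≤ (SimpleGraph.binomialRandom (Fin N) p).real s / (1 - Phi z) := by positivity
  rw [abs_le]
  constructor <;> linarith

end Distribution

end SubgraphCount

/-! ### The main theorem. -/

open SubgraphCount in
theorem theorem3p1 {V : Type*} [Fintype V] (G : SimpleGraph V) (hG : G.edgeSet.Nonempty) :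
    ∃ C : ℝ, 0 < C ∧
      ∀ (N : ℕ) (p : unitInterval), Fintype.card V ≤ N → 0 < (p : ℝ) → (p : ℝ) < 1 →
        (⨆ z : ℝ, |(SimpleGraph.binomialRandom (Fin N) p).real
              {Γ | SubgraphCount.W G N p Γ ≤ z} - SubgraphCount.Phi z|)
            ≤ C * SubgraphCount.berryEsseenRate G N p ∧
        ∀ z : ℝ, 0 ≤ z →
          z ≤ (1 - (p : ℝ)) * (N : ℝ) ^ 2 * (p : ℝ) ^ G.edgeSet.ncard
              / √(SubgraphCount.psi G N p) →
          (1 + z ^ 2) * SubgraphCount.b G N p z ≤ 1 →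
          |(SimpleGraph.binomialRandom (Fin N) p).real {Γ | z < SubgraphCount.W G N p Γ}
              / (1 - SubgraphCount.Phi z) - 1|
            ≤ C * ((1 + z ^ 2) * SubgraphCount.b G N p z) := by
  obtain ⟨C₁, hC₁, hT⟩ := exists_tiltedErrors_edgeImage hG
  have hV : 0 < Fintype.card V := by
    obtain ⟨f, _⟩ := hG
    induction f with | _ a b => exact Fintype.card_pos_iff.2 ⟨a⟩
  set e := G.edgeSet.ncard
  set a : ℝ := 2 ^ e with ha
  have ha1 : 1 ≤ a := one_le_pow₀ (by norm_num)
  set C₂ := C₁ * (4 * a)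
  have hC₂ : 0 ≤ C₂ := by positivity
  have hκ := one_sub_Phi_pos a
  set κ := 1 / (1 - Phi a) + 1
  have hκ0 : 0 < κ := by positivity
  set X := Real.exp (2 * C₂)
  have hX : 0 < X := Real.exp_pos _
  have hX2 : 0 ≤ 260 * X * C₂ := by positivity
  have hκa : 0 < κ * a := by positivity
  -- One summand for each case: the Berry–Esseen bound for ψ ≥ 1 and for ψ ≤ 1, then the tail bound
  -- for ψ ≥ 1 and for ψ ≤ 1.
  refine ⟨8 * C₂ + a + 260 * X * C₂ + κ * a, by positivity, fun N p hN hp hp1 => ?_⟩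
  have hN0 : 0 < N := hV.trans_le hN
  have hv := cvar_edgeImage_pos hG hN hN0 hp hp1
  have hq : 0 < 1 - (p : ℝ) := sub_pos.2 hp1
  have hR : 0 ≤ berryEsseenRate G N p := by
    unfold berryEsseenRate
    split_ifs <;> positivity
  have hb : ∀ z, 0 ≤ z → 0 ≤ b G N p z := fun z hz => hR.trans (berryEsseenRate_le_b hz)
  have hrange : 0 ≤ (1 - (p : ℝ)) * (N : ℝ) ^ 2 * (p : ℝ) ^ e / √(psi G N p) := by positivity
  have hTb : 1 ≤ psi G N p → ∀ z, 0 ≤ z →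
      z ≤ (1 - (p : ℝ)) * (N : ℝ) ^ 2 * (p : ℝ) ^ e / √(psi G N p) → ∀ t, 0 ≤ t → t ≤ z →
      TiltedErrors (p : ℝ) (edgeImage G : (V ↪ Fin N) → Finset (Edge N)) t (C₂ * b G N p z) :=
    fun hψ z hz hz' t ht htz => (hT N p z hN hN0 hp hp1 hψ hz' t ht htz).mono hp.le hp1 <| by
      rw [mul_assoc]
      exact mul_le_mul_of_nonneg_left (tilted_rate_le_b hG hN0 hp hp1 hz) hC₁
  constructor
  · refine ciSup_le fun z => ?_
    rcases le_total 1 (psi G N p) with hψ | hψ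
    · have h := hTb hψ 0 le_rfl hrange 0 le_rfl le_rfl
      rw [b_zero] at h
      calc _ ≤ 8 * (C₂ * berryEsseenRate G N p) := abs_W_cdf_sub_le hp1 hv h z
        _ = 8 * C₂ * berryEsseenRate G N p := by ring
        _ ≤ _ := by gcongr; linarith
    · calc _ ≤ (1 : ℝ) := abs_measureReal_sub_Phi_le_one _
        _ ≤ a * berryEsseenRate G N p := one_le_two_pow_mul_berryEsseenRate hG hN0 hp hp1 hψ
        _ ≤ _ := by gcongr; linarith
  · intro z hz hz' hzb
    have hbz := hb z hz
    have hzb0 : 0 ≤ (1 + z ^ 2) * b G N p z := by positivity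
    rcases le_total 1 (psi G N p) with hψ | hψ
    · rw [binomialRandom_real_lt_W]
      have hε : 0 ≤ C₂ * b G N p z := by positivity
      -- The condition (1 + z²)b ≤ 1 is what keeps z²ε, and with it the factor e^{2D}, bounded.
      have hD : z ^ 2 * (C₂ * b G N p z) ≤ C₂ := by
        calc z ^ 2 * (C₂ * b G N p z) = C₂ * (z ^ 2 * b G N p z) := by ring
          _ ≤ C₂ * 1 := by gcongr; linarith
          _ = C₂ := mul_one _
      calc _ ≤ 130 * X * ((1 + z) ^ 2 * (C₂ * b G N p z)) :=
            abs_tail_div_sub_one_le hp.le hp1 hv hz hε (hTb hψ z hz hz') hD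
        _ ≤ 130 * X * (2 * (1 + z ^ 2) * (C₂ * b G N p z)) := by
            gcongr
            nlinarith [sq_nonneg (1 - z)]
        _ = 260 * X * C₂ * ((1 + z ^ 2) * b G N p z) := by ring
        _ ≤ _ := by gcongr; linarith
    · have h1 := one_le_two_pow_mul_berryEsseenRate hG hN0 hp hp1 hψ
      have h2 : 1 ≤ a * b G N p z := h1.trans (by gcongr; exact berryEsseenRate_le_b hz)
      -- Since b ≥ 1/a, the condition (1 + z²)b ≤ 1 confines z to a bounded interval, on which the
      -- normal tail is bounded below.
      have h3 : 1 + z ^ 2 ≤ a := by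
        calc 1 + z ^ 2 ≤ (1 + z ^ 2) * (a * b G N p z) := le_mul_of_one_le_right (by positivity) h2
          _ = a * ((1 + z ^ 2) * b G N p z) := by ring
          _ ≤ a * 1 := by gcongr
          _ = a := mul_one _
      have hza : z ≤ a := by nlinarith
      calc _ ≤ κ := abs_measureReal_div_sub_one_le _ hza
        _ ≤ κ * (a * ((1 + z ^ 2) * b G N p z)) := by
            refine le_mul_of_one_le_right hκ0.le ?_
            nlinarith [mul_nonneg (sq_nonneg z) (zero_le_one.trans h2)]
        _ = κ * a * ((1 + z ^ 2) * b G N p z) := by ring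
        _ ≤ _ := by gcongr; linarith
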